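/- Let $\kappa,\tau\in\mathbb R$ with $\tau\neq 0$ and $\kappa>4\tau^2$, and let $E(\kappa,\tau)$ be the simply connected homogeneous $3$-manifold (Berger sphere) that is the total space of a Riemannian submersion $\Pi:E(\kappa,\tau)\to\mathbb S^2(\kappa)$ over the $2$-sphere of constant curvature $\kappa$, with bundle curvature $\tau$ and vertical unit Killing field $\xi$; concretely, it is the unit sphere $\mathbb S^3\subset\mathbb C^2$ with the metric $$\langle X,Y\rangle=\frac4\kappa\Big[\langle X,Y\rangle_{\mathbb S^3}+\Big(\frac{4\tau^2}{\kappa}-1\Big)\langle X,V\rangle_{\mathbb S^3}\langle Y,V\rangle_{\mathbb S^3}\Big],\qquad V_{(z,w)}=(iz,iw),$$ $\xi=\frac{\kappa}{4\tau}V$, and $\Pi$ is the Hopf fibration onto the sphere of radius $1/\sqrt\kappa$ in $\mathbb R^3$. Let $f:M\to E(\kappa,\tau)$ be a smooth immersion of a compact connected surface (without boundary) with constant mean curvature $H=\frac12\operatorname{tr}A$, where $A$ is the second fundamental form with respect to a (local) unit normal field $N$, and let $C=\langle\xi,N\rangle$ (so that $|A|^2$ and $C^2$ do not depend on the choice of $N$).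 Let $a(\kappa,\tau,H,C)<b(\kappa,\tau,H,C)$ be the two real roots of $$x^2-\big[2(H^2+\tau^2)+(\kappa-4\tau^2)(5C^2-1)\big]x+2(\kappa-4\tau^2)(H^2+\tau^2)(3C^2-1)=0 .$$ If $$a(\kappa,\tau,H,C)+2H^2\le |A|^2\le b(\kappa,\tau,H,C)+2H^2$$ everywhere on $M$, then $M$ is a Hopf cylinder, that is, $f(M)=\Pi^{-1}(\gamma)$ for a regular closed curve $\gamma$ in $\mathbb S^2(\kappa)$, and $|A|^2=2(2H^2+\tau^2)$ on $M$. In particular, if $3H^2+\tau^2\le|A|^2\le 2(2H^2+\tau^2)$ everywhere on $M$, then $M$ is a Hopf cylinder with $|A|^2=2(2H^2+\tau^2)$. -/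

import Mathlib

open scoped Manifold ContDiff

noncomputable section

namespace Berger

/-- Euclidean `ℝ⁴ = ℂ²`, a vector `x` being the pair `(z, w) = (x₀ + i x₁, x₂ + i x₃)`. -/
abbrev R4 : Type := EuclideanSpace ℝ (Fin 4)

/-- Euclidean `ℝ³`. -/
abbrev R3 : Type := EuclideanSpace ℝ (Fin 3)

/-- The unit sphere `𝕊³ ⊂ ℂ²`, with the smooth structure of Mathlib. For `κ > 0` and `τ ≠ 0` it is
the underlying manifold of `E(κ,τ)`. -/
abbrev S3 : Type := Metric.sphere (0 : R4) 1

/-- The field `(iz, iw)`, tangent to the Hopf fibration, of Euclidean unit length on `𝕊³`. -/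
def hopfField (x : R4) : R4 := !₂[-x 1, x 0, -x 3, x 2]

/-- The Riemannian metric of the Berger sphere `E(κ,τ)` at the point `x ∈ 𝕊³`,
`(4/κ) (⟨v,w⟩ + (4τ²/κ - 1) ⟨v,(iz,iw)⟩ ⟨w,(iz,iw)⟩)`, for vectors `v, w` tangent to `𝕊³` at `x`. -/
def metric (κ τ : ℝ) (x v w : R4) : ℝ :=
  4 / κ * (inner ℝ v w
    + (4 * τ ^ 2 / κ - 1) * (inner ℝ v (hopfField x) * inner ℝ w (hopfField x)))

/-- The vertical unit Killing field `ξ` of `E(κ,τ)`. -/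
def xi (κ τ : ℝ) (x : R4) : R4 := (κ / (4 * τ)) • hopfField x

/-- The global orthonormal frame `f₁, f₂, f₃ = ξ` of `E(κ,τ)`, as (linear) vector fields on `ℝ⁴`
that are tangent to `𝕊³`. -/
def frame (κ τ : ℝ) (i : Fin 3) (x : R4) : R4 :=
  match i with
  | 0 => (√κ / 2) • !₂[-x 2, x 3, x 0, -x 1]
  | 1 => (√κ / 2) • !₂[-x 3, -x 2, x 1, x 0]
  | 2 => xi κ τ x

/-- The Lie brackets of the frame. The fields are tangent to `𝕊³`, so their bracket in `ℝ⁴`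
is, along `𝕊³`, their bracket in `𝕊³`. -/
def frameBracket (κ τ : ℝ) (i j : Fin 3) (x : R4) : R4 :=
  VectorField.lieBracket ℝ (frame κ τ i) (frame κ τ j) x

/-- The coefficients `⟨∇_{fᵢ} fⱼ, fₖ⟩` of the Levi-Civita connection of `E(κ,τ)` in the orthonormal
frame, by Koszul's formula. -/
def connCoeff (κ τ : ℝ) (x : R4) (i j k : Fin 3) : ℝ :=
  (metric κ τ x (frameBracket κ τ i j x) (frame κ τ k x)
    - metric κ τ x (frameBracket κ τ j k x) (frame κ τ i x)
    + metric κ τ x (frameBracket κ τ k i x) (frame κ τ j x)) / 2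

/-- The Hopf fibration `Π : E(κ,τ) → 𝕊²(κ)`,
`(z, w) ↦ κ^{-1/2} (2 Re (z w̄), 2 Im (z w̄), |z|² - |w|²)`, onto the sphere of radius `1/√κ`
in `ℝ³`. -/
def hopfMap (κ : ℝ) (x : R4) : R3 :=
  (1 / √κ) • !₂[2 * (x 0 * x 2 + x 1 * x 3), 2 * (x 1 * x 2 - x 0 * x 3),
    x 0 ^ 2 + x 1 ^ 2 - x 2 ^ 2 - x 3 ^ 2]

theorem sphere_sum_sq (x : S3) :
    (x : R4) 0 ^ 2 + (x : R4) 1 ^ 2 + (x : R4) 2 ^ 2 + (x : R4) 3 ^ 2 = 1 := by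
  have h : ‖(x : R4)‖ = 1 := by simp
  have h2 := EuclideanSpace.norm_sq_eq (x : R4)
  rw [h, Fin.sum_univ_four] at h2
  simpa using h2.symm

theorem inner_R4 (v w : R4) :
    inner ℝ v w = v 0 * w 0 + v 1 * w 1 + v 2 * w 2 + v 3 * w 3 := by
  simp [PiLp.inner_apply, Fin.sum_univ_four, mul_comm]

/-- The frame is tangent to `𝕊³`. -/
theorem inner_frame_self (κ τ : ℝ) (i : Fin 3) (x : R4) : inner ℝ (frame κ τ i x) x = 0 := by
  rw [inner_R4]
  fin_cases i <;> simp [frame, xi, hopfField] <;> ring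

/-- The frame is orthonormal for the metric of `E(κ,τ)`. -/
theorem metric_frame {κ τ : ℝ} (hκ : 0 < κ) (hτ : τ ≠ 0) (x : S3) (i j : Fin 3) :
    metric κ τ x (frame κ τ i x) (frame κ τ j x) = if i = j then 1 else 0 := by
  have h := sphere_sum_sq x
  obtain ⟨s, hs, rfl⟩ : ∃ s : ℝ, 0 < s ∧ κ = s ^ 2 :=
    ⟨√κ, Real.sqrt_pos.2 hκ, (Real.sq_sqrt hκ.le).symm⟩
  have hs0 : s ≠ 0 := hs.ne'
  have hsq : √(s ^ 2) = s := Real.sqrt_sq hs.le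
  generalize (x : R4) = y at h
  generalize h0 : y 0 = a at h
  generalize h1 : y 1 = b at h
  generalize h2 : y 2 = c at h
  generalize h3 : y 3 = d at h
  have ha : a ^ 2 = 1 - b ^ 2 - c ^ 2 - d ^ 2 := by linarith
  simp only [metric, inner_R4]
  fin_cases i <;> fin_cases j <;>
    simp [frame, xi, hopfField, hsq, h0, h1, h2, h3] <;> field_simp <;> (try ring_nf) <;>
    (try simp only [show a ^ 4 = (a ^ 2) ^ 2 by ring, ha]) <;> (try ring_nf) <;> (try simp)

/-- The Hopf fibration takes values in the sphere of radius `1/√κ`. -/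
theorem hopfMap_mem (κ : ℝ) (x : S3) :
    hopfMap κ x ∈ Metric.sphere (0 : R3) (1 / √κ) := by
  have h := sphere_sum_sq x
  generalize (x : R4) = y at h
  have h1 : ‖(!₂[2 * (y 0 * y 2 + y 1 * y 3), 2 * (y 1 * y 2 - y 0 * y 3),
      y 0 ^ 2 + y 1 ^ 2 - y 2 ^ 2 - y 3 ^ 2] : R3)‖ = 1 := by
    rw [EuclideanSpace.norm_eq, Real.sqrt_eq_one]
    simp only [Fin.sum_univ_three, Real.norm_eq_abs, sq_abs]
    simp
    linear_combination (y 0 ^ 2 + y 1 ^ 2 + y 2 ^ 2 + y 3 ^ 2 + 1) * h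
  rw [mem_sphere_zero_iff_norm, hopfMap, norm_smul, h1, mul_one, Real.norm_of_nonneg]
  positivity

section Surface

variable {M : Type*} [TopologicalSpace M] [ChartedSpace (EuclideanSpace ℝ (Fin 2)) M]

/-- `f : M → 𝕊³` is a smooth immersion of a surface. -/
def IsSmoothImmersion (f : M → S3) : Prop :=
  ContMDiff (𝓡 2) (𝓡 3) ∞ f ∧ ∀ x, Function.Injective (mfderiv (𝓡 2) (𝓡 3) f x)

/-- The differential of `f` at `x`, with values in `ℝ⁴`. -/
def diff (f : M → S3) (x : M) (v : TangentSpace (𝓡 2) x) : R4 :=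
  mfderiv (𝓡 2) 𝓘(ℝ, R4) (fun y => (f y : R4)) x v

/-- `N` is a smooth unit normal vector field, on the open set `U ⊆ M`, of the immersion `f` in
`E(κ,τ)`: it is a vector field along `f`, tangent to `𝕊³`, of length one, and orthogonal to `f`. -/
structure IsUnitNormalOn (κ τ : ℝ) (f : M → S3) (U : Set M) (N : M → R4) : Prop where
  isOpen : IsOpen U
  smooth : ContMDiffOn (𝓡 2) 𝓘(ℝ, R4) ∞ N U
  tangent : ∀ x ∈ U, inner ℝ (N x) (f x : R4) = 0
  unit : ∀ x ∈ U, metric κ τ (f x) (N x) (N x) = 1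
  normal : ∀ x ∈ U, ∀ v : TangentSpace (𝓡 2) x, metric κ τ (f x) (N x) (diff f x v) = 0

/-- The derivative `v(u)` at `x` of a function `u` on `M`. -/
def dirDeriv (u : M → ℝ) (x : M) (v : TangentSpace (𝓡 2) x) : ℝ :=
  mfderiv (𝓡 2) 𝓘(ℝ, ℝ) u x v

/-- The components, in the orthonormal frame, of a vector field `N` along `f`. -/
def comp (κ τ : ℝ) (f : M → S3) (N : M → R4) (k : Fin 3) (x : M) : ℝ :=
  metric κ τ (f x) (N x) (frame κ τ k (f x))

/-- The covariant derivative `∇_v N`, for the Levi-Civita connection of `E(κ,τ)`, of a vector field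
`N = ∑ Nᵏ fₖ` along `f`, in the direction `v` tangent to `M`:
`∑ₖ (v(Nᵏ) + ∑ᵢⱼ df(v)ⁱ Nʲ ⟨∇_{fᵢ} fⱼ, fₖ⟩) fₖ`. -/
def covDeriv (κ τ : ℝ) (f : M → S3) (N : M → R4) (x : M) (v : TangentSpace (𝓡 2) x) : R4 :=
  ∑ k : Fin 3,
    (dirDeriv (comp κ τ f N k) x v
      + ∑ i : Fin 3, ∑ j : Fin 3,
          metric κ τ (f x) (diff f x v) (frame κ τ i (f x)) * comp κ τ f N j x
            * connCoeff κ τ (f x) i j k) • frame κ τ k (f x)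

/-- The second fundamental form `⟨A v, w⟩ = -⟨∇_v N, df(w)⟩` for the unit normal field `N`. -/
def secondForm (κ τ : ℝ) (f : M → S3) (N : M → R4) (x : M) (v w : TangentSpace (𝓡 2) x) : ℝ :=
  -metric κ τ (f x) (covDeriv κ τ f N x v) (diff f x w)

/-- The standard basis of `T_x M`, which is a copy of `ℝ²`. -/
def basisVec (x : M) (i : Fin 2) : TangentSpace (𝓡 2) x :=
  (EuclideanSpace.single i (1 : ℝ) : EuclideanSpace ℝ (Fin 2))

/-- The Gram matrix of the induced metric on `T_x M`. -/
def gramMatrix (κ τ : ℝ) (f : M → S3) (x : M) : Matrix (Fin 2) (Fin 2) ℝ :=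
  Matrix.of fun i j => metric κ τ (f x) (diff f x (basisVec x i)) (diff f x (basisVec x j))

/-- The matrix of the second fundamental form. -/
def secondFormMatrix (κ τ : ℝ) (f : M → S3) (N : M → R4) (x : M) : Matrix (Fin 2) (Fin 2) ℝ :=
  Matrix.of fun i j => secondForm κ τ f N x (basisVec x i) (basisVec x j)

/-- The matrix of the shape operator `A`, which is self-adjoint for the induced metric. -/
def shapeMatrix (κ τ : ℝ) (f : M → S3) (N : M → R4) (x : M) : Matrix (Fin 2) (Fin 2) ℝ :=
  (gramMatrix κ τ f x)⁻¹ * secondFormMatrix κ τ f N x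

/-- The mean curvature `H = tr A / 2`. -/
def meanCurvature (κ τ : ℝ) (f : M → S3) (N : M → R4) (x : M) : ℝ :=
  (shapeMatrix κ τ f N x).trace / 2

/-- The squared norm `|A|² = tr (A²)` of the second fundamental form. -/
def normSqA (κ τ : ℝ) (f : M → S3) (N : M → R4) (x : M) : ℝ :=
  (shapeMatrix κ τ f N x * shapeMatrix κ τ f N x).trace

/-- The angle function `C = ⟨ξ, N⟩`. -/
def angle (κ τ : ℝ) (f : M → S3) (N : M → R4) (x : M) : ℝ :=
  metric κ τ (f x) (xi κ τ (f x)) (N x)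

/-- `f` has constant mean curvature `H`: near each point there is a smooth unit normal field whose
mean curvature is constantly `H`. No global unit normal is asked for; if `H ≠ 0` the local ones
agree and form one. -/
def IsCMC (κ τ H : ℝ) (f : M → S3) : Prop :=
  ∀ x : M, ∃ (U : Set M) (N : M → R4), x ∈ U ∧ IsUnitNormalOn κ τ f U N ∧
    ∀ y ∈ U, meanCurvature κ τ f N y = H

/-- `M` is a Hopf cylinder: `f(M)` is the preimage under the Hopf fibration of a regular closed
curve in `𝕊²(κ)`. -/
def IsHopfCylinder (κ : ℝ) (f : M → S3) : Prop :=
  ∃ (γ : ℝ → R3) (L : ℝ), ContDiff ℝ ∞ γ ∧ 0 < L ∧ Function.Periodic γ L ∧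
    (∀ t, deriv γ t ≠ 0) ∧ (∀ t, γ t ∈ Metric.sphere (0 : R3) (1 / √κ)) ∧
    Set.range f = {q : S3 | hopfMap κ q ∈ Set.range γ}

end Surface

/-- The middle coefficient of the quadratic
`x² - [2(H²+τ²) + (κ-4τ²)(5C²-1)] x + 2(κ-4τ²)(H²+τ²)(3C²-1)`. -/
def quadB (κ τ H C : ℝ) : ℝ := 2 * (H ^ 2 + τ ^ 2) + (κ - 4 * τ ^ 2) * (5 * C ^ 2 - 1)

/-- The constant coefficient of the quadratic. -/
def quadC (κ τ H C : ℝ) : ℝ := 2 * (κ - 4 * τ ^ 2) * (H ^ 2 + τ ^ 2) * (3 * C ^ 2 - 1)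

/-- The smaller root of the quadratic. -/
def rootA (κ τ H C : ℝ) : ℝ :=
  (quadB κ τ H C - √(quadB κ τ H C ^ 2 - 4 * quadC κ τ H C)) / 2

/-- The larger root of the quadratic. -/
def rootB (κ τ H C : ℝ) : ℝ :=
  (quadB κ τ H C + √(quadB κ τ H C ^ 2 - 4 * quadC κ τ H C)) / 2

end Berger

end

/-! Write D = κ - 4τ² > 0, let φ be the trace-free part of A, so |φ|² = |A|² - 2H², and let q be the
quadratic of the statement. The heart is a Simons identity in divergence form: the tangent field X =
∇|A|² - 4DC(H ξᵀ - τ N×ξ) satisfies div X = 2 (D² C²(1 - C²) - q(|φ|²) + P² + Q²) for some functions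
P, Q. The Codazzi equations fix two combinations of the components of ∇φ, equal to D C times the
components of ξᵀ; the other two combinations are P and Q, and |∇φ|² = D² C²(1 - C²) + P² + Q². The
remaining terms come from the Gauss equation and from commuting derivatives.

Both pinching conditions give q(|φ|²) ≤ 0: the first because |φ|² lies between the roots, the second
because q ≤ 0 at H² + τ² and at 2(H² + τ²) and q is convex. Hence div X ≥ 0, and since M is compact,
div X = 0 and C²(1 - C²) = 0 everywhere. By connectedness C² is identically 0 or identically 1. The
value 1 is impossible, because the surface would be an integral surface of the horizontal
distribution, which has curvature proportional to τ ≠ 0 (`LocalSurface.not_horizontal`). So C = 0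
(`angle_eq_zero`), ξ is tangent to the surface, and in a basis (ξ, horizontal unit vector) the
second fundamental form has entries 0, ±τ, 2H, whence |A|² = 4H² + 2τ²
(`LocalSurface.normSq_of_vertical`).

It remains to find the whole image. When C = 0 the surface lies over a curve of constant geodesic
curvature 2H, up to sign, so over a circle. Concretely, with p = √κ Π, the vector H p + ½ dp(N) of
ℝ³ is constant on M (`axis`, `IsCMC.exists_axis`) and has product H with p. This places f(M) inside
a torus a e^{is} u + c e^{it} v of 𝕊³, with u, v a unitary basis of ℂ². An immersion of a surface
into it is open and M is compact, so f(M) is the whole torus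
(`IsSmoothImmersion.torus_subset_range`), which is the preimage of a circle.

The computations are polynomial identities in a commutative ℝ-algebra with derivations, applied to
the algebra of smooth functions on an open set of the plane. The surface is described by components
in the global frame f₁, f₂, f₃ = ξ of E(κ,τ), in which the Levi-Civita connection is ∇_a n = a(n) +
t a×n + m a₃ ξ×n, with t = -τ and m = 2τ - κ/(2τ), so that 2tm = D.

No orientation is assumed: |A|², HC and the products of C with the components of N are the same for
every local normal of mean curvature H, and X is integrated as a density, which changes by |det|
between charts. -/

noncomputable section

/-! ### Gauss, Codazzi and Simons identities in an adapted frame. -/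

namespace Berger

/-- The Codazzi equations, from the structure equations of an adapted frame. -/
theorem frame_codazzi {R : Type*} [CommRing R] [Algebra ℝ R] (E₁ E₂ : Derivation ℝ R R)
    {t m H T₁ T₂ C p₁ p₂ q₁ q₂ r₁ r₂ ω₁ ω₂ α β : R}
    (ht₁ : E₁ t = 0) (ht₂ : E₂ t = 0) (hm₁ : E₁ m = 0) (hm₂ : E₂ m = 0)
    (hH₁ : E₁ H = 0) (hH₂ : E₂ H = 0)
    (hp₁ : p₁ = ω₁ - m * T₁ * C) (hp₂ : p₂ = ω₂ - m * T₂ * C)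
    (hq₁ : q₁ = H + α + m * T₁ * T₂) (hq₂ : q₂ = β + t + m * T₂ * T₂)
    (hr₁ : r₁ = β - t - m * T₁ * T₁) (hr₂ : r₂ = H - α - m * T₁ * T₂)
    (h11 : E₁ T₁ = p₁ * T₂ + q₁ * C) (h12 : E₁ T₂ = -p₁ * T₁ + r₁ * C)
    (h21 : E₂ T₁ = p₂ * T₂ + q₂ * C) (h22 : E₂ T₂ = -p₂ * T₁ + r₂ * C)
    (hC₁ : E₁ C = -q₁ * T₁ - r₁ * T₂) (hC₂ : E₂ C = -q₂ * T₁ - r₂ * T₂)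
    (fp : E₁ p₂ - E₂ p₁ - q₂ * r₁ + q₁ * r₂ = -ω₁ * p₁ - ω₂ * p₂)
    (fq : E₁ q₂ - E₂ q₁ + p₂ * r₁ - p₁ * r₂ = -ω₁ * q₁ - ω₂ * q₂)
    (fr : E₁ r₂ - E₂ r₁ - p₂ * q₁ + p₁ * q₂ = -ω₁ * r₁ - ω₂ * r₂) :
    (E₁ β = E₂ α - 2 * ω₂ * β - 2 * ω₁ * α + 2 * t * m * C * T₂) ∧
    (E₂ β = -E₁ α - 2 * ω₂ * α + 2 * ω₁ * β + 2 * t * m * C * T₁) ∧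
    (E₁ ω₂ = E₂ ω₁ - ω₁ ^ 2 - ω₂ ^ 2 - H ^ 2 + α ^ 2 + β ^ 2 - t ^ 2 - 2 * t * m * C ^ 2) := by
  subst hp₁ hp₂ hq₁ hq₂ hr₁ hr₂
  simp only [map_add, map_sub, Derivation.leibniz, smul_eq_mul, ht₁, ht₂, hm₁, hm₂, hH₁, hH₂,
    h11, h12, h21, h22, hC₁, hC₂] at fp fq fr
  -- The normal parts fq and fr of the flatness equations are the two Codazzi equations; the
  -- tangential part fp is the Gauss equation.
  refine ⟨?_, ?_, ?_⟩
  · linear_combination fq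
  · linear_combination -fr
  · linear_combination fp

/-- T₁, T₂, C are the components of ξ in the adapted frame, ω the Levi-Civita form of the surface,
and (α, β; β, -α) the matrix of φ. The left side is the divergence of a field whose first summand is
½∇|A|². The last two squares are P² and Q²: with x, y components of ∇φ and x + y given by Codazzi,
2(x² + y²) = (x + y)² + (x - y)². -/
theorem frame_simons {R : Type*} [CommRing R] [Algebra ℝ R] (E₁ E₂ : Derivation ℝ R R)
    {t m H T₁ T₂ C ω₁ ω₂ α β D p₁ p₂ q₁ q₂ r₁ r₂ : R}
    (ht₁ : E₁ t = 0) (ht₂ : E₂ t = 0) (hD₁ : E₁ D = 0) (hD₂ : E₂ D = 0)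
    (hH₁ : E₁ H = 0) (hH₂ : E₂ H = 0) (hD : D = 2 * t * m)
    (hp₁ : p₁ = ω₁ - m * T₁ * C) (hp₂ : p₂ = ω₂ - m * T₂ * C)
    (hq₁ : q₁ = H + α + m * T₁ * T₂) (hq₂ : q₂ = β + t + m * T₂ * T₂)
    (hr₁ : r₁ = β - t - m * T₁ * T₁) (hr₂ : r₂ = H - α - m * T₁ * T₂)
    (h11 : E₁ T₁ = p₁ * T₂ + q₁ * C) (h12 : E₁ T₂ = -p₁ * T₁ + r₁ * C)
    (h21 : E₂ T₁ = p₂ * T₂ + q₂ * C) (h22 : E₂ T₂ = -p₂ * T₁ + r₂ * C)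
    (hC₁ : E₁ C = -q₁ * T₁ - r₁ * T₂) (hC₂ : E₂ C = -q₂ * T₁ - r₂ * T₂)
    (comm : ∀ u, E₁ (E₂ u) - E₂ (E₁ u) = -ω₁ * E₁ u - ω₂ * E₂ u)
    (cod₁ : E₁ β = E₂ α - 2 * ω₂ * β - 2 * ω₁ * α + D * C * T₂)
    (cod₂ : E₂ β = -E₁ α - 2 * ω₂ * α + 2 * ω₁ * β + D * C * T₁)
    (gauss : E₁ ω₂ = E₂ ω₁ - ω₁ ^ 2 - ω₂ ^ 2 - H ^ 2 + α ^ 2 + β ^ 2 - t ^ 2 - D * C ^ 2)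
    (hT : T₁ ^ 2 + T₂ ^ 2 + C ^ 2 = 1) :
    E₁ (2 * (α * E₁ α + β * E₁ β) - 2 * D * (H * (C * T₁) - t * (C * T₂)))
      + E₂ (2 * (α * E₂ α + β * E₂ β) - 2 * D * (H * (C * T₂) + t * (C * T₁)))
      + ω₂ * (2 * (α * E₁ α + β * E₁ β) - 2 * D * (H * (C * T₁) - t * (C * T₂)))
      - ω₁ * (2 * (α * E₂ α + β * E₂ β) - 2 * D * (H * (C * T₂) + t * (C * T₁)))
    = D ^ 2 * (C ^ 2 * (1 - C ^ 2))
      - ((2 * (α ^ 2 + β ^ 2)) ^ 2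
          - (2 * (H ^ 2 + t ^ 2) + D * (5 * C ^ 2 - 1)) * (2 * (α ^ 2 + β ^ 2))
          + 2 * D * (H ^ 2 + t ^ 2) * (3 * C ^ 2 - 1))
      + (E₁ α - 2 * ω₁ * β - (E₂ β + 2 * ω₂ * α)) ^ 2
      + (E₁ β + 2 * ω₁ * α + (E₂ α - 2 * ω₂ * β)) ^ 2 := by
  -- Differentiating each Codazzi equation along both directions and exchanging mixed derivatives by
  -- `comm` yields the Laplacians of β (from c1, c2) and of α (from d1, d2). No second derivative of
  -- α or β survives in the final combination.
  have c1 := congrArg E₁ cod₁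
  have c2 := congrArg E₂ cod₂
  have d1 := congrArg E₁ cod₂
  have d2 := congrArg E₂ cod₁
  have ka := comm α
  have kb := comm β
  clear comm
  have z1 : E₁ (2 : R) = 0 := E₁.map_natCast 2
  have z2 : E₂ (2 : R) = 0 := E₂.map_natCast 2
  subst hp₁ hp₂ hq₁ hq₂ hr₁ hr₂
  simp only [map_add, map_sub, map_neg, Derivation.leibniz, smul_eq_mul, ht₁, ht₂, hD₁, hD₂, hH₁,
    hH₂, h11, h12, h21, h22, hC₁, hC₂, z1, z2] at c1 c2 d1 d2 ⊢
  generalize E₁ (E₁ α) = aa at *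
  generalize E₁ (E₂ α) = ab at *
  generalize E₂ (E₁ α) = ba at *
  generalize E₂ (E₂ α) = bb at *
  generalize E₁ (E₁ β) = Aa at *
  generalize E₁ (E₂ β) = Ab at *
  generalize E₂ (E₁ β) = Ba at *
  generalize E₂ (E₂ β) = Bb at *
  rw [cod₁, cod₂] at *
  rw [gauss] at *
  clear cod₁ cod₂ gauss
  subst hD
  linear_combination 2 * β * c1 + 2 * β * c2 + 2 * α * d1 - 2 * α * d2 + 2 * β * ka - 2 * α * kb
    + (4 * t * m * (H ^ 2 + t ^ 2 - α ^ 2 - β ^ 2) + 4 * t ^ 2 * m ^ 2 * C ^ 2) * hT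
end Berger

/-! ### Algebra of orthonormal moving frames. -/

namespace Berger

theorem derivation_two_mul {R : Type*} [CommRing R] [Algebra ℝ R] (E : Derivation ℝ R R) (x : R) :
    E (2 * x) = 2 * E x := by
  rw [two_mul, map_add, two_mul]

/-- `e, f, n` is an orthonormal basis of `R³` with `e × f = n`. -/
structure IsFrame {R : Type*} [CommRing R] (e f n : Fin 3 → R) : Prop where
  ee : e 0 * e 0 + e 1 * e 1 + e 2 * e 2 = 1
  ff : f 0 * f 0 + f 1 * f 1 + f 2 * f 2 = 1
  nn : n 0 * n 0 + n 1 * n 1 + n 2 * n 2 = 1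
  ef : e 0 * f 0 + e 1 * f 1 + e 2 * f 2 = 0
  en : e 0 * n 0 + e 1 * n 1 + e 2 * n 2 = 0
  fn : f 0 * n 0 + f 1 * n 1 + f 2 * n 2 = 0
  det : (e 1 * f 2 - e 2 * f 1) * n 0 + (e 2 * f 0 - e 0 * f 2) * n 1
    + (e 0 * f 1 - e 1 * f 0) * n 2 = 1

namespace IsFrame

variable {R : Type*} [CommRing R] {e f n : Fin 3 → R}

/-- Orthonormal rows force orthonormal columns: a one-sided inverse of a square matrix over a
commutative ring is two-sided. -/
theorem complete (h : IsFrame e f n) (i j : Fin 3) :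
    e i * e j + f i * f j + n i * n j = if i = j then 1 else 0 := by
  have h : (Matrix.of ![e, f, n]) * (Matrix.of ![e, f, n]).transpose = 1 := by
    ext i j
    fin_cases i <;> fin_cases j <;>
      simp [Matrix.mul_apply, Fin.sum_univ_three] <;>
      first
        | linear_combination h.ee | linear_combination h.ff | linear_combination h.nn
        | linear_combination h.ef | linear_combination h.en | linear_combination h.fn
  have h' : (Matrix.of ![e, f, n]).transpose * (Matrix.of ![e, f, n]) = 1 := mul_eq_one_comm.1 h
  replace h' := congrFun (congrFun h' i) j
  simpa [Matrix.mul_apply, Fin.sum_univ_three, Matrix.one_apply] using h'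

/-- A vector is the sum of its components in the frame. -/
theorem expand (h : IsFrame e f n) (v : Fin 3 → R) (k : Fin 3) :
    v k = (v 0 * e 0 + v 1 * e 1 + v 2 * e 2) * e k + (v 0 * f 0 + v 1 * f 1 + v 2 * f 2) * f k
      + (v 0 * n 0 + v 1 * n 1 + v 2 * n 2) * n k := by
  have h0 := h.complete k 0
  have h1 := h.complete k 1
  have h2 := h.complete k 2
  have : v k = v 0 * (if k = 0 then 1 else 0) + v 1 * (if k = 1 then 1 else 0)
      + v 2 * (if k = 2 then 1 else 0) := by fin_cases k <;> simp
  rw [this, ← h0, ← h1, ← h2]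
  ring

/-- e × f is orthogonal to e and f, and its n-component is the determinant, so the expansion in the
frame leaves n alone. The other two products go the same way. -/
theorem cross_ef (h : IsFrame e f n) : e 1 * f 2 - e 2 * f 1 = n 0 ∧
    e 2 * f 0 - e 0 * f 2 = n 1 ∧ e 0 * f 1 - e 1 * f 0 = n 2 := by
  have := h.expand ![e 1 * f 2 - e 2 * f 1, e 2 * f 0 - e 0 * f 2, e 0 * f 1 - e 1 * f 0]
  refine ⟨(this 0).trans ?_, (this 1).trans ?_, (this 2).trans ?_⟩ <;> simp
  · linear_combination n 0 * h.det
  · linear_combination n 1 * h.det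
  · linear_combination n 2 * h.det

theorem cross_fn (h : IsFrame e f n) : f 1 * n 2 - f 2 * n 1 = e 0 ∧
    f 2 * n 0 - f 0 * n 2 = e 1 ∧ f 0 * n 1 - f 1 * n 0 = e 2 := by
  have := h.expand ![f 1 * n 2 - f 2 * n 1, f 2 * n 0 - f 0 * n 2, f 0 * n 1 - f 1 * n 0]
  refine ⟨(this 0).trans ?_, (this 1).trans ?_, (this 2).trans ?_⟩ <;> simp
  · linear_combination e 0 * h.det
  · linear_combination e 1 * h.det
  · linear_combination e 2 * h.det

theorem cross_ne (h : IsFrame e f n) : n 1 * e 2 - n 2 * e 1 = f 0 ∧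
    n 2 * e 0 - n 0 * e 2 = f 1 ∧ n 0 * e 1 - n 1 * e 0 = f 2 := by
  have := h.expand ![n 1 * e 2 - n 2 * e 1, n 2 * e 0 - n 0 * e 2, n 0 * e 1 - n 1 * e 0]
  refine ⟨(this 0).trans ?_, (this 1).trans ?_, (this 2).trans ?_⟩ <;> simp
  · linear_combination f 0 * h.det
  · linear_combination f 1 * h.det
  · linear_combination f 2 * h.det

theorem col_two (h : IsFrame e f n) : e 2 ^ 2 + f 2 ^ 2 + n 2 ^ 2 = 1 := by
  have := h.complete 2 2
  simp only [if_true] at this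
  linear_combination this

variable [Algebra ℝ R]

theorem eq_zero_of_two_mul {x : R} (h : 2 * x = 0) : x = 0 := by
  have : (algebraMap ℝ R (1 / 2)) * (algebraMap ℝ R 2) = 1 := by
    rw [← map_mul]; norm_num
  rw [map_ofNat] at this
  calc x = (algebraMap ℝ R (1 / 2)) * 2 * x := by rw [this, one_mul]
    _ = 0 := by rw [mul_assoc, h, mul_zero]

/-- The derivatives of the frame vectors in terms of the connection coefficients. -/
theorem deriv (h : IsFrame e f n) (E : Derivation ℝ R R) {p q r : R}
    (hp : p = E (e 0) * f 0 + E (e 1) * f 1 + E (e 2) * f 2)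
    (hq : q = E (e 0) * n 0 + E (e 1) * n 1 + E (e 2) * n 2)
    (hr : r = E (f 0) * n 0 + E (f 1) * n 1 + E (f 2) * n 2) (k : Fin 3) :
    E (e k) = p * f k + q * n k ∧ E (f k) = -p * e k + r * n k ∧
      E (n k) = -q * e k - r * f k := by
  have ee := congrArg E h.ee
  have ff := congrArg E h.ff
  have nn := congrArg E h.nn
  have ef := congrArg E h.ef
  have en := congrArg E h.en
  have fn := congrArg E h.fn
  simp only [map_add, Derivation.leibniz, smul_eq_mul, Derivation.map_one_eq_zero, map_zero]
    at ee ff nn ef en fn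
  have ee' : E (e 0) * e 0 + E (e 1) * e 1 + E (e 2) * e 2 = 0 :=
    eq_zero_of_two_mul (by linear_combination ee)
  have ff' : E (f 0) * f 0 + E (f 1) * f 1 + E (f 2) * f 2 = 0 :=
    eq_zero_of_two_mul (by linear_combination ff)
  have nn' : E (n 0) * n 0 + E (n 1) * n 1 + E (n 2) * n 2 = 0 :=
    eq_zero_of_two_mul (by linear_combination nn)
  refine ⟨(h.expand (fun k => E (e k)) k).trans ?_, (h.expand (fun k => E (f k)) k).trans ?_,
    (h.expand (fun k => E (n k)) k).trans ?_⟩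
  · rw [ee', ← hp, ← hq]; ring
  · rw [ff', ← hr]
    linear_combination e k * (ef + hp)
  · rw [nn']
    linear_combination e k * (en + hq) + f k * (fn + hr)

end IsFrame

/-- The flatness of the frame bundle connection. -/
theorem IsFrame.flat {R : Type*} [CommRing R] [Algebra ℝ R] {e f n : Fin 3 → R}
    (h : IsFrame e f n) (E₁ E₂ : Derivation ℝ R R) {p₁ p₂ q₁ q₂ r₁ r₂ ω₁ ω₂ : R}
    (h₁ : ∀ k, E₁ (e k) = p₁ * f k + q₁ * n k ∧ E₁ (f k) = -p₁ * e k + r₁ * n k ∧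
      E₁ (n k) = -q₁ * e k - r₁ * f k)
    (h₂ : ∀ k, E₂ (e k) = p₂ * f k + q₂ * n k ∧ E₂ (f k) = -p₂ * e k + r₂ * n k ∧
      E₂ (n k) = -q₂ * e k - r₂ * f k)
    (comm : ∀ u, E₁ (E₂ u) - E₂ (E₁ u) = -ω₁ * E₁ u - ω₂ * E₂ u) :
    (E₁ p₂ - E₂ p₁ - q₂ * r₁ + q₁ * r₂ = -ω₁ * p₁ - ω₂ * p₂) ∧
    (E₁ q₂ - E₂ q₁ + p₂ * r₁ - p₁ * r₂ = -ω₁ * q₁ - ω₂ * q₂) ∧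
    (E₁ r₂ - E₂ r₁ - p₂ * q₁ + p₁ * q₂ = -ω₁ * r₁ - ω₂ * r₂) := by
  have ke : ∀ k, (E₁ p₂ - E₂ p₁ - q₂ * r₁ + q₁ * r₂ + ω₁ * p₁ + ω₂ * p₂) * f k
      + (E₁ q₂ - E₂ q₁ + p₂ * r₁ - p₁ * r₂ + ω₁ * q₁ + ω₂ * q₂) * n k = 0 := fun k => by
    have := comm (e k)
    simp only [(h₁ k).1, (h₂ k).1, map_add, Derivation.leibniz, smul_eq_mul, (h₁ k).2.1,
      (h₁ k).2.2, (h₂ k).2.1, (h₂ k).2.2] at this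
    linear_combination this
  have kf : ∀ k, (-(E₁ p₂ - E₂ p₁ - q₂ * r₁ + q₁ * r₂ + ω₁ * p₁ + ω₂ * p₂)) * e k
      + (E₁ r₂ - E₂ r₁ - p₂ * q₁ + p₁ * q₂ + ω₁ * r₁ + ω₂ * r₂) * n k = 0 := fun k => by
    have := comm (f k)
    simp only [(h₁ k).2.1, (h₂ k).2.1, map_add, map_neg, Derivation.leibniz, smul_eq_mul, (h₁ k).1,
      (h₁ k).2.2, (h₂ k).1, (h₂ k).2.2] at this
    linear_combination this
  generalize hA : E₁ p₂ - E₂ p₁ - q₂ * r₁ + q₁ * r₂ + ω₁ * p₁ + ω₂ * p₂ = A at ke kf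
  generalize hB : E₁ q₂ - E₂ q₁ + p₂ * r₁ - p₁ * r₂ + ω₁ * q₁ + ω₂ * q₂ = B at ke
  generalize hC : E₁ r₂ - E₂ r₁ - p₂ * q₁ + p₁ * q₂ + ω₁ * r₁ + ω₂ * r₂ = C at kf
  refine ⟨?_, ?_, ?_⟩
  · linear_combination hA + f 0 * ke 0 + f 1 * ke 1 + f 2 * ke 2 - A * h.ff - B * h.fn
  · linear_combination hB + n 0 * ke 0 + n 1 * ke 1 + n 2 * ke 2 - B * h.nn - A * h.fn
  · linear_combination hC + n 0 * kf 0 + n 1 * kf 1 + n 2 * kf 2 - C * h.nn + A * h.en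

/-- Simons' identity for an adapted frame. The `hᵢⱼ` are the components of the second fundamental
form. -/
theorem IsFrame.simons {R : Type*} [CommRing R] [Algebra ℝ R] {e f n : Fin 3 → R}
    (h : IsFrame e f n) (E₁ E₂ : Derivation ℝ R R) {t m D H c₁ c₂ p₁ p₂ q₁ q₂ r₁ r₂ A : R}
    (ht₁ : E₁ t = 0) (ht₂ : E₂ t = 0) (hm₁ : E₁ m = 0) (hm₂ : E₂ m = 0)
    (hH₁ : E₁ H = 0) (hH₂ : E₂ H = 0) (hD : D = 2 * t * m)
    (h₁ : ∀ k, E₁ (e k) = p₁ * f k + q₁ * n k ∧ E₁ (f k) = -p₁ * e k + r₁ * n k ∧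
      E₁ (n k) = -q₁ * e k - r₁ * f k)
    (h₂ : ∀ k, E₂ (e k) = p₂ * f k + q₂ * n k ∧ E₂ (f k) = -p₂ * e k + r₂ * n k ∧
      E₂ (n k) = -q₂ * e k - r₂ * f k)
    (comm : ∀ u, E₁ (E₂ u) - E₂ (E₁ u) = c₁ * E₁ u + c₂ * E₂ u)
    (tors₀ : E₁ (f 0) - E₂ (e 0) + (2 * t + m) * n 0 = c₁ * e 0 + c₂ * f 0)
    (tors₁ : E₁ (f 1) - E₂ (e 1) + (2 * t + m) * n 1 = c₁ * e 1 + c₂ * f 1)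
    (tors₂ : E₁ (f 2) - E₂ (e 2) + 2 * t * n 2 = c₁ * e 2 + c₂ * f 2)
    (hH : q₁ - m * e 2 * f 2 + (r₂ + m * e 2 * f 2) = 2 * H)
    (hA : A = (q₁ - m * e 2 * f 2) ^ 2 + 2 * ((r₁ + t + m * e 2 * e 2)
      * (q₂ - t - m * f 2 * f 2)) + (r₂ + m * e 2 * f 2) ^ 2) :
    r₁ + t + m * e 2 * e 2 = q₂ - t - m * f 2 * f 2 ∧
    ∃ P Q : R, E₁ (E₁ A - 4 * D * (H * (n 2 * e 2) - t * (n 2 * f 2)))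
      + E₂ (E₂ A - 4 * D * (H * (n 2 * f 2) + t * (n 2 * e 2)))
      - c₂ * (E₁ A - 4 * D * (H * (n 2 * e 2) - t * (n 2 * f 2)))
      + c₁ * (E₂ A - 4 * D * (H * (n 2 * f 2) + t * (n 2 * e 2)))
    = 2 * (D ^ 2 * (n 2 ^ 2 * (1 - n 2 ^ 2))
      - ((A - 2 * H ^ 2) ^ 2
          - (2 * (H ^ 2 + t ^ 2) + D * (5 * n 2 ^ 2 - 1)) * (A - 2 * H ^ 2)
          + 2 * D * (H ^ 2 + t ^ 2) * (3 * n 2 ^ 2 - 1)) + P ^ 2 + Q ^ 2) := by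
  have hD₁ : E₁ D = 0 := by
    rw [hD, mul_assoc, derivation_two_mul, Derivation.leibniz, ht₁, hm₁]; simp
  have hD₂ : E₂ D = 0 := by
    rw [hD, mul_assoc, derivation_two_mul, Derivation.leibniz, ht₂, hm₂]; simp
  simp only [(h₁ _).2.1, (h₂ _).1] at tors₀ tors₁ tors₂
  -- The torsion equation, paired with e and f, identifies the bracket coefficients with the
  -- Levi-Civita form; paired with n it is the symmetry of the second fundamental form.
  have t1 : c₁ = -(p₁ + m * e 2 * n 2) := by
    linear_combination -(e 0 * tors₀ + e 1 * tors₁ + e 2 * tors₂) - c₁ * h.ee - c₂ * h.ef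
      - p₁ * h.ee - p₂ * h.ef + (r₁ - q₂ + 2 * t + m) * h.en
  have t2 : c₂ = -(p₂ + m * f 2 * n 2) := by
    linear_combination -(f 0 * tors₀ + f 1 * tors₁ + f 2 * tors₂) - c₂ * h.ff - c₁ * h.ef
      - p₁ * h.ef - p₂ * h.ff + (r₁ - q₂ + 2 * t + m) * h.fn
  have sym : r₁ + t + m * e 2 * e 2 = q₂ - t - m * f 2 * f 2 := by
    linear_combination (n 0 * tors₀ + n 1 * tors₁ + n 2 * tors₂) + c₁ * h.en + c₂ * h.fn
      - (r₁ - q₂ + 2 * t + m) * h.nn + m * h.col_two + p₁ * h.en + p₂ * h.fn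
  refine ⟨sym, ?_⟩
  have comm' : ∀ u, E₁ (E₂ u) - E₂ (E₁ u) =
      -(p₁ + m * e 2 * n 2) * E₁ u - (p₂ + m * f 2 * n 2) * E₂ u := fun u => by
    rw [comm, t1, t2]; ring
  obtain ⟨fp, fq, fr⟩ := h.flat E₁ E₂ h₁ h₂ comm'
  obtain ⟨ω₁, hω₁⟩ : ∃ ω₁, ω₁ = p₁ + m * e 2 * n 2 := ⟨_, rfl⟩
  obtain ⟨ω₂, hω₂⟩ : ∃ ω₂, ω₂ = p₂ + m * f 2 * n 2 := ⟨_, rfl⟩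
  -- α and β are the entries of the trace-free part of the second fundamental form.
  obtain ⟨α, hα⟩ : ∃ α, α = q₁ - m * e 2 * f 2 - H := ⟨_, rfl⟩
  obtain ⟨β, hβ⟩ : ∃ β, β = q₂ - t - m * f 2 * f 2 := ⟨_, rfl⟩
  rw [← hω₁, ← hω₂] at comm' fp fq fr
  have hp₁ : p₁ = ω₁ - m * e 2 * n 2 := by rw [hω₁]; ring
  have hp₂ : p₂ = ω₂ - m * f 2 * n 2 := by rw [hω₂]; ring
  have hq₁ : q₁ = H + α + m * e 2 * f 2 := by rw [hα]; ring
  have hq₂ : q₂ = β + t + m * f 2 * f 2 := by rw [hβ]; ring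
  have hr₁ : r₁ = β - t - m * e 2 * e 2 := by rw [hβ]; linear_combination sym
  have hr₂ : r₂ = H - α - m * e 2 * f 2 := by rw [hα]; linear_combination hH
  obtain ⟨cod₁, cod₂, gauss⟩ := frame_codazzi E₁ E₂ ht₁ ht₂ hm₁ hm₂ hH₁ hH₂ hp₁ hp₂ hq₁ hq₂ hr₁ hr₂
    (h₁ 2).1 (h₁ 2).2.1 (h₂ 2).1 (h₂ 2).2.1 (h₁ 2).2.2 (h₂ 2).2.2 fp fq fr
  rw [← hD] at cod₁ cod₂ gauss
  have key := frame_simons E₁ E₂ ht₁ ht₂ hD₁ hD₂ hH₁ hH₂ hD hp₁ hp₂ hq₁ hq₂ hr₁ hr₂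
    (h₁ 2).1 (h₁ 2).2.1 (h₂ 2).1 (h₂ 2).2.1 (h₁ 2).2.2 (h₂ 2).2.2 comm' cod₁ cod₂ gauss h.col_two
  have hA' : A = 2 * (α ^ 2 + β ^ 2) + 2 * H ^ 2 := by
    rw [hA, sym, ← hβ, show q₁ - m * e 2 * f 2 = H + α by rw [hα]; ring,
      show r₂ + m * e 2 * f 2 = H - α by rw [hr₂]; ring]
    ring
  have dA : ∀ E : Derivation ℝ R R, E H = 0 → E A = 2 * (2 * (α * E α + β * E β)) := fun E hE => by
    rw [hA', map_add, derivation_two_mul, derivation_two_mul, map_add, pow_two, pow_two, pow_two]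
    simp only [Derivation.leibniz, smul_eq_mul, hE]
    ring
  refine ⟨E₁ α - 2 * ω₁ * β - (E₂ β + 2 * ω₂ * α), E₁ β + 2 * ω₁ * α + (E₂ α - 2 * ω₂ * β), ?_⟩
  · rw [dA E₁ hH₁, dA E₂ hH₂, show ∀ x y : R, 2 * x - 4 * D * y = 2 * (x - 2 * D * y) by
      intros; ring, show ∀ x y : R, 2 * x - 4 * D * y = 2 * (x - 2 * D * y) by
      intros; ring, derivation_two_mul, derivation_two_mul, hA', add_sub_cancel_right, t1, t2, ← hω₁, ← hω₂]
    linear_combination 2 * key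

end Berger

/-! ### From the adapted frame to coordinates. -/

namespace Berger

/-- Simons' identity in coordinates, in divergence form, for a surface with moving coframe `a, b`
and unit normal `n`; and the derivative of the normal of a surface with vanishing angle. -/
theorem coord_simons {R : Type*} [CommRing R] [Algebra ℝ R] (d₁ d₂ : Derivation ℝ R R)
    {a b n : Fin 3 → R} {t m D H s si ρ ρi A L₁ L₂ S₁₁ S₁₂ S₂₁ S₂₂ g₁₁ g₁₂ g₂₂ : R}
    (comm : ∀ u, d₁ (d₂ u) = d₂ (d₁ u))
    (ht₁ : d₁ t = 0) (ht₂ : d₂ t = 0) (hm₁ : d₁ m = 0) (hm₂ : d₂ m = 0)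
    (hH₁ : d₁ H = 0) (hH₂ : d₂ H = 0) (hD : D = 2 * t * m)
    (hn : n 0 * n 0 + n 1 * n 1 + n 2 * n 2 = 1)
    (han : a 0 * n 0 + a 1 * n 1 + a 2 * n 2 = 0)
    (hbn : b 0 * n 0 + b 1 * n 1 + b 2 * n 2 = 0)
    (hg₁₁ : g₁₁ = a 0 * a 0 + a 1 * a 1 + a 2 * a 2)
    (hg₁₂ : g₁₂ = a 0 * b 0 + a 1 * b 1 + a 2 * b 2)
    (hg₂₂ : g₂₂ = b 0 * b 0 + b 1 * b 1 + b 2 * b 2)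
    (hs : s * s = g₁₁) (hsi : s * si = 1)
    (hρ : ρ = (a 1 * b 2 - a 2 * b 1) * n 0 + (a 2 * b 0 - a 0 * b 2) * n 1
      + (a 0 * b 1 - a 1 * b 0) * n 2) (hρi : ρ * ρi = 1)
    (tors₀ : d₁ (b 0) - d₂ (a 0) + (2 * t + m) * (a 1 * b 2 - a 2 * b 1) = 0)
    (tors₁ : d₁ (b 1) - d₂ (a 1) + (2 * t + m) * (a 2 * b 0 - a 0 * b 2) = 0)
    (tors₂ : d₁ (b 2) - d₂ (a 2) + 2 * t * (a 0 * b 1 - a 1 * b 0) = 0)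
    (h₁₁ : S₁₁ = -((d₁ (n 0) + t * (a 1 * n 2) - (t + m) * (a 2 * n 1)) * a 0
      + (d₁ (n 1) + (t + m) * (a 2 * n 0) - t * (a 0 * n 2)) * a 1
      + (d₁ (n 2) + t * (a 0 * n 1) - t * (a 1 * n 0)) * a 2))
    (h₁₂ : S₁₂ = -((d₁ (n 0) + t * (a 1 * n 2) - (t + m) * (a 2 * n 1)) * b 0
      + (d₁ (n 1) + (t + m) * (a 2 * n 0) - t * (a 0 * n 2)) * b 1
      + (d₁ (n 2) + t * (a 0 * n 1) - t * (a 1 * n 0)) * b 2))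
    (h₂₁ : S₂₁ = -((d₂ (n 0) + t * (b 1 * n 2) - (t + m) * (b 2 * n 1)) * a 0
      + (d₂ (n 1) + (t + m) * (b 2 * n 0) - t * (b 0 * n 2)) * a 1
      + (d₂ (n 2) + t * (b 0 * n 1) - t * (b 1 * n 0)) * a 2))
    (h₂₂ : S₂₂ = -((d₂ (n 0) + t * (b 1 * n 2) - (t + m) * (b 2 * n 1)) * b 0
      + (d₂ (n 1) + (t + m) * (b 2 * n 0) - t * (b 0 * n 2)) * b 1
      + (d₂ (n 2) + t * (b 0 * n 1) - t * (b 1 * n 0)) * b 2))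
    (hH : g₂₂ * S₁₁ - g₁₂ * S₂₁ - g₁₂ * S₁₂ + g₁₁ * S₂₂ = 2 * H * (g₁₁ * g₂₂ - g₁₂ * g₁₂))
    (hA : (g₁₁ * g₂₂ - g₁₂ * g₁₂) ^ 2 * A = (g₂₂ * S₁₁ - g₁₂ * S₂₁) ^ 2
      + 2 * ((g₂₂ * S₁₂ - g₁₂ * S₂₂) * (g₁₁ * S₂₁ - g₁₂ * S₁₁)) + (g₁₁ * S₂₂ - g₁₂ * S₁₂) ^ 2)
    (hL₁ : L₁ = d₁ A - 4 * D * (H * (n 2 * a 2) + t * (n 2 * (n 1 * a 0 - n 0 * a 1))))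
    (hL₂ : L₂ = d₂ A - 4 * D * (H * (n 2 * b 2) + t * (n 2 * (n 1 * b 0 - n 0 * b 1)))) :
    (n 2 = 0 → (d₁ (n 0) = -2 * H * a 0 + (2 * t + m) * a 2 * n 1 ∧
      d₁ (n 1) = -2 * H * a 1 - (2 * t + m) * a 2 * n 0) ∧
      d₂ (n 0) = -2 * H * b 0 + (2 * t + m) * b 2 * n 1 ∧
      d₂ (n 1) = -2 * H * b 1 - (2 * t + m) * b 2 * n 0) ∧
    ∃ P Q : R, d₁ (ρi * (g₂₂ * L₁ - g₁₂ * L₂)) + d₂ (ρi * (g₁₁ * L₂ - g₁₂ * L₁))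
    = 2 * ρ * (D ^ 2 * (n 2 ^ 2 * (1 - n 2 ^ 2))
      - ((A - 2 * H ^ 2) ^ 2
          - (2 * (H ^ 2 + t ^ 2) + D * (5 * n 2 ^ 2 - 1)) * (A - 2 * H ^ 2)
          + 2 * D * (H ^ 2 + t ^ 2) * (3 * n 2 ^ 2 - 1)) + P ^ 2 + Q ^ 2) := by
  -- Gram–Schmidt: a = s e and b = b₁ e + b₂ f, with inverse f = w b - k a. Since b₂ = ρ / s carries
  -- the sign of the triple product ρ, the frame (e, f, n) is positive for either choice of the
  -- normal.
  obtain ⟨b₁, hb₁⟩ : ∃ b₁, b₁ = si * g₁₂ := ⟨_, rfl⟩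
  obtain ⟨b₂, hb₂⟩ : ∃ b₂, b₂ = ρ * si := ⟨_, rfl⟩
  obtain ⟨w, hw⟩ : ∃ w, w = s * ρi := ⟨_, rfl⟩
  obtain ⟨k, hk⟩ : ∃ k, k = w * b₁ * si := ⟨_, rfl⟩
  obtain ⟨e, he⟩ : ∃ e : Fin 3 → R, e = fun i => si * a i := ⟨_, rfl⟩
  obtain ⟨f, hf⟩ : ∃ f : Fin 3 → R, f = fun i => w * b i - k * a i := ⟨_, rfl⟩
  have hbw : b₂ * w = 1 := by rw [hb₂, hw]; linear_combination s * si * hρi + hsi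
  have hρs : ρ = s * b₂ := by rw [hb₂]; linear_combination -ρ * hsi
  have ha : ∀ i, a i = s * e i := fun i => by rw [he]; linear_combination -a i * hsi
  have hb : ∀ i, b i = b₁ * e i + b₂ * f i := fun i => by
    simp only [he, hf, hk]; linear_combination (si * b₁ * a i - b i) * hbw
  have hks : k * s = w * b₁ := by rw [hk]; linear_combination w * b₁ * hsi
  have ee : e 0 * e 0 + e 1 * e 1 + e 2 * e 2 = 1 := by
    simp only [he]; linear_combination -si * si * hg₁₁ - si * si * hs + (s * si + 1) * hsi
  have lag : ρ * ρ = g₁₁ * g₂₂ - g₁₂ * g₁₂ := by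
    rw [hρ, hg₁₁, hg₁₂, hg₂₂]
    linear_combination ((a 0 * a 0 + a 1 * a 1 + a 2 * a 2) * (b 0 * b 0 + b 1 * b 1 + b 2 * b 2)
      - (a 0 * b 0 + a 1 * b 1 + a 2 * b 2) * (a 0 * b 0 + a 1 * b 1 + a 2 * b 2)) * hn
      - (a 0 * a 0 + a 1 * a 1 + a 2 * a 2) * (b 0 * n 0 + b 1 * n 1 + b 2 * n 2) * hbn
      + (2 * (a 0 * b 0 + a 1 * b 1 + a 2 * b 2) * (b 0 * n 0 + b 1 * n 1 + b 2 * n 2)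
        - (b 0 * b 0 + b 1 * b 1 + b 2 * b 2) * (a 0 * n 0 + a 1 * n 1 + a 2 * n 2)) * han
  have hg12 : g₁₂ = s * b₁ := by rw [hb₁]; linear_combination -g₁₂ * hsi
  have hg22 : g₂₂ = b₁ * b₁ + b₂ * b₂ := by
    rw [hb₁, hb₂]
    linear_combination -si * si * lag + g₂₂ * si * si * hs - g₂₂ * (s * si + 1) * hsi
  have en : e 0 * n 0 + e 1 * n 1 + e 2 * n 2 = 0 := by
    simp only [he]; linear_combination si * han
  have fn : f 0 * n 0 + f 1 * n 1 + f 2 * n 2 = 0 := by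
    simp only [hf]; linear_combination w * hbn - k * han
  have ef : e 0 * f 0 + e 1 * f 1 + e 2 * f 2 = 0 := by
    simp only [he, hf]
    linear_combination -si * w * hg₁₂ + si * k * hg₁₁ + si * w * hg12 + si * k * hs - si * s * hks
  have ff : f 0 * f 0 + f 1 * f 1 + f 2 * f 2 = 1 := by
    simp only [hf]
    linear_combination -w * w * hg₂₂ + 2 * w * k * hg₁₂ - k * k * hg₁₁ + w * w * hg22
      - 2 * w * k * hg12 - k * k * hs + (k * s - w * b₁) * hks + (b₂ * w + 1) * hbw
  have hfr : IsFrame e f n := by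
    refine ⟨ee, ff, hn, ef, en, fn, ?_⟩
    simp only [he, hf]
    linear_combination -si * w * hρ + w * si * hρs + s * si * hbw + hsi
  obtain ⟨E₁, hE₁⟩ : ∃ E₁ : Derivation ℝ R R, E₁ = si • d₁ := ⟨_, rfl⟩
  obtain ⟨E₂, hE₂⟩ : ∃ E₂ : Derivation ℝ R R, E₂ = w • d₂ - k • d₁ := ⟨_, rfl⟩
  have E1 : ∀ u, E₁ u = si * d₁ u := fun u => by rw [hE₁]; rfl
  have E2 : ∀ u, E₂ u = w * d₂ u - k * d₁ u := fun u => by rw [hE₂]; rfl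
  have D1 : ∀ u, d₁ u = s * E₁ u := fun u => by rw [E1]; linear_combination -d₁ u * hsi
  have D2 : ∀ u, d₂ u = b₁ * E₁ u + b₂ * E₂ u := fun u => by
    rw [E1, E2, hk]; linear_combination (si * b₁ * d₁ u - d₂ u) * hbw
  have constant : ∀ u, d₁ u = 0 → d₂ u = 0 → E₁ u = 0 ∧ E₂ u = 0 := fun u h₁ h₂ => by
    rw [E1, E2, h₁, h₂]; simp
  -- As d₁ and d₂ commute, [E₁, E₂] = X d₁ + si (d₁ w) d₂; c₁ and c₂ are its coefficients with
  -- respect to E₁, E₂.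
  obtain ⟨X, hX⟩ : ∃ X, X = -si * d₁ k - w * d₂ si + k * d₁ si := ⟨_, rfl⟩
  obtain ⟨c₂, hc₂⟩ : ∃ c₂, c₂ = si * d₁ w * b₂ := ⟨_, rfl⟩
  obtain ⟨c₁, hc₁⟩ : ∃ c₁, c₁ = X * s + si * d₁ w * b₁ := ⟨_, rfl⟩
  have commE : ∀ u, E₁ (E₂ u) - E₂ (E₁ u) = c₁ * E₁ u + c₂ * E₂ u := fun u => by
    have h : c₁ * E₁ u + c₂ * E₂ u = X * d₁ u + si * d₁ w * d₂ u := by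
      rw [hc₁, hc₂, D1 u, D2 u]; ring
    rw [h, hX]
    simp only [E1, E2, map_sub, Derivation.leibniz, smul_eq_mul]
    linear_combination si * w * comm u
  have tors : ∀ i, E₁ (f i) - E₂ (e i) - si * w * (d₁ (b i) - d₂ (a i)) = c₁ * e i + c₂ * f i := by
    intro i
    have h : c₁ * e i + c₂ * f i = X * a i + si * d₁ w * b i := by
      rw [hc₁, hc₂, ha, hb]; ring
    rw [h, hX]
    simp only [E1, E2, he, hf, map_sub, Derivation.leibniz, smul_eq_mul]
    ring
  have hsw : si * w * ρ = 1 := by rw [hρs]; linear_combination s * si * hbw + hsi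
  obtain ⟨x0, x1, x2⟩ := hfr.cross_ef
  have cross0 : a 1 * b 2 - a 2 * b 1 = ρ * n 0 := by rw [← x0]; simp only [ha, hb, hρs]; ring
  have cross1 : a 2 * b 0 - a 0 * b 2 = ρ * n 1 := by rw [← x1]; simp only [ha, hb, hρs]; ring
  have cross2 : a 0 * b 1 - a 1 * b 0 = ρ * n 2 := by rw [← x2]; simp only [ha, hb, hρs]; ring
  rw [cross0] at tors₀
  rw [cross1] at tors₁
  rw [cross2] at tors₂
  have T0 : E₁ (f 0) - E₂ (e 0) + (2 * t + m) * n 0 = c₁ * e 0 + c₂ * f 0 := by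
    linear_combination tors 0 + si * w * tors₀ - (2 * t + m) * n 0 * hsw
  have T1 : E₁ (f 1) - E₂ (e 1) + (2 * t + m) * n 1 = c₁ * e 1 + c₂ * f 1 := by
    linear_combination tors 1 + si * w * tors₁ - (2 * t + m) * n 1 * hsw
  have T2 : E₁ (f 2) - E₂ (e 2) + 2 * t * n 2 = c₁ * e 2 + c₂ * f 2 := by
    linear_combination tors 2 + si * w * tors₂ - 2 * t * n 2 * hsw
  obtain ⟨p₁, hp₁⟩ : ∃ p, p = E₁ (e 0) * f 0 + E₁ (e 1) * f 1 + E₁ (e 2) * f 2 := ⟨_, rfl⟩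
  obtain ⟨q₁, hq₁⟩ : ∃ q, q = E₁ (e 0) * n 0 + E₁ (e 1) * n 1 + E₁ (e 2) * n 2 := ⟨_, rfl⟩
  obtain ⟨r₁, hr₁⟩ : ∃ r, r = E₁ (f 0) * n 0 + E₁ (f 1) * n 1 + E₁ (f 2) * n 2 := ⟨_, rfl⟩
  obtain ⟨p₂, hp₂⟩ : ∃ p, p = E₂ (e 0) * f 0 + E₂ (e 1) * f 1 + E₂ (e 2) * f 2 := ⟨_, rfl⟩
  obtain ⟨q₂, hq₂⟩ : ∃ q, q = E₂ (e 0) * n 0 + E₂ (e 1) * n 1 + E₂ (e 2) * n 2 := ⟨_, rfl⟩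
  obtain ⟨r₂, hr₂⟩ : ∃ r, r = E₂ (f 0) * n 0 + E₂ (f 1) * n 1 + E₂ (f 2) * n 2 := ⟨_, rfl⟩
  have F1 := hfr.deriv E₁ hp₁ hq₁ hr₁
  have F2 := hfr.deriv E₂ hp₂ hq₂ hr₂
  obtain ⟨y0, y1, y2⟩ := hfr.cross_fn
  obtain ⟨z0, z1, z2⟩ := hfr.cross_ne
  obtain ⟨V, hV⟩ : ∃ V : Fin 3 → R, V = ![E₁ (n 0) + t * (e 1 * n 2) - (t + m) * (e 2 * n 1),
    E₁ (n 1) + (t + m) * (e 2 * n 0) - t * (e 0 * n 2),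
    E₁ (n 2) + t * (e 0 * n 1) - t * (e 1 * n 0)] := ⟨_, rfl⟩
  obtain ⟨W, hW⟩ : ∃ W : Fin 3 → R, W = ![E₂ (n 0) + t * (f 1 * n 2) - (t + m) * (f 2 * n 1),
    E₂ (n 1) + (t + m) * (f 2 * n 0) - t * (f 0 * n 2),
    E₂ (n 2) + t * (f 0 * n 1) - t * (f 1 * n 0)] := ⟨_, rfl⟩
  have v11 : V 0 * e 0 + V 1 * e 1 + V 2 * e 2 = -(q₁ - m * e 2 * f 2) := by
    simp [hV, (F1 _).2.2]
    linear_combination -q₁ * hfr.ee - r₁ * hfr.ef + m * e 2 * z2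
  have v12 : V 0 * f 0 + V 1 * f 1 + V 2 * f 2 = -(r₁ + t + m * e 2 * e 2) := by
    simp [hV, (F1 _).2.2]
    linear_combination -q₁ * hfr.ef - r₁ * hfr.ff - t * hfr.det - m * e 2 * y2
  have v21 : W 0 * e 0 + W 1 * e 1 + W 2 * e 2 = -(q₂ - t - m * f 2 * f 2) := by
    simp [hW, (F2 _).2.2]
    linear_combination -q₂ * hfr.ee - r₂ * hfr.ef + t * hfr.det + m * f 2 * z2
  have v22 : W 0 * f 0 + W 1 * f 1 + W 2 * f 2 = -(r₂ + m * e 2 * f 2) := by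
    simp [hW, (F2 _).2.2]
    linear_combination -q₂ * hfr.ef - r₂ * hfr.ff - m * f 2 * y2
  have s11 : S₁₁ = s * s * (q₁ - m * e 2 * f 2) := by
    rw [h₁₁]
    simp only [D1, ha]
    simp [hV] at v11
    linear_combination -s * s * v11
  have s12 : S₁₂ = s * (b₁ * (q₁ - m * e 2 * f 2) + b₂ * (r₁ + t + m * e 2 * e 2)) := by
    rw [h₁₂]
    simp only [D1, ha, hb]
    simp [hV] at v11 v12
    linear_combination -s * b₁ * v11 - s * b₂ * v12
  have s21 : S₂₁ = s * (b₁ * (q₁ - m * e 2 * f 2) + b₂ * (q₂ - t - m * f 2 * f 2)) := by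
    rw [h₂₁]
    simp only [D2, ha, hb]
    simp [hV] at v11
    simp [hW] at v21
    linear_combination -s * b₁ * v11 - s * b₂ * v21
  have s22 : S₂₂ = b₁ * b₁ * (q₁ - m * e 2 * f 2) + b₁ * b₂ * (r₁ + t + m * e 2 * e 2)
      + b₁ * b₂ * (q₂ - t - m * f 2 * f 2) + b₂ * b₂ * (r₂ + m * e 2 * f 2) := by
    rw [h₂₂]
    simp only [D2, hb]
    simp [hV] at v11 v12
    simp [hW] at v21 v22
    linear_combination -b₁ * b₁ * v11 - b₁ * b₂ * v12 - b₁ * b₂ * v21 - b₂ * b₂ * v22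
  have hρ0 : IsUnit ρ := IsUnit.of_mul_eq_one ρi hρi
  have hH' : q₁ - m * e 2 * f 2 + (r₂ + m * e 2 * f 2) = 2 * H := by
    have hu : IsUnit (ρ * ρ) := hρ0.mul hρ0
    apply hu.mul_left_cancel
    rw [← lag, s11, s12, s21, s22, hg22, hg12, ← hs] at hH
    rw [hρs] at hH ⊢
    linear_combination hH
  have hA' : A = (q₁ - m * e 2 * f 2) ^ 2 + 2 * ((r₁ + t + m * e 2 * e 2)
      * (q₂ - t - m * f 2 * f 2)) + (r₂ + m * e 2 * f 2) ^ 2 := by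
    have hu : IsUnit ((ρ * ρ) ^ 2) := (hρ0.mul hρ0).pow 2
    apply hu.mul_left_cancel
    rw [← lag, s11, s12, s21, s22, hg22, hg12, ← hs] at hA
    rw [hρs] at hA ⊢
    linear_combination hA
  obtain ⟨et1, et2⟩ := constant t ht₁ ht₂
  obtain ⟨em1, em2⟩ := constant m hm₁ hm₂
  obtain ⟨eH1, eH2⟩ := constant H hH₁ hH₂
  obtain ⟨sym, P, Q, key⟩ := hfr.simons E₁ E₂ et1 et2 em1 em2 eH1 eH2 hD F1 F2 commE T0 T1 T2 hH' hA'
  refine ⟨fun h0 => ?_, P, Q, ?_⟩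
  · have cE1 := (F1 2).2.2
    have cE2 := (F2 2).2.2
    rw [h0, map_zero] at cE1 cE2
    rw [h0] at y0 y1 z0 z1
    have T := hfr.col_two
    rw [h0] at T
    -- When C vanishes, (e 2, f 2) is a unit vector. The derivative of C = 0, the trace and the
    -- symmetry of the second fundamental form then determine the derivative of n in the direction
    -- across ξ.
    have u1 : q₁ * f 2 - r₁ * e 2 = 2 * H * f 2 + (2 * t + m) * e 2 := by
      linear_combination -cE2 + f 2 * hH' - e 2 * sym + m * e 2 * T
    have u2 : q₂ * f 2 - r₂ * e 2 = -2 * H * e 2 + (2 * t + m) * f 2 := by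
      linear_combination cE1 - e 2 * hH' - f 2 * sym + m * f 2 * T
    have g1 : E₁ (n 0) = -2 * H * e 0 + (2 * t + m) * e 2 * n 1 := by
      rw [(F1 0).2.2]
      linear_combination n 1 * u1 + (q₁ - 2 * H) * y0 + r₁ * z0
    have g2 : E₁ (n 1) = -2 * H * e 1 - (2 * t + m) * e 2 * n 0 := by
      rw [(F1 1).2.2]
      linear_combination -n 0 * u1 + (q₁ - 2 * H) * y1 + r₁ * z1
    have g3 : E₂ (n 0) = -2 * H * f 0 + (2 * t + m) * f 2 * n 1 := by
      rw [(F2 0).2.2]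
      linear_combination n 1 * u2 + q₂ * y0 + (r₂ - 2 * H) * z0
    have g4 : E₂ (n 1) = -2 * H * f 1 - (2 * t + m) * f 2 * n 0 := by
      rw [(F2 1).2.2]
      linear_combination -n 0 * u2 + q₂ * y1 + (r₂ - 2 * H) * z1
    simp only [D1, D2, ha, hb, g1, g2, g3, g4]
    refine ⟨⟨?_, ?_⟩, ?_, ?_⟩ <;> ring
  obtain ⟨Y₁, hY₁⟩ : ∃ Y, Y = E₁ A - 4 * D * (H * (n 2 * e 2) - t * (n 2 * f 2)) := ⟨_, rfl⟩
  obtain ⟨Y₂, hY₂⟩ : ∃ Y, Y = E₂ A - 4 * D * (H * (n 2 * f 2) + t * (n 2 * e 2)) := ⟨_, rfl⟩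
  rw [← hY₁, ← hY₂] at key
  have l1 : L₁ = s * Y₁ := by
    rw [hL₁, hY₁, D1]; simp only [ha]
    linear_combination -4 * D * t * n 2 * s * (-z2)
  have l2 : L₂ = b₁ * Y₁ + b₂ * Y₂ := by
    rw [hL₂, hY₁, hY₂, D2]; simp only [hb]
    linear_combination 4 * D * t * n 2 * b₁ * z2 - 4 * D * t * n 2 * b₂ * y2
  -- b₂ Y₁ - b₁ Y₂ and s Y₂ are ρ times the coordinate components of the field Y₁ E₁ + Y₂ E₂, so the
  -- sum of their partial derivatives is ρ times its divergence.
  have x1 : ρi * (g₂₂ * L₁ - g₁₂ * L₂) = b₂ * Y₁ - b₁ * Y₂ := by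
    rw [l1, l2, hg22, hg12]
    rw [hρs] at hρi
    linear_combination (b₂ * Y₁ - b₁ * Y₂) * hρi
  have x2 : ρi * (g₁₁ * L₂ - g₁₂ * L₁) = s * Y₂ := by
    rw [l1, l2, ← hs, hg12]
    rw [hρs] at hρi
    linear_combination (s * Y₂) * hρi
  rw [x1, x2, mul_assoc, mul_left_comm, ← key]
  have dw : d₁ b₂ * w + b₂ * d₁ w = 0 := by
    have := congrArg d₁ hbw
    simp only [Derivation.leibniz, smul_eq_mul, Derivation.map_one_eq_zero] at this
    linear_combination this
  have ds : d₂ si * s + si * d₂ s = 0 := by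
    have := congrArg d₂ hsi
    simp only [Derivation.leibniz, smul_eq_mul, Derivation.map_one_eq_zero] at this
    linear_combination this
  have k1 : ρ * si = b₂ := hb₂.symm
  have k2 : ρ * w = s := by rw [hρs]; linear_combination s * hbw
  have k3 : ρ * k = b₁ := by rw [hk]; linear_combination b₁ * hsw
  have k4 : ρ * c₂ = -d₁ b₂ := by
    rw [hc₂]; linear_combination b₂ * d₁ w * k1 + b₂ * dw - d₁ b₂ * hbw
  have k5 : ρ * c₁ = d₂ s - d₁ b₁ := by
    have : d₁ k = d₁ w * b₁ * si + w * d₁ b₁ * si + w * b₁ * d₁ si := by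
      rw [hk]; simp only [Derivation.leibniz, smul_eq_mul]; ring
    rw [hc₁, hX, this]
    linear_combination (-d₂ si * s) * k2 + (s * d₁ si) * k3 - s * ds + d₂ s * hsi
      + (-s * (d₁ w * b₁ * si + w * d₁ b₁ * si + w * b₁ * d₁ si) + d₁ w * b₁) * k1
      - s * d₁ b₁ * si * hbw - s * b₁ * d₁ si * hbw - d₁ b₁ * hsi - d₁ w * b₁ * b₂ * hsi
  simp only [E1, E2, map_sub, Derivation.leibniz, smul_eq_mul]
  linear_combination -d₁ Y₁ * k1 - d₂ Y₂ * k2 + d₁ Y₂ * k3 + Y₁ * k4 - Y₂ * k5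
end Berger

/-! ### Structure equations of maps to the sphere, and the constant axis. -/

namespace Berger

/-- The torsion equations of the coframe of a map to the sphere. -/
theorem coframe_torsion {R : Type*} [CommRing R] [Algebra ℝ R] (d₁ d₂ : Derivation ℝ R R)
    {x : Fin 4 → R} {a b : Fin 3 → R} {c c' ε ε' t m : R}
    (comm : ∀ u, d₁ (d₂ u) = d₂ (d₁ u)) (hc₁ : d₁ c = 0) (hc₂ : d₂ c = 0) (hε₁ : d₁ ε = 0)
    (hε₂ : d₂ ε = 0) (hc : c * c' = 1) (hε : ε * ε' = 1) (hct : c * c = -(t * ε))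
    (htm : 2 * t + m = -2 * ε)
    (hx : x 0 * x 0 + x 1 * x 1 + x 2 * x 2 + x 3 * x 3 = 1)
    (h₁₀ : d₁ (x 0) = -c * a 0 * x 2 - c * a 1 * x 3 - ε * a 2 * x 1)
    (h₁₁ : d₁ (x 1) = c * a 0 * x 3 - c * a 1 * x 2 + ε * a 2 * x 0)
    (h₁₂ : d₁ (x 2) = c * a 0 * x 0 + c * a 1 * x 1 - ε * a 2 * x 3)
    (h₁₃ : d₁ (x 3) = -c * a 0 * x 1 + c * a 1 * x 0 + ε * a 2 * x 2)
    (h₂₀ : d₂ (x 0) = -c * b 0 * x 2 - c * b 1 * x 3 - ε * b 2 * x 1)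
    (h₂₁ : d₂ (x 1) = c * b 0 * x 3 - c * b 1 * x 2 + ε * b 2 * x 0)
    (h₂₂ : d₂ (x 2) = c * b 0 * x 0 + c * b 1 * x 1 - ε * b 2 * x 3)
    (h₂₃ : d₂ (x 3) = -c * b 0 * x 1 + c * b 1 * x 0 + ε * b 2 * x 2) :
    (d₁ (b 0) - d₂ (a 0) + (2 * t + m) * (a 1 * b 2 - a 2 * b 1) = 0) ∧
    (d₁ (b 1) - d₂ (a 1) + (2 * t + m) * (a 2 * b 0 - a 0 * b 2) = 0) ∧
    (d₁ (b 2) - d₂ (a 2) + 2 * t * (a 0 * b 1 - a 1 * b 0) = 0) := by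
  have k0 := comm (x 0)
  have k1 := comm (x 1)
  have k2 := comm (x 2)
  have k3 := comm (x 3)
  rw [h₁₀, h₂₀] at k0
  rw [h₁₁, h₂₁] at k1
  rw [h₁₂, h₂₂] at k2
  rw [h₁₃, h₂₃] at k3
  simp only [map_add, map_sub, map_neg, Derivation.leibniz, smul_eq_mul, hc₁, hc₂, hε₁, hε₂,
    h₁₀, h₁₁, h₁₂, h₁₃, h₂₀, h₂₁, h₂₂, h₂₃] at k0 k1 k2 k3
  -- The equality of mixed derivatives of x, paired in ℝ⁴ with the direction of each frame field,
  -- gives one structure equation per field.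
  have e0 : c * (d₁ (b 0) - d₂ (a 0) + (2 * t + m) * (a 1 * b 2 - a 2 * b 1)) = 0 := by
    linear_combination -x 2 * k0 + x 3 * k1 + x 0 * k2 - x 1 * k3
      - c * (d₁ (b 0) - d₂ (a 0) - 2 * ε * (a 1 * b 2 - a 2 * b 1)) * hx
      + c * (a 1 * b 2 - a 2 * b 1) * htm
  have e1 : c * (d₁ (b 1) - d₂ (a 1) + (2 * t + m) * (a 2 * b 0 - a 0 * b 2)) = 0 := by
    linear_combination -x 3 * k0 - x 2 * k1 + x 1 * k2 + x 0 * k3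
      - c * (d₁ (b 1) - d₂ (a 1) - 2 * ε * (a 2 * b 0 - a 0 * b 2)) * hx
      + c * (a 2 * b 0 - a 0 * b 2) * htm
  have e2 : ε * (d₁ (b 2) - d₂ (a 2) + 2 * t * (a 0 * b 1 - a 1 * b 0)) = 0 := by
    linear_combination -x 1 * k0 + x 0 * k1 - x 3 * k2 + x 2 * k3
      - (ε * (d₁ (b 2) - d₂ (a 2)) - 2 * c * c * (a 0 * b 1 - a 1 * b 0)) * hx
      + 2 * (a 0 * b 1 - a 1 * b 0) * hct
  refine ⟨?_, ?_, ?_⟩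
  · linear_combination c' * e0 - (d₁ (b 0) - d₂ (a 0) + (2 * t + m) * (a 1 * b 2 - a 2 * b 1)) * hc
  · linear_combination c' * e1 - (d₁ (b 1) - d₂ (a 1) + (2 * t + m) * (a 2 * b 0 - a 0 * b 2)) * hc
  · linear_combination ε' * e2 - (d₁ (b 2) - d₂ (a 2) + 2 * t * (a 0 * b 1 - a 1 * b 0)) * hε

/-- The vector of `R³` normal to the plane of the projected curve of a surface with vanishing angle
is constant. -/
theorem axis_constant {R : Type*} [CommRing R] [Algebra ℝ R] (d : Derivation ℝ R R)
    {x : Fin 4 → R} {a n : Fin 3 → R} {c ε H : R} (hc : d c = 0) (hH : d H = 0)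
    (h₀ : d (x 0) = -c * a 0 * x 2 - c * a 1 * x 3 - ε * a 2 * x 1)
    (h₁ : d (x 1) = c * a 0 * x 3 - c * a 1 * x 2 + ε * a 2 * x 0)
    (h₂ : d (x 2) = c * a 0 * x 0 + c * a 1 * x 1 - ε * a 2 * x 3)
    (h₃ : d (x 3) = -c * a 0 * x 1 + c * a 1 * x 0 + ε * a 2 * x 2)
    (han : a 0 * n 0 + a 1 * n 1 = 0)
    (n₀ : d (n 0) = -2 * H * a 0 - 2 * ε * a 2 * n 1)
    (n₁ : d (n 1) = -2 * H * a 1 + 2 * ε * a 2 * n 0) :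
    d (H * (2 * (x 0 * x 2 + x 1 * x 3)) + c * (n 0 * (x 0 * x 0 - x 1 * x 1 - x 2 * x 2 + x 3 * x 3)
      + n 1 * (2 * (x 0 * x 1 - x 2 * x 3)))) = 0 ∧
    d (H * (2 * (x 1 * x 2 - x 0 * x 3)) + c * (n 0 * (2 * (x 0 * x 1 + x 2 * x 3))
      + n 1 * (x 1 * x 1 + x 3 * x 3 - x 0 * x 0 - x 2 * x 2))) = 0 ∧
    d (H * (x 0 * x 0 + x 1 * x 1 - x 2 * x 2 - x 3 * x 3) + c * (n 0 * (2 * (x 1 * x 3 - x 0 * x 2))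
      + n 1 * (-2 * (x 0 * x 3 + x 1 * x 2)))) = 0 := by
  have h2 : d (2 : R) = 0 := d.map_natCast 2
  refine ⟨?_, ?_, ?_⟩ <;>
    simp only [map_add, map_sub, map_neg, neg_mul, Derivation.leibniz, smul_eq_mul, hc, hH, h2,
      h₀, h₁, h₂, h₃, n₀, n₁]
  · linear_combination -2 * c * c * (2 * (x 0 * x 2 + x 1 * x 3)) * han
  · linear_combination -2 * c * c * (2 * (x 1 * x 2 - x 0 * x 3)) * han
  · linear_combination -2 * c * c * (x 0 * x 0 + x 1 * x 1 - x 2 * x 2 - x 3 * x 3) * han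
end Berger

/-! ### The algebra of smooth functions on an open set and its derivations. -/

namespace Berger

/-- The algebra of smooth real functions on a subset `V` of a normed space. -/
def smoothFun {E : Type*} [NormedAddCommGroup E] [NormedSpace ℝ E] (V : Set E) :
    Subalgebra ℝ (V → ℝ) where
  carrier := {g | ∃ G : E → ℝ, ContDiffOn ℝ ∞ G V ∧ g = fun x : V => G x}
  mul_mem' := by
    rintro _ _ ⟨F, hF, rfl⟩ ⟨G, hG, rfl⟩
    exact ⟨fun x => F x * G x, hF.mul hG, rfl⟩
  add_mem' := by
    rintro _ _ ⟨F, hF, rfl⟩ ⟨G, hG, rfl⟩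
    exact ⟨fun x => F x + G x, hF.add hG, rfl⟩
  algebraMap_mem' r := ⟨fun _ => r, contDiffOn_const, rfl⟩

namespace smoothFun

variable {E : Type*} [NormedAddCommGroup E] [NormedSpace ℝ E] {V : Set E}

/-- The element of `smoothFun V` given by a function on the ambient space. -/
def of (G : E → ℝ) (hG : ContDiffOn ℝ ∞ G V) : smoothFun V := ⟨fun x => G x, G, hG, rfl⟩

theorem exists_of (u : smoothFun V) : ∃ G hG, u = of G hG := by
  obtain ⟨_, G, hG, rfl⟩ := u
  exact ⟨G, hG, rfl⟩

theorem of_eq_of_iff {F G : E → ℝ} (hF : ContDiffOn ℝ ∞ F V) (hG : ContDiffOn ℝ ∞ G V) :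
    of F hF = of G hG ↔ ∀ x ∈ V, F x = G x := by
  exact ⟨fun h x hx => congrFun (congrArg Subtype.val h) ⟨x, hx⟩,
    fun h => Subtype.ext (funext fun x => h x x.2)⟩

theorem of_mul {F G : E → ℝ} (hF : ContDiffOn ℝ ∞ F V) (hG : ContDiffOn ℝ ∞ G V) :
    of F hF * of G hG = of (fun x => F x * G x) (hF.mul hG) := rfl

theorem of_add {F G : E → ℝ} (hF : ContDiffOn ℝ ∞ F V) (hG : ContDiffOn ℝ ∞ G V) :
    of F hF + of G hG = of (fun x => F x + G x) (hF.add hG) := rfl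

theorem of_sub {F G : E → ℝ} (hF : ContDiffOn ℝ ∞ F V) (hG : ContDiffOn ℝ ∞ G V) :
    of F hF - of G hG = of (fun x => F x - G x) (hF.sub hG) := rfl

theorem smul_of (r : ℝ) {F : E → ℝ} (hF : ContDiffOn ℝ ∞ F V) :
    r • of F hF = of (fun x => r * F x) (contDiffOn_const.mul hF) := rfl

theorem contDiffOn_fderiv_apply (hV : IsOpen V) {F : E → ℝ} (hF : ContDiffOn ℝ ∞ F V) (v : E) :
    ContDiffOn ℝ ∞ (fun x => fderiv ℝ F x v) V :=
  (hF.fderiv_of_isOpen hV (m := ∞) le_rfl).clm_apply contDiffOn_const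

theorem differentiableAt (hV : IsOpen V) {F : E → ℝ} (hF : ContDiffOn ℝ ∞ F V) {x : E}
    (hx : x ∈ V) : DifferentiableAt ℝ F x :=
  (hF.contDiffAt (hV.mem_nhds hx)).differentiableAt (by simp)

/-- The function underlying the derivative. -/
def derFun (hV : IsOpen V) (v : E) (u : smoothFun V) : smoothFun V :=
  of (fun x => fderiv ℝ (exists_of u).choose x v)
    (contDiffOn_fderiv_apply hV (exists_of u).choose_spec.choose v)

/-- Any two functions representing the same element agree on the open set V, hence near each of its
points, so the chosen representative is immaterial. -/
theorem derFun_of (hV : IsOpen V) (v : E) {F : E → ℝ} (hF : ContDiffOn ℝ ∞ F V) :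
    derFun hV v (of F hF) = of (fun x => fderiv ℝ F x v) (contDiffOn_fderiv_apply hV hF v) := by
  rw [derFun, of_eq_of_iff]
  intro x hx
  have h := (exists_of (of F hF)).choose_spec.choose_spec
  rw [of_eq_of_iff] at h
  have : (exists_of (of F hF)).choose =ᶠ[nhds x] F := by
    filter_upwards [hV.mem_nhds hx] with y hy using (h y hy).symm
  rw [this.fderiv_eq]

/-- The derivative in the direction `v`, as a derivation. -/
def der (hV : IsOpen V) (v : E) : Derivation ℝ (smoothFun V) (smoothFun V) :=
  Derivation.mk'
    { toFun := derFun hV v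
      map_add' := fun a b => by
        obtain ⟨F, hF, rfl⟩ := exists_of a
        obtain ⟨G, hG, rfl⟩ := exists_of b
        rw [of_add, derFun_of, derFun_of, derFun_of, of_add, of_eq_of_iff]
        intro x hx
        rw [fderiv_fun_add (differentiableAt hV hF hx) (differentiableAt hV hG hx)]
        rfl
      map_smul' := fun r a => by
        obtain ⟨F, hF, rfl⟩ := exists_of a
        rw [smul_of, derFun_of, derFun_of, RingHom.id_apply, smul_of, of_eq_of_iff]
        intro x hx
        rw [fderiv_const_mul (differentiableAt hV hF hx)]
        rfl }
    fun a b => by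
      obtain ⟨F, hF, rfl⟩ := exists_of a
      obtain ⟨G, hG, rfl⟩ := exists_of b
      change derFun hV v _ = _ • derFun hV v _ + _ • derFun hV v _
      rw [of_mul, derFun_of, derFun_of, derFun_of, smul_eq_mul, smul_eq_mul, of_mul, of_mul, of_add,
        of_eq_of_iff]
      intro x hx
      rw [fderiv_fun_mul (differentiableAt hV hF hx) (differentiableAt hV hG hx)]
      simp

theorem der_of (hV : IsOpen V) (v : E) {F : E → ℝ} (hF : ContDiffOn ℝ ∞ F V) :
    der hV v (of F hF) = of (fun x => fderiv ℝ F x v) (contDiffOn_fderiv_apply hV hF v) :=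
  derFun_of hV v hF

theorem der_comm (hV : IsOpen V) (v w : E) (u : smoothFun V) :
    der hV v (der hV w u) = der hV w (der hV v u) := by
  obtain ⟨F, hF, rfl⟩ := exists_of u
  rw [der_of, der_of, der_of, der_of, of_eq_of_iff]
  intro x hx
  have hs : IsSymmSndFDerivAt ℝ F x :=
    (hF.contDiffAt (hV.mem_nhds hx)).isSymmSndFDerivAt (by
      simpa using WithTop.coe_le_coe.2 (le_top : (2 : ℕ∞) ≤ ⊤))
  have hd : DifferentiableAt ℝ (fderiv ℝ F) x :=
    ((hF.fderiv_of_isOpen hV (m := ∞) le_rfl).contDiffAt (hV.mem_nhds hx)).differentiableAt (by simp)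
  rw [fderiv_clm_apply hd (differentiableAt_const _), fderiv_clm_apply hd (differentiableAt_const _)]
  simp
  exact hs.eq v w

end smoothFun
end Berger

/-! ### The Berger metric in its orthonormal frame. -/

namespace Berger

theorem frame_zero (κ τ : ℝ) (x : R4) :
    frame κ τ 0 x = (√κ / 2) • !₂[-x 2, x 3, x 0, -x 1] := rfl
theorem frame_one (κ τ : ℝ) (x : R4) :
    frame κ τ 1 x = (√κ / 2) • !₂[-x 3, -x 2, x 1, x 0] := rfl
theorem frame_two (κ τ : ℝ) (x : R4) :
    frame κ τ 2 x = (κ / (4 * τ)) • hopfField x := rfl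

theorem hopfField_contDiff : ContDiff ℝ ∞ hopfField := by
  rw [contDiff_euclidean]
  intro i
  fin_cases i <;> simp [hopfField] <;> fun_prop

theorem frame_contDiff (κ τ : ℝ) (i : Fin 3) : ContDiff ℝ ∞ (frame κ τ i) := by
  rw [contDiff_euclidean]
  intro j
  fin_cases i <;> fin_cases j <;> simp [frame, xi, hopfField] <;> fun_prop

theorem metric_comm (κ τ : ℝ) (x v w : R4) : metric κ τ x v w = metric κ τ x w v := by
  simp only [metric, real_inner_comm v w]; ring

theorem metric_add_left (κ τ : ℝ) (x u v w : R4) :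
    metric κ τ x (u + v) w = metric κ τ x u w + metric κ τ x v w := by
  simp only [metric, inner_add_left]; ring

theorem metric_smul_left (κ τ r : ℝ) (x v w : R4) :
    metric κ τ x (r • v) w = r * metric κ τ x v w := by
  simp only [metric, real_inner_smul_left]; ring

theorem metric_add_right (κ τ : ℝ) (x u v w : R4) :
    metric κ τ x w (u + v) = metric κ τ x w u + metric κ τ x w v := by
  simp only [metric, inner_add_right, inner_add_left]; ring

theorem metric_smul_right (κ τ r : ℝ) (x v w : R4) :
    metric κ τ x w (r • v) = r * metric κ τ x w v := by
  simp only [metric, real_inner_smul_right, real_inner_smul_left]; ring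

theorem metric_contDiffOn {E : Type*} [NormedAddCommGroup E] [NormedSpace ℝ E] (κ τ : ℝ) {V : Set E}
    {F G K : E → R4} (hF : ContDiffOn ℝ ∞ F V) (hG : ContDiffOn ℝ ∞ G V)
    (hK : ContDiffOn ℝ ∞ K V) : ContDiffOn ℝ ∞ (fun p => metric κ τ (F p) (G p) (K p)) V := by
  have := hopfField_contDiff.comp_contDiffOn hF
  simp only [metric]
  exact contDiffOn_const.mul ((hG.inner ℝ hK).add
    (contDiffOn_const.mul ((hG.inner ℝ this).mul (hK.inner ℝ this))))

theorem metric_frame_zero {κ : ℝ} (hκ : 0 < κ) (τ : ℝ) (x v : R4) :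
    metric κ τ x v (frame κ τ 0 x) = 2 / √κ * (-v 0 * x 2 + v 1 * x 3 + v 2 * x 0 - v 3 * x 1) := by
  obtain ⟨s, hs, rfl⟩ : ∃ s : ℝ, 0 < s ∧ κ = s ^ 2 :=
    ⟨√κ, Real.sqrt_pos.2 hκ, (Real.sq_sqrt hκ.le).symm⟩
  simp only [metric, inner_R4, frame_zero, Real.sqrt_sq hs.le]
  simp [hopfField]
  field_simp
  ring

theorem metric_frame_one {κ : ℝ} (hκ : 0 < κ) (τ : ℝ) (x v : R4) :
    metric κ τ x v (frame κ τ 1 x) = 2 / √κ * (-v 0 * x 3 - v 1 * x 2 + v 2 * x 1 + v 3 * x 0) := by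
  obtain ⟨s, hs, rfl⟩ : ∃ s : ℝ, 0 < s ∧ κ = s ^ 2 :=
    ⟨√κ, Real.sqrt_pos.2 hκ, (Real.sq_sqrt hκ.le).symm⟩
  simp only [metric, inner_R4, frame_one, Real.sqrt_sq hs.le]
  simp [hopfField]
  field_simp
  ring

theorem metric_frame_two {κ τ : ℝ} (hκ : 0 < κ) (hτ : τ ≠ 0) {x : R4} (v : R4)
    (hx : x 0 ^ 2 + x 1 ^ 2 + x 2 ^ 2 + x 3 ^ 2 = 1) :
    metric κ τ x v (frame κ τ 2 x) =
      4 * τ / κ * (-v 0 * x 1 + v 1 * x 0 - v 2 * x 3 + v 3 * x 2) := by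
  simp only [metric, inner_R4, frame_two]
  simp [hopfField]
  field_simp
  linear_combination ((4 * τ ^ 2 - κ) * (-v 0 * x 1 + v 1 * x 0 - v 2 * x 3 + v 3 * x 2)) * hx

/-- Expansion of a tangent vector in the frame, in coordinates. -/
theorem tangent_coord {κ τ : ℝ} (hκ : 0 < κ) (hτ : τ ≠ 0) {x v : R4}
    (hx : x 0 ^ 2 + x 1 ^ 2 + x 2 ^ 2 + x 3 ^ 2 = 1)
    (hv : v 0 * x 0 + v 1 * x 1 + v 2 * x 2 + v 3 * x 3 = 0) {a₀ a₁ a₂ c ε : ℝ}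
    (h₀ : a₀ = metric κ τ x v (frame κ τ 0 x)) (h₁ : a₁ = metric κ τ x v (frame κ τ 1 x))
    (h₂ : a₂ = metric κ τ x v (frame κ τ 2 x)) (hc : c = √κ / 2) (hε : ε = κ / (4 * τ)) :
    v 0 = -c * a₀ * x 2 - c * a₁ * x 3 - ε * a₂ * x 1 ∧
    v 1 = c * a₀ * x 3 - c * a₁ * x 2 + ε * a₂ * x 0 ∧
    v 2 = c * a₀ * x 0 + c * a₁ * x 1 - ε * a₂ * x 3 ∧
    v 3 = -c * a₀ * x 1 + c * a₁ * x 0 + ε * a₂ * x 2 := by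
  have e0 : c * a₀ = -v 0 * x 2 + v 1 * x 3 + v 2 * x 0 - v 3 * x 1 := by
    have : √κ ≠ 0 := (Real.sqrt_pos.2 hκ).ne'
    rw [h₀, hc, metric_frame_zero hκ]; field_simp
  have e1 : c * a₁ = -v 0 * x 3 - v 1 * x 2 + v 2 * x 1 + v 3 * x 0 := by
    have : √κ ≠ 0 := (Real.sqrt_pos.2 hκ).ne'
    rw [h₁, hc, metric_frame_one hκ]; field_simp
  have e2 : ε * a₂ = -v 0 * x 1 + v 1 * x 0 - v 2 * x 3 + v 3 * x 2 := by
    rw [h₂, hε, metric_frame_two hκ hτ v hx]; field_simp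
  rw [neg_mul, e0, e1, e2]
  refine ⟨?_, ?_, ?_, ?_⟩
  · linear_combination -v 0 * hx + x 0 * hv
  · linear_combination -v 1 * hx + x 1 * hv
  · linear_combination -v 2 * hx + x 2 * hv
  · linear_combination -v 3 * hx + x 3 * hv

theorem tangent_expand {κ τ : ℝ} (hκ : 0 < κ) (hτ : τ ≠ 0) {x v : R4}
    (hx : x 0 ^ 2 + x 1 ^ 2 + x 2 ^ 2 + x 3 ^ 2 = 1) (hv : inner ℝ v x = 0) :
    v = metric κ τ x v (frame κ τ 0 x) • frame κ τ 0 x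
      + metric κ τ x v (frame κ τ 1 x) • frame κ τ 1 x
      + metric κ τ x v (frame κ τ 2 x) • frame κ τ 2 x := by
  rw [inner_R4] at hv
  obtain ⟨h0, h1, h2, h3⟩ := tangent_coord hκ hτ hx hv rfl rfl rfl rfl rfl
  ext i
  fin_cases i
  · refine h0.trans ?_; simp [frame_zero, frame_one, frame_two, hopfField]; ring
  · refine h1.trans ?_; simp [frame_zero, frame_one, frame_two, hopfField]; ring
  · refine h2.trans ?_; simp [frame_zero, frame_one, frame_two, hopfField]; ring
  · refine h3.trans ?_; simp [frame_zero, frame_one, frame_two, hopfField]; ring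

theorem metric_eq_sum {κ τ : ℝ} (hκ : 0 < κ) (hτ : τ ≠ 0) {x v : R4} (w : R4)
    (hx : x 0 ^ 2 + x 1 ^ 2 + x 2 ^ 2 + x 3 ^ 2 = 1) (hv : inner ℝ v x = 0) :
    metric κ τ x v w = metric κ τ x v (frame κ τ 0 x) * metric κ τ x w (frame κ τ 0 x)
      + metric κ τ x v (frame κ τ 1 x) * metric κ τ x w (frame κ τ 1 x)
      + metric κ τ x v (frame κ τ 2 x) * metric κ τ x w (frame κ τ 2 x) := by
  conv_lhs => rw [tangent_expand hκ hτ hx hv]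
  simp only [metric_add_left, metric_smul_left, metric_comm κ τ x w]

end Berger

/-! ### Brackets and Levi-Civita connection of the frame. -/

namespace Berger

theorem frame_add (κ τ : ℝ) (i : Fin 3) (x y : R4) :
    frame κ τ i (x + y) = frame κ τ i x + frame κ τ i y := by
  ext j
  fin_cases i <;> fin_cases j <;> simp [frame, xi, hopfField] <;> ring

theorem frame_smul (κ τ r : ℝ) (i : Fin 3) (x : R4) :
    frame κ τ i (r • x) = r • frame κ τ i x := by
  ext j
  fin_cases i <;> fin_cases j <;> simp [frame, xi, hopfField] <;> ring

/-- The frame fields are linear in x, so brackets become commutators of linear maps. -/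
theorem fderiv_frame (κ τ : ℝ) (i : Fin 3) (x v : R4) :
    fderiv ℝ (frame κ τ i) x v = frame κ τ i v := by
  let L : R4 →ₗ[ℝ] R4 := ⟨⟨frame κ τ i, frame_add κ τ i⟩, fun r x => frame_smul κ τ r i x⟩
  exact congrArg (· v) (L.toContinuousLinearMap.fderiv (x := x))

theorem frameBracket_eq (κ τ : ℝ) (i j : Fin 3) (x : R4) :
    frameBracket κ τ i j x = frame κ τ j (frame κ τ i x) - frame κ τ i (frame κ τ j x) := by
  rw [frameBracket, VectorField.lieBracket, fderiv_frame, fderiv_frame]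

theorem frameBracket_swap (κ τ : ℝ) (i j : Fin 3) (x : R4) :
    frameBracket κ τ i j x = (-1 : ℝ) • frameBracket κ τ j i x := by
  rw [frameBracket_eq, frameBracket_eq, neg_one_smul, neg_sub]

theorem frameBracket_self (κ τ : ℝ) (i : Fin 3) (x : R4) :
    frameBracket κ τ i i x = (0 : ℝ) • frame κ τ 0 x := by
  rw [frameBracket_eq, sub_self, zero_smul]

variable {κ τ : ℝ}

theorem frameBracket_zero_one (hκ : 0 < κ) (hτ : τ ≠ 0) (x : R4) :
    frameBracket κ τ 0 1 x = (-2 * τ) • frame κ τ 2 x := by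
  obtain ⟨s, hs, rfl⟩ : ∃ s : ℝ, 0 < s ∧ κ = s ^ 2 :=
    ⟨√κ, Real.sqrt_pos.2 hκ, (Real.sq_sqrt hκ.le).symm⟩
  rw [frameBracket_eq]
  ext j
  fin_cases j <;> simp [frame_zero, frame_one, frame_two, hopfField, Real.sqrt_sq hs.le] <;>
    field_simp <;> ring

theorem frameBracket_one_two (hκ : 0 < κ) (hτ : τ ≠ 0) (x : R4) :
    frameBracket κ τ 1 2 x = (-κ / (2 * τ)) • frame κ τ 0 x := by
  obtain ⟨s, hs, rfl⟩ : ∃ s : ℝ, 0 < s ∧ κ = s ^ 2 :=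
    ⟨√κ, Real.sqrt_pos.2 hκ, (Real.sq_sqrt hκ.le).symm⟩
  rw [frameBracket_eq]
  ext j
  fin_cases j <;> simp [frame_zero, frame_one, frame_two, hopfField, Real.sqrt_sq hs.le] <;>
    field_simp <;> ring

theorem frameBracket_two_zero (hκ : 0 < κ) (hτ : τ ≠ 0) (x : R4) :
    frameBracket κ τ 2 0 x = (-κ / (2 * τ)) • frame κ τ 1 x := by
  obtain ⟨s, hs, rfl⟩ : ∃ s : ℝ, 0 < s ∧ κ = s ^ 2 :=
    ⟨√κ, Real.sqrt_pos.2 hκ, (Real.sq_sqrt hκ.le).symm⟩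
  rw [frameBracket_eq]
  ext j
  fin_cases j <;> simp [frame_zero, frame_one, frame_two, hopfField, Real.sqrt_sq hs.le] <;>
    field_simp <;> ring

/-- The connection terms of the covariant derivative, as a cross product. -/
theorem sum_connCoeff (hκ : 0 < κ) (hτ : τ ≠ 0) (x : S3) (a n : Fin 3 → ℝ) {t m : ℝ}
    (ht : t = -τ) (hm : m = 2 * τ - κ / (2 * τ)) :
    (∑ i : Fin 3, ∑ j : Fin 3, a i * n j * connCoeff κ τ x i j 0
      = t * (a 1 * n 2) - (t + m) * (a 2 * n 1)) ∧
    (∑ i : Fin 3, ∑ j : Fin 3, a i * n j * connCoeff κ τ x i j 1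
      = (t + m) * (a 2 * n 0) - t * (a 0 * n 2)) ∧
    (∑ i : Fin 3, ∑ j : Fin 3, a i * n j * connCoeff κ τ x i j 2
      = t * (a 0 * n 1) - t * (a 1 * n 0)) := by
  have h01 := frameBracket_zero_one hκ hτ x
  have h12 := frameBracket_one_two hκ hτ x
  have h20 := frameBracket_two_zero hκ hτ x
  have h10 := frameBracket_swap κ τ 1 0 x
  have h21 := frameBracket_swap κ τ 2 1 x
  have h02 := frameBracket_swap κ τ 0 2 x
  rw [h01] at h10
  rw [h12] at h21
  rw [h20] at h02
  subst ht hm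
  refine ⟨?_, ?_, ?_⟩ <;>
    simp [Fin.sum_univ_three, connCoeff, h01, h12, h20, h10, h21, h02, frameBracket_self,
      metric_smul_left, metric_frame hκ hτ, -one_div, -neg_smul, -zero_smul] <;>
    field_simp <;> ring

end Berger

/-! ### Parametrized surfaces and their fundamental forms. -/

namespace Berger

/-- The parameter plane. -/
abbrev E2 : Type := EuclideanSpace ℝ (Fin 2)

/-- The `i`-th partial derivative. -/
def pd {W : Type*} [NormedAddCommGroup W] [NormedSpace ℝ W] (G : E2 → W) (i : Fin 2) (p : E2) : W :=
  fderiv ℝ G p (EuclideanSpace.single i 1)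

/-- The components of `∂ᵢF` in the frame of `E(κ,τ)`. -/
def coframe (κ τ : ℝ) (F : E2 → R4) (i : Fin 2) (k : Fin 3) (p : E2) : ℝ :=
  metric κ τ (F p) (pd F i p) (frame κ τ k (F p))

/-- The components of a field `ν` along `F` in the frame of `E(κ,τ)`. -/
def normalComp (κ τ : ℝ) (F ν : E2 → R4) (k : Fin 3) (p : E2) : ℝ :=
  metric κ τ (F p) (ν p) (frame κ τ k (F p))

/-- The coefficients of the first fundamental form. -/
def gramE (κ τ : ℝ) (F : E2 → R4) (i j : Fin 2) (p : E2) : ℝ :=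
  metric κ τ (F p) (pd F i p) (pd F j p)

/-- The determinant of the first fundamental form. -/
def gramDet (κ τ : ℝ) (F : E2 → R4) (p : E2) : ℝ :=
  gramE κ τ F 0 0 p * gramE κ τ F 1 1 p - gramE κ τ F 0 1 p * gramE κ τ F 0 1 p

/-- The coefficients of the second fundamental form. -/
def secE (κ τ : ℝ) (F ν : E2 → R4) (i j : Fin 2) (p : E2) : ℝ :=
  -((pd (normalComp κ τ F ν 0) i p + (-τ) * (coframe κ τ F i 1 p * normalComp κ τ F ν 2 p)
        - (-τ + (2 * τ - κ / (2 * τ))) * (coframe κ τ F i 2 p * normalComp κ τ F ν 1 p))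
      * coframe κ τ F j 0 p
    + (pd (normalComp κ τ F ν 1) i p
        + (-τ + (2 * τ - κ / (2 * τ))) * (coframe κ τ F i 2 p * normalComp κ τ F ν 0 p)
        - (-τ) * (coframe κ τ F i 0 p * normalComp κ τ F ν 2 p)) * coframe κ τ F j 1 p
    + (pd (normalComp κ τ F ν 2) i p + (-τ) * (coframe κ τ F i 0 p * normalComp κ τ F ν 1 p)
        - (-τ) * (coframe κ τ F i 1 p * normalComp κ τ F ν 0 p)) * coframe κ τ F j 2 p)

/-- A parametrized surface `F` in `E(κ,τ)` with unit normal `ν` and constant mean curvature `H`. -/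
structure LocalSurface (κ τ H : ℝ) (V : Set E2) (F ν : E2 → R4) : Prop where
  isOpen : IsOpen V
  smooth : ContDiffOn ℝ ∞ F V
  smooth_normal : ContDiffOn ℝ ∞ ν V
  sphere : ∀ p ∈ V, ‖F p‖ = 1
  tangent : ∀ p ∈ V, inner ℝ (ν p) (F p) = 0
  unit : ∀ p ∈ V, metric κ τ (F p) (ν p) (ν p) = 1
  normal : ∀ p ∈ V, ∀ i, metric κ τ (F p) (ν p) (pd F i p) = 0
  gramDet_pos : ∀ p ∈ V, 0 < gramDet κ τ F p
  gram_pos : ∀ p ∈ V, 0 < gramE κ τ F 0 0 p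
  mean : ∀ p ∈ V, gramE κ τ F 1 1 p * secE κ τ F ν 0 0 p - gramE κ τ F 0 1 p * secE κ τ F ν 1 0 p
    - gramE κ τ F 0 1 p * secE κ τ F ν 0 1 p + gramE κ τ F 0 0 p * secE κ τ F ν 1 1 p
    = 2 * H * gramDet κ τ F p

/-- The numerator of `|A|²`. -/
def normSqNum (κ τ : ℝ) (F ν : E2 → R4) (p : E2) : ℝ :=
  (gramE κ τ F 1 1 p * secE κ τ F ν 0 0 p - gramE κ τ F 0 1 p * secE κ τ F ν 1 0 p) ^ 2
    + 2 * ((gramE κ τ F 1 1 p * secE κ τ F ν 0 1 p - gramE κ τ F 0 1 p * secE κ τ F ν 1 1 p)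
      * (gramE κ τ F 0 0 p * secE κ τ F ν 1 0 p - gramE κ τ F 0 1 p * secE κ τ F ν 0 0 p))
    + (gramE κ τ F 0 0 p * secE κ τ F ν 1 1 p - gramE κ τ F 0 1 p * secE κ τ F ν 0 1 p) ^ 2

/-- The covector field `d|A|² - 4(κ-4τ²)(HC⟨ξ,·⟩ - τC⟨N×ξ,·⟩)`, where `A`, `HC`, `CN` stand for
`|A|²`, `HC` and `CN`. -/
def simonsCovector (κ τ : ℝ) (F : E2 → R4) (A HC : E2 → ℝ) (CN : Fin 3 → E2 → ℝ) (i : Fin 2)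
    (p : E2) : ℝ :=
  pd A i p - 4 * (κ - 4 * τ ^ 2) * (HC p * coframe κ τ F i 2 p
    - τ * (CN 1 p * coframe κ τ F i 0 p - CN 0 p * coframe κ τ F i 1 p))

/-- The components of the dual vector field. -/
def simonsField (κ τ : ℝ) (F : E2 → R4) (A HC : E2 → ℝ) (CN : Fin 3 → E2 → ℝ) (i : Fin 2)
    (p : E2) : ℝ :=
  match i with
  | 0 => (gramE κ τ F 1 1 p * simonsCovector κ τ F A HC CN 0 p
      - gramE κ τ F 0 1 p * simonsCovector κ τ F A HC CN 1 p) / gramDet κ τ F p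
  | 1 => (gramE κ τ F 0 0 p * simonsCovector κ τ F A HC CN 1 p
      - gramE κ τ F 0 1 p * simonsCovector κ τ F A HC CN 0 p) / gramDet κ τ F p

namespace LocalSurface

variable {κ τ H : ℝ} {V : Set E2} {F ν : E2 → R4}

theorem _root_.Berger.contDiffOn_pd {W : Type*} [NormedAddCommGroup W] [NormedSpace ℝ W]
    {G : E2 → W} (hV : IsOpen V) (hG : ContDiffOn ℝ ∞ G V) (i : Fin 2) :
    ContDiffOn ℝ ∞ (pd G i) V :=
  (hG.fderiv_of_isOpen hV (m := ∞) le_rfl).clm_apply contDiffOn_const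

theorem contDiffOn_coframe (h : LocalSurface κ τ H V F ν) (i : Fin 2) (k : Fin 3) :
    ContDiffOn ℝ ∞ (coframe κ τ F i k) V :=
  metric_contDiffOn κ τ h.smooth (contDiffOn_pd h.isOpen h.smooth i)
    ((frame_contDiff κ τ k).comp_contDiffOn h.smooth)

theorem contDiffOn_normalComp (h : LocalSurface κ τ H V F ν) (k : Fin 3) :
    ContDiffOn ℝ ∞ (normalComp κ τ F ν k) V :=
  metric_contDiffOn κ τ h.smooth h.smooth_normal ((frame_contDiff κ τ k).comp_contDiffOn h.smooth)

theorem contDiffOn_gramE (h : LocalSurface κ τ H V F ν) (i j : Fin 2) :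
    ContDiffOn ℝ ∞ (gramE κ τ F i j) V :=
  metric_contDiffOn κ τ h.smooth (contDiffOn_pd h.isOpen h.smooth i)
    (contDiffOn_pd h.isOpen h.smooth j)

theorem contDiffOn_gramDet (h : LocalSurface κ τ H V F ν) : ContDiffOn ℝ ∞ (gramDet κ τ F) V :=
  ((h.contDiffOn_gramE 0 0).mul (h.contDiffOn_gramE 1 1)).sub
    ((h.contDiffOn_gramE 0 1).mul (h.contDiffOn_gramE 0 1))

theorem contDiffOn_secE (h : LocalSurface κ τ H V F ν) (i j : Fin 2) :
    ContDiffOn ℝ ∞ (secE κ τ F ν i j) V := by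
  have a := h.contDiffOn_coframe i
  have b := h.contDiffOn_coframe j
  have n := h.contDiffOn_normalComp
  have dn := fun k => contDiffOn_pd h.isOpen (n k) i
  have a0 := a 0
  have a1 := a 1
  have a2 := a 2
  have b0 := b 0
  have b1 := b 1
  have b2 := b 2
  have n0 := n 0
  have n1 := n 1
  have n2 := n 2
  have dn0 := dn 0
  have dn1 := dn 1
  have dn2 := dn 2
  unfold secE
  fun_prop

theorem contDiffOn_normSqNum (h : LocalSurface κ τ H V F ν) :
    ContDiffOn ℝ ∞ (normSqNum κ τ F ν) V := by
  have g00 := h.contDiffOn_gramE 0 0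
  have g01 := h.contDiffOn_gramE 0 1
  have g11 := h.contDiffOn_gramE 1 1
  have s00 := h.contDiffOn_secE 0 0
  have s01 := h.contDiffOn_secE 0 1
  have s10 := h.contDiffOn_secE 1 0
  have s11 := h.contDiffOn_secE 1 1
  unfold normSqNum
  fun_prop

theorem sum_sq (h : LocalSurface κ τ H V F ν) {p : E2} (hp : p ∈ V) :
    F p 0 ^ 2 + F p 1 ^ 2 + F p 2 ^ 2 + F p 3 ^ 2 = 1 :=
  sphere_sum_sq ⟨F p, by simp [h.sphere p hp]⟩

theorem inner_pd (h : LocalSurface κ τ H V F ν) {p : E2} (hp : p ∈ V) (i : Fin 2) :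
    inner ℝ (pd F i p) (F p) = 0 := by
  have hd : DifferentiableAt ℝ F p :=
    (h.smooth.contDiffAt (h.isOpen.mem_nhds hp)).differentiableAt (by simp)
  have h1 : (fun q => inner ℝ (F q) (F q)) =ᶠ[nhds p] fun _ => (1 : ℝ) := by
    filter_upwards [h.isOpen.mem_nhds hp] with q hq
    rw [real_inner_self_eq_norm_sq, h.sphere q hq]; norm_num
  have h3 := congrArg (fun L : E2 →L[ℝ] ℝ => L (EuclideanSpace.single i (1 : ℝ))) h1.fderiv_eq
  rw [fderiv_inner_apply ℝ hd hd, fderiv_fun_const] at h3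
  change inner ℝ (F p) (pd F i p) + inner ℝ (pd F i p) (F p) = 0 at h3
  rw [real_inner_comm] at h3
  linarith

theorem coframe_coord (h : LocalSurface κ τ H V F ν) (hκ : 0 < κ) (hτ : τ ≠ 0) {p : E2} (hp : p ∈ V)
    (i : Fin 2) :
    pd F i p 0 = -(√κ / 2) * coframe κ τ F i 0 p * F p 2 - √κ / 2 * coframe κ τ F i 1 p * F p 3
      - κ / (4 * τ) * coframe κ τ F i 2 p * F p 1 ∧
    pd F i p 1 = √κ / 2 * coframe κ τ F i 0 p * F p 3 - √κ / 2 * coframe κ τ F i 1 p * F p 2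
      + κ / (4 * τ) * coframe κ τ F i 2 p * F p 0 ∧
    pd F i p 2 = √κ / 2 * coframe κ τ F i 0 p * F p 0 + √κ / 2 * coframe κ τ F i 1 p * F p 1
      - κ / (4 * τ) * coframe κ τ F i 2 p * F p 3 ∧
    pd F i p 3 = -(√κ / 2) * coframe κ τ F i 0 p * F p 1 + √κ / 2 * coframe κ τ F i 1 p * F p 0
      + κ / (4 * τ) * coframe κ τ F i 2 p * F p 2 := by
  have hi := h.inner_pd hp i
  rw [inner_R4] at hi
  exact tangent_coord hκ hτ (h.sum_sq hp) hi rfl rfl rfl rfl rfl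

theorem gramE_eq (h : LocalSurface κ τ H V F ν) (hκ : 0 < κ) (hτ : τ ≠ 0) {p : E2} (hp : p ∈ V)
    (i j : Fin 2) : gramE κ τ F i j p = coframe κ τ F i 0 p * coframe κ τ F j 0 p
      + coframe κ τ F i 1 p * coframe κ τ F j 1 p + coframe κ τ F i 2 p * coframe κ τ F j 2 p :=
  metric_eq_sum hκ hτ _ (h.sum_sq hp) (h.inner_pd hp i)

theorem normal_eq (h : LocalSurface κ τ H V F ν) (hκ : 0 < κ) (hτ : τ ≠ 0) {p : E2} (hp : p ∈ V)
    (i : Fin 2) : coframe κ τ F i 0 p * normalComp κ τ F ν 0 p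
      + coframe κ τ F i 1 p * normalComp κ τ F ν 1 p
      + coframe κ τ F i 2 p * normalComp κ τ F ν 2 p = 0 := by
  rw [← h.normal p hp i, metric_comm]
  exact (metric_eq_sum hκ hτ _ (h.sum_sq hp) (h.inner_pd hp i)).symm

theorem unit_eq (h : LocalSurface κ τ H V F ν) (hκ : 0 < κ) (hτ : τ ≠ 0) {p : E2} (hp : p ∈ V) :
    normalComp κ τ F ν 0 p * normalComp κ τ F ν 0 p + normalComp κ τ F ν 1 p * normalComp κ τ F ν 1 p
      + normalComp κ τ F ν 2 p * normalComp κ τ F ν 2 p = 1 := by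
  rw [← h.unit p hp]
  exact (metric_eq_sum hκ hτ _ (h.sum_sq hp) (h.tangent p hp)).symm

/-- The triple product `det (∂₁F, ∂₂F, ν)`. -/
def triple (κ τ : ℝ) (F ν : E2 → R4) (p : E2) : ℝ :=
  (coframe κ τ F 0 1 p * coframe κ τ F 1 2 p - coframe κ τ F 0 2 p * coframe κ τ F 1 1 p)
      * normalComp κ τ F ν 0 p
    + (coframe κ τ F 0 2 p * coframe κ τ F 1 0 p - coframe κ τ F 0 0 p * coframe κ τ F 1 2 p)
      * normalComp κ τ F ν 1 p
    + (coframe κ τ F 0 0 p * coframe κ τ F 1 1 p - coframe κ τ F 0 1 p * coframe κ τ F 1 0 p)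
      * normalComp κ τ F ν 2 p

/-- Lagrange's identity: ν is a unit multiple of the normalized cross product of ∂₁F and ∂₂F. Thus
`triple` is a polynomial, signed square root of the Gram determinant. -/
theorem triple_sq (h : LocalSurface κ τ H V F ν) (hκ : 0 < κ) (hτ : τ ≠ 0) {p : E2} (hp : p ∈ V) :
    triple κ τ F ν p * triple κ τ F ν p = gramDet κ τ F p := by
  have hn := h.unit_eq hκ hτ hp
  have han := h.normal_eq hκ hτ hp 0
  have hbn := h.normal_eq hκ hτ hp 1
  rw [gramDet, h.gramE_eq hκ hτ hp, h.gramE_eq hκ hτ hp, h.gramE_eq hκ hτ hp, triple]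
  generalize coframe κ τ F 0 0 p = a0 at *
  generalize coframe κ τ F 0 1 p = a1 at *
  generalize coframe κ τ F 0 2 p = a2 at *
  generalize coframe κ τ F 1 0 p = b0 at *
  generalize coframe κ τ F 1 1 p = b1 at *
  generalize coframe κ τ F 1 2 p = b2 at *
  generalize normalComp κ τ F ν 0 p = n0 at *
  generalize normalComp κ τ F ν 1 p = n1 at *
  generalize normalComp κ τ F ν 2 p = n2 at *
  linear_combination ((a0 * a0 + a1 * a1 + a2 * a2) * (b0 * b0 + b1 * b1 + b2 * b2)
      - (a0 * b0 + a1 * b1 + a2 * b2) * (a0 * b0 + a1 * b1 + a2 * b2)) * hn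
      - (a0 * a0 + a1 * a1 + a2 * a2) * (b0 * n0 + b1 * n1 + b2 * n2) * hbn
      + (2 * (a0 * b0 + a1 * b1 + a2 * b2) * (b0 * n0 + b1 * n1 + b2 * n2)
        - (b0 * b0 + b1 * b1 + b2 * b2) * (a0 * n0 + a1 * n1 + a2 * n2)) * han

theorem contDiffOn_triple (h : LocalSurface κ τ H V F ν) : ContDiffOn ℝ ∞ (triple κ τ F ν) V := by
  have a0 := h.contDiffOn_coframe 0 0
  have a1 := h.contDiffOn_coframe 0 1
  have a2 := h.contDiffOn_coframe 0 2
  have b0 := h.contDiffOn_coframe 1 0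
  have b1 := h.contDiffOn_coframe 1 1
  have b2 := h.contDiffOn_coframe 1 2
  have n0 := h.contDiffOn_normalComp 0
  have n1 := h.contDiffOn_normalComp 1
  have n2 := h.contDiffOn_normalComp 2
  unfold triple
  fun_prop

theorem triple_ne (h : LocalSurface κ τ H V F ν) (hκ : 0 < κ) (hτ : τ ≠ 0) {p : E2} (hp : p ∈ V) :
    triple κ τ F ν p ≠ 0 := by
  intro h0
  have := h.triple_sq hκ hτ hp
  rw [h0] at this
  linarith [h.gramDet_pos p hp]

end LocalSurface
end Berger

/-! ### The algebraic identities for parametrized surfaces. -/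

namespace Berger
namespace LocalSurface

variable {κ τ H : ℝ} {V : Set E2} {F ν : E2 → R4}

open smoothFun

theorem contDiffOn_coord (h : LocalSurface κ τ H V F ν) (k : Fin 4) :
    ContDiffOn ℝ ∞ (fun p => F p k) V :=
  contDiffOn_euclidean.1 h.smooth k

theorem pd_coord (h : LocalSurface κ τ H V F ν) {p : E2} (hp : p ∈ V) (i : Fin 2) (k : Fin 4) :
    pd (fun q => F q k) i p = pd F i p k := by
  have hd : DifferentiableAt ℝ F p :=
    (h.smooth.contDiffAt (h.isOpen.mem_nhds hp)).differentiableAt (by simp)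
  have := ((EuclideanSpace.proj k : R4 →L[ℝ] ℝ).hasFDerivAt.comp p hd.hasFDerivAt).fderiv
  exact congrArg (fun L : E2 →L[ℝ] ℝ => L (EuclideanSpace.single i (1 : ℝ))) this

theorem contDiffOn_normSq (h : LocalSurface κ τ H V F ν) {A : E2 → ℝ}
    (hA : ∀ p ∈ V, gramDet κ τ F p ^ 2 * A p = normSqNum κ τ F ν p) : ContDiffOn ℝ ∞ A V := by
  have : ContDiffOn ℝ ∞ (fun p => normSqNum κ τ F ν p / gramDet κ τ F p ^ 2) V :=
    h.contDiffOn_normSqNum.div (h.contDiffOn_gramDet.pow 2)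
      fun p hp => pow_ne_zero 2 (h.gramDet_pos p hp).ne'
  refine this.congr fun p hp => ?_
  rw [← hA p hp, mul_div_cancel_left₀]
  exact pow_ne_zero 2 (h.gramDet_pos p hp).ne'

theorem contDiffOn_simonsCovector (h : LocalSurface κ τ H V F ν) {A HC : E2 → ℝ}
    {CN : Fin 3 → E2 → ℝ} (hA : ContDiffOn ℝ ∞ A V)
    (hHC : ∀ p ∈ V, HC p = H * normalComp κ τ F ν 2 p)
    (hCN : ∀ p ∈ V, ∀ k, CN k p = normalComp κ τ F ν 2 p * normalComp κ τ F ν k p) (i : Fin 2) :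
    ContDiffOn ℝ ∞ (simonsCovector κ τ F A HC CN i) V := by
  have a0 := h.contDiffOn_coframe i 0
  have a1 := h.contDiffOn_coframe i 1
  have a2 := h.contDiffOn_coframe i 2
  have n0 := h.contDiffOn_normalComp 0
  have n1 := h.contDiffOn_normalComp 1
  have n2 := h.contDiffOn_normalComp 2
  have dA := contDiffOn_pd h.isOpen hA i
  have hc : ContDiffOn ℝ ∞ HC V := (contDiffOn_const.mul n2).congr hHC
  have c0 : ContDiffOn ℝ ∞ (CN 0) V := (n2.mul n0).congr fun p hp => hCN p hp 0
  have c1 : ContDiffOn ℝ ∞ (CN 1) V := (n2.mul n1).congr fun p hp => hCN p hp 1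
  unfold simonsCovector
  fun_prop

/-- Transfers `coframe_torsion` and `coord_simons` to functions. Its three parts serve, in order,
the surfaces with C = 0, the exclusion of C² = 1, and the divergence formula. -/
theorem smooth_system (h : LocalSurface κ τ H V F ν) (hκ : 0 < κ) (hτ : τ ≠ 0) {A HC : E2 → ℝ}
    {CN : Fin 3 → E2 → ℝ}
    (hA : ∀ p ∈ V, gramDet κ τ F p ^ 2 * A p = normSqNum κ τ F ν p)
    (hHC : ∀ p ∈ V, HC p = H * normalComp κ τ F ν 2 p)
    (hCN : ∀ p ∈ V, ∀ k, CN k p = normalComp κ τ F ν 2 p * normalComp κ τ F ν k p) :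
    ((∀ p ∈ V, normalComp κ τ F ν 2 p = 0) → ∀ p ∈ V, ∀ i,
      pd (normalComp κ τ F ν 0) i p = -2 * H * coframe κ τ F i 0 p
        - κ / (2 * τ) * coframe κ τ F i 2 p * normalComp κ τ F ν 1 p ∧
      pd (normalComp κ τ F ν 1) i p = -2 * H * coframe κ τ F i 1 p
        + κ / (2 * τ) * coframe κ τ F i 2 p * normalComp κ τ F ν 0 p) ∧
    (∀ p ∈ V, pd (coframe κ τ F 1 2) 0 p - pd (coframe κ τ F 0 2) 1 p
      + 2 * (-τ) * (coframe κ τ F 0 0 p * coframe κ τ F 1 1 p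
        - coframe κ τ F 0 1 p * coframe κ τ F 1 0 p) = 0) ∧
    ∃ P Q : E2 → ℝ, ∀ p ∈ V,
      pd (fun q => (triple κ τ F ν q)⁻¹ * (gramE κ τ F 1 1 q * simonsCovector κ τ F A HC CN 0 q
        - gramE κ τ F 0 1 q * simonsCovector κ τ F A HC CN 1 q)) 0 p
      + pd (fun q => (triple κ τ F ν q)⁻¹ * (gramE κ τ F 0 0 q * simonsCovector κ τ F A HC CN 1 q
        - gramE κ τ F 0 1 q * simonsCovector κ τ F A HC CN 0 q)) 1 p
      = 2 * triple κ τ F ν p * ((κ - 4 * τ ^ 2) ^ 2 * (normalComp κ τ F ν 2 p ^ 2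
          * (1 - normalComp κ τ F ν 2 p ^ 2))
        - ((A p - 2 * H ^ 2) ^ 2 - quadB κ τ H (normalComp κ τ F ν 2 p) * (A p - 2 * H ^ 2)
          + quadC κ τ H (normalComp κ τ F ν 2 p)) + P p ^ 2 + Q p ^ 2) := by
  have hV := h.isOpen
  have hAs := h.contDiffOn_normSq hA
  have hL := h.contDiffOn_simonsCovector hAs hHC hCN
  let d₁ := der hV (EuclideanSpace.single (0 : Fin 2) (1 : ℝ))
  let d₂ := der hV (EuclideanSpace.single (1 : Fin 2) (1 : ℝ))
  have D₁ : ∀ (G : E2 → ℝ) (hG : ContDiffOn ℝ ∞ G V), d₁ (of G hG) = of (pd G 0)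
    (contDiffOn_pd hV hG 0) := fun G hG => der_of hV _ hG
  have D₂ : ∀ (G : E2 → ℝ) (hG : ContDiffOn ℝ ∞ G V), d₂ (of G hG) = of (pd G 1)
    (contDiffOn_pd hV hG 1) := fun G hG => der_of hV _ hG
  have comm : ∀ u, d₁ (d₂ u) = d₂ (d₁ u) := der_comm hV _ _
  let x : Fin 4 → smoothFun V := fun k => of (fun p => F p k) (h.contDiffOn_coord k)
  let a : Fin 3 → smoothFun V := fun k => of (coframe κ τ F 0 k) (h.contDiffOn_coframe 0 k)
  let b : Fin 3 → smoothFun V := fun k => of (coframe κ τ F 1 k) (h.contDiffOn_coframe 1 k)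
  let n : Fin 3 → smoothFun V := fun k => of (normalComp κ τ F ν k) (h.contDiffOn_normalComp k)
  let C : ℝ → smoothFun V := fun r => algebraMap ℝ (smoothFun V) r
  have C₁ : ∀ r, d₁ (C r) = 0 := fun r => d₁.map_algebraMap r
  have C₂ : ∀ r, d₂ (C r) = 0 := fun r => d₂.map_algebraMap r
  have ext : ∀ u v : smoothFun V, (∀ p, u.1 p = v.1 p) → u = v := fun u v huv =>
    Subtype.ext (funext huv)
  have hsq : √κ ≠ 0 := (Real.sqrt_pos.2 hκ).ne'
  -- √κ/2 and κ/(4τ) are the coefficients of the linear frame fields; -τ and 2τ - κ/(2τ) are the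
  -- connection constants t and m.
  obtain ⟨tors₀, tors₁, tors₂⟩ := coframe_torsion (x := x) (a := a) (b := b) d₁ d₂
    (c := C (√κ / 2)) (c' := C (√κ / 2)⁻¹) (ε := C (κ / (4 * τ))) (ε' := C (κ / (4 * τ))⁻¹)
    (t := C (-τ)) (m := C (2 * τ - κ / (2 * τ))) comm (C₁ _) (C₂ _) (C₁ _) (C₂ _)
    (by simp only [C]; rw [← map_mul, mul_inv_cancel₀ (by positivity), map_one])
    (by simp only [C]; rw [← map_mul, mul_inv_cancel₀ (by positivity), map_one])
    (by
      simp only [C]; rw [← map_mul, ← map_mul, ← map_neg]; congr 1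
      field_simp; rw [Real.sq_sqrt hκ.le]; ring)
    (by
      simp only [C]
      rw [show (2 : smoothFun V) = algebraMap ℝ _ 2 from (map_ofNat _ 2).symm, ← map_neg, ← map_mul,
        ← map_mul, ← map_add]
      congr 1; field_simp; ring)
    (by
      refine ext _ _ fun p => ?_
      have := h.sum_sq p.2
      simp only [pow_two] at this
      exact this)
    (by
      refine (D₁ _ _).trans (ext _ _ fun p => ?_)
      exact (h.pd_coord p.2 0 0).trans (h.coframe_coord hκ hτ p.2 0).1)
    (by
      refine (D₁ _ _).trans (ext _ _ fun p => ?_)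
      exact (h.pd_coord p.2 0 1).trans (h.coframe_coord hκ hτ p.2 0).2.1)
    (by
      refine (D₁ _ _).trans (ext _ _ fun p => ?_)
      exact (h.pd_coord p.2 0 2).trans (h.coframe_coord hκ hτ p.2 0).2.2.1)
    (by
      refine (D₁ _ _).trans (ext _ _ fun p => ?_)
      exact (h.pd_coord p.2 0 3).trans (h.coframe_coord hκ hτ p.2 0).2.2.2)
    (by
      refine (D₂ _ _).trans (ext _ _ fun p => ?_)
      exact (h.pd_coord p.2 1 0).trans (h.coframe_coord hκ hτ p.2 1).1)
    (by
      refine (D₂ _ _).trans (ext _ _ fun p => ?_)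
      exact (h.pd_coord p.2 1 1).trans (h.coframe_coord hκ hτ p.2 1).2.1)
    (by
      refine (D₂ _ _).trans (ext _ _ fun p => ?_)
      exact (h.pd_coord p.2 1 2).trans (h.coframe_coord hκ hτ p.2 1).2.2.1)
    (by
      refine (D₂ _ _).trans (ext _ _ fun p => ?_)
      exact (h.pd_coord p.2 1 3).trans (h.coframe_coord hκ hτ p.2 1).2.2.2)
  have smooth_inv : ContDiffOn ℝ ∞ (fun p => (triple κ τ F ν p)⁻¹) V :=
    h.contDiffOn_triple.inv fun p hp => h.triple_ne hκ hτ hp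
  have smooth_s : ContDiffOn ℝ ∞ (fun p => √(gramE κ τ F 0 0 p)) V :=
    (h.contDiffOn_gramE 0 0).sqrt fun p hp => (h.gram_pos p hp).ne'
  have smooth_si : ContDiffOn ℝ ∞ (fun p => (√(gramE κ τ F 0 0 p))⁻¹) V :=
    smooth_s.inv fun p hp => (Real.sqrt_pos.2 (h.gram_pos p hp)).ne'
  obtain ⟨hflat, P, Q, key⟩ := coord_simons d₁ d₂ (a := a) (b := b) (n := n) (t := C (-τ))
    (m := C (2 * τ - κ / (2 * τ))) (D := C (κ - 4 * τ ^ 2)) (H := C H)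
    (s := of _ smooth_s) (si := of _ smooth_si) (ρ := of _ h.contDiffOn_triple)
    (ρi := of _ smooth_inv) (A := of _ hAs) (L₁ := of _ (hL 0)) (L₂ := of _ (hL 1))
    (S₁₁ := of _ (h.contDiffOn_secE 0 0)) (S₁₂ := of _ (h.contDiffOn_secE 0 1))
    (S₂₁ := of _ (h.contDiffOn_secE 1 0)) (S₂₂ := of _ (h.contDiffOn_secE 1 1))
    (g₁₁ := of _ (h.contDiffOn_gramE 0 0)) (g₁₂ := of _ (h.contDiffOn_gramE 0 1))
    (g₂₂ := of _ (h.contDiffOn_gramE 1 1)) comm (C₁ _) (C₂ _) (C₁ _) (C₂ _) (C₁ _) (C₂ _)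
    (by
      simp only [C]
      rw [show (2 : smoothFun V) = algebraMap ℝ _ 2 from (map_ofNat _ 2).symm, ← map_mul,
        ← map_mul]
      congr 1; field_simp; ring)
    (ext _ _ fun p => h.unit_eq hκ hτ p.2) (ext _ _ fun p => h.normal_eq hκ hτ p.2 0)
    (ext _ _ fun p => h.normal_eq hκ hτ p.2 1) (ext _ _ fun p => h.gramE_eq hκ hτ p.2 0 0)
    (ext _ _ fun p => h.gramE_eq hκ hτ p.2 0 1) (ext _ _ fun p => h.gramE_eq hκ hτ p.2 1 1)
    (ext _ _ fun p => Real.mul_self_sqrt (h.gram_pos p p.2).le)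
    (ext _ _ fun p => mul_inv_cancel₀ (Real.sqrt_pos.2 (h.gram_pos p p.2)).ne')
    (ext _ _ fun p => rfl) (ext _ _ fun p => mul_inv_cancel₀ (h.triple_ne hκ hτ p.2))
    tors₀ tors₁ tors₂ (by rw [D₁, D₁, D₁]; exact ext _ _ fun p => rfl)
    (by rw [D₁, D₁, D₁]; exact ext _ _ fun p => rfl)
    (by rw [D₂, D₂, D₂]; exact ext _ _ fun p => rfl)
    (by rw [D₂, D₂, D₂]; exact ext _ _ fun p => rfl)
    (ext _ _ fun p => h.mean p p.2) (ext _ _ fun p => hA p p.2)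
    (by
      rw [D₁]
      refine ext _ _ fun p => ?_
      change pd A 0 p - 4 * (κ - 4 * τ ^ 2) * (HC p * coframe κ τ F 0 2 p
        - τ * (CN 1 p * coframe κ τ F 0 0 p - CN 0 p * coframe κ τ F 0 1 p)) =
        pd A 0 p - 4 * (κ - 4 * τ ^ 2) * (H * (normalComp κ τ F ν 2 p * coframe κ τ F 0 2 p)
        + -τ * (normalComp κ τ F ν 2 p * (normalComp κ τ F ν 1 p * coframe κ τ F 0 0 p
          - normalComp κ τ F ν 0 p * coframe κ τ F 0 1 p)))
      rw [hHC p p.2, hCN p p.2, hCN p p.2]; ring)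
    (by
      rw [D₂]
      refine ext _ _ fun p => ?_
      change pd A 1 p - 4 * (κ - 4 * τ ^ 2) * (HC p * coframe κ τ F 1 2 p
        - τ * (CN 1 p * coframe κ τ F 1 0 p - CN 0 p * coframe κ τ F 1 1 p)) =
        pd A 1 p - 4 * (κ - 4 * τ ^ 2) * (H * (normalComp κ τ F ν 2 p * coframe κ τ F 1 2 p)
        + -τ * (normalComp κ τ F ν 2 p * (normalComp κ τ F ν 1 p * coframe κ τ F 1 0 p
          - normalComp κ τ F ν 0 p * coframe κ τ F 1 1 p)))
      rw [hHC p p.2, hCN p p.2, hCN p p.2]; ring)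
  refine ⟨fun h0 p hp i => ?_, fun p hp => ?_, ?_⟩
  · obtain ⟨⟨k1, k2⟩, k3, k4⟩ := hflat (ext _ _ fun p => h0 p p.2)
    rw [D₁] at k1 k2
    rw [D₂] at k3 k4
    have k1' : pd (normalComp κ τ F ν 0) 0 p = -2 * H * coframe κ τ F 0 0 p
      + (2 * -τ + (2 * τ - κ / (2 * τ))) * coframe κ τ F 0 2 p * normalComp κ τ F ν 1 p :=
      congrFun (congrArg Subtype.val k1) ⟨p, hp⟩
    have k2' : pd (normalComp κ τ F ν 1) 0 p = -2 * H * coframe κ τ F 0 1 p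
      - (2 * -τ + (2 * τ - κ / (2 * τ))) * coframe κ τ F 0 2 p * normalComp κ τ F ν 0 p :=
      congrFun (congrArg Subtype.val k2) ⟨p, hp⟩
    have k3' : pd (normalComp κ τ F ν 0) 1 p = -2 * H * coframe κ τ F 1 0 p
      + (2 * -τ + (2 * τ - κ / (2 * τ))) * coframe κ τ F 1 2 p * normalComp κ τ F ν 1 p :=
      congrFun (congrArg Subtype.val k3) ⟨p, hp⟩
    have k4' : pd (normalComp κ τ F ν 1) 1 p = -2 * H * coframe κ τ F 1 1 p
      - (2 * -τ + (2 * τ - κ / (2 * τ))) * coframe κ τ F 1 2 p * normalComp κ τ F ν 0 p :=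
      congrFun (congrArg Subtype.val k4) ⟨p, hp⟩
    revert i
    rw [Fin.forall_fin_two]
    constructor
    · exact ⟨k1'.trans (by ring), k2'.trans (by ring)⟩
    · exact ⟨k3'.trans (by ring), k4'.trans (by ring)⟩
  · rw [D₁, D₂] at tors₂
    exact congrFun (congrArg Subtype.val tors₂) ⟨p, hp⟩
  · obtain ⟨P', hP, rfl⟩ := exists_of P
    obtain ⟨Q', hQ, rfl⟩ := exists_of Q
    refine ⟨P', Q', fun p hp => ?_⟩
    rw [of_mul, of_mul, of_mul, of_mul, of_sub, of_sub, of_mul, of_mul, D₁, D₂] at key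
    refine (congrFun (congrArg Subtype.val key) ⟨p, hp⟩).trans ?_
    change 2 * triple κ τ F ν p * ((κ - 4 * τ ^ 2) ^ 2 * (normalComp κ τ F ν 2 p ^ 2
          * (1 - normalComp κ τ F ν 2 p ^ 2))
        - ((A p - 2 * H ^ 2) ^ 2 - (2 * (H ^ 2 + (-τ) ^ 2) + (κ - 4 * τ ^ 2) *
          (5 * normalComp κ τ F ν 2 p ^ 2 - 1)) * (A p - 2 * H ^ 2)
          + 2 * (κ - 4 * τ ^ 2) * (H ^ 2 + (-τ) ^ 2) * (3 * normalComp κ τ F ν 2 p ^ 2 - 1))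
          + P' p ^ 2 + Q' p ^ 2) = _
    rw [quadB, quadC, neg_sq]

/-- For a surface with vanishing angle, this vector is normal to the plane of the curve onto which it
projects. -/
def _root_.Berger.axis (κ H : ℝ) (x : R4) (n : Fin 3 → ℝ) (k : Fin 3) : ℝ :=
  match k with
  | 0 => H * (2 * (x 0 * x 2 + x 1 * x 3)) + √κ / 2 * (n 0 * (x 0 * x 0 - x 1 * x 1 - x 2 * x 2
      + x 3 * x 3) + n 1 * (2 * (x 0 * x 1 - x 2 * x 3)))
  | 1 => H * (2 * (x 1 * x 2 - x 0 * x 3)) + √κ / 2 * (n 0 * (2 * (x 0 * x 1 + x 2 * x 3))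
      + n 1 * (x 1 * x 1 + x 3 * x 3 - x 0 * x 0 - x 2 * x 2))
  | 2 => H * (x 0 * x 0 + x 1 * x 1 - x 2 * x 2 - x 3 * x 3) + √κ / 2 *
      (n 0 * (2 * (x 1 * x 3 - x 0 * x 2)) + n 1 * (-2 * (x 0 * x 3 + x 1 * x 2)))

theorem contDiffOn_axis (h : LocalSurface κ τ H V F ν) (k : Fin 3) :
    ContDiffOn ℝ ∞ (fun q => axis κ H (F q) (fun j => normalComp κ τ F ν j q) k) V := by
  have x0 := h.contDiffOn_coord 0
  have x1 := h.contDiffOn_coord 1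
  have x2 := h.contDiffOn_coord 2
  have x3 := h.contDiffOn_coord 3
  have n0 := h.contDiffOn_normalComp 0
  have n1 := h.contDiffOn_normalComp 1
  fin_cases k <;> simp only [axis] <;> fun_prop

/-- The axis is H p + ½ dp(N) with p = √κ Π. Along the base curve, of geodesic curvature 2H up to
sign, the derivative of ½ dp(N) cancels that of H p. -/
theorem pd_axis (h : LocalSurface κ τ H V F ν) (hκ : 0 < κ) (hτ : τ ≠ 0) {A HC : E2 → ℝ}
    {CN : Fin 3 → E2 → ℝ}
    (hA : ∀ p ∈ V, gramDet κ τ F p ^ 2 * A p = normSqNum κ τ F ν p)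
    (hHC : ∀ p ∈ V, HC p = H * normalComp κ τ F ν 2 p)
    (hCN : ∀ p ∈ V, ∀ k, CN k p = normalComp κ τ F ν 2 p * normalComp κ τ F ν k p)
    (h0 : ∀ p ∈ V, normalComp κ τ F ν 2 p = 0) {p : E2} (hp : p ∈ V) (i : Fin 2) (k : Fin 3) :
    pd (fun q => axis κ H (F q) (fun j => normalComp κ τ F ν j q) k) i p = 0 := by
  have hV := h.isOpen
  let d := der hV (EuclideanSpace.single i (1 : ℝ))
  have D : ∀ (G : E2 → ℝ) (hG : ContDiffOn ℝ ∞ G V), d (of G hG) = of (pd G i)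
    (contDiffOn_pd hV hG i) := fun G hG => der_of hV _ hG
  let x : Fin 4 → smoothFun V := fun k => of (fun p => F p k) (h.contDiffOn_coord k)
  let a : Fin 3 → smoothFun V := fun k => of (coframe κ τ F i k) (h.contDiffOn_coframe i k)
  let n : Fin 3 → smoothFun V := fun k => of (normalComp κ τ F ν k) (h.contDiffOn_normalComp k)
  let C : ℝ → smoothFun V := fun r => algebraMap ℝ (smoothFun V) r
  have ext : ∀ u v : smoothFun V, (∀ p, u.1 p = v.1 p) → u = v := fun u v huv =>
    Subtype.ext (funext huv)
  have hn := (h.smooth_system hκ hτ hA hHC hCN).1 h0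
  obtain ⟨k0, k1, k2⟩ := axis_constant (x := x) (a := a) (n := n) (c := C (√κ / 2))
    (ε := C (κ / (4 * τ))) (H := C H) d (d.map_algebraMap _) (d.map_algebraMap _)
    (by
      refine (D _ _).trans (ext _ _ fun p => ?_)
      exact (h.pd_coord p.2 i 0).trans (h.coframe_coord hκ hτ p.2 i).1)
    (by
      refine (D _ _).trans (ext _ _ fun p => ?_)
      exact (h.pd_coord p.2 i 1).trans (h.coframe_coord hκ hτ p.2 i).2.1)
    (by
      refine (D _ _).trans (ext _ _ fun p => ?_)
      exact (h.pd_coord p.2 i 2).trans (h.coframe_coord hκ hτ p.2 i).2.2.1)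
    (by
      refine (D _ _).trans (ext _ _ fun p => ?_)
      exact (h.pd_coord p.2 i 3).trans (h.coframe_coord hκ hτ p.2 i).2.2.2)
    (ext _ _ fun p => by
      have := h.normal_eq hκ hτ p.2 i
      rw [h0 p p.2, mul_zero, add_zero] at this
      exact this)
    (by
      refine (D _ _).trans (ext _ _ fun p => ?_)
      refine ((hn p p.2 i).1).trans ?_
      change _ = -2 * H * coframe κ τ F i 0 p
        - 2 * (κ / (4 * τ)) * coframe κ τ F i 2 p * normalComp κ τ F ν 1 p
      field_simp; ring)
    (by
      refine (D _ _).trans (ext _ _ fun p => ?_)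
      refine ((hn p p.2 i).2).trans ?_
      change _ = -2 * H * coframe κ τ F i 1 p
        + 2 * (κ / (4 * τ)) * coframe κ τ F i 2 p * normalComp κ τ F ν 0 p
      field_simp; ring)
  have hs := h.contDiffOn_axis
  fin_cases k
  · exact congrFun (congrArg Subtype.val ((D _ (hs 0)).symm.trans k0)) ⟨p, hp⟩
  · exact congrFun (congrArg Subtype.val ((D _ (hs 1)).symm.trans k1)) ⟨p, hp⟩
  · exact congrFun (congrArg Subtype.val ((D _ (hs 2)).symm.trans k2)) ⟨p, hp⟩

end LocalSurface
end Berger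

/-! ### Integration by parts in the plane, and coordinate changes. -/

namespace Berger

open MeasureTheory Set

section plane

theorem fderiv_eq_sum_pd {W : Type*} [NormedAddCommGroup W] [NormedSpace ℝ W] (u : E2 → W)
    (p v : E2) : fderiv ℝ u p v = v 0 • pd u 0 p + v 1 • pd u 1 p := by
  have : v = v 0 • EuclideanSpace.single 0 (1 : ℝ) + v 1 • EuclideanSpace.single 1 (1 : ℝ) := by
    ext i; fin_cases i <;> simp
  conv_lhs => rw [this]
  simp [pd]

theorem integrableOn_of_zero_off_compact {T K : Set E2} {u : E2 → ℝ} (hT : IsOpen T)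
    (hK : IsCompact K) (hKT : K ⊆ T) (hu : ContinuousOn u T) (h0 : ∀ p ∈ T, p ∉ K → u p = 0) :
    IntegrableOn u T := by
  have h1 : IntegrableOn u K := (hu.mono hKT).integrableOn_compact hK
  have h2 : IntegrableOn u (T \ K) := by
    refine integrableOn_zero.congr_fun (fun p hp => (h0 p hp.1 hp.2).symm)
      (hT.measurableSet.diff hK.measurableSet)
  have := h1.union h2
  rwa [union_sdiff_cancel hKT] at this

theorem pd_eq_zero_of_off_closed {K T : Set E2} {u : E2 → ℝ} (hT : IsOpen T) (hK : IsClosed K)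
    (h0 : ∀ p ∈ T, p ∉ K → u p = 0) {p : E2} (hp : p ∈ T) (hpK : p ∉ K) (i : Fin 2) :
    pd u i p = 0 := by
  have : u =ᶠ[nhds p] fun _ => 0 := by
    filter_upwards [hT.mem_nhds hp, hK.isOpen_compl.mem_nhds hpK] with q h1 h2 using h0 q h1 h2
  rw [pd, this.fderiv_eq]; simp

/-- The extension of u by zero is smooth on the whole plane with support in K, and integration by
parts against the constant 1 applies to it. -/
theorem setIntegral_pd_eq_zero {T K : Set E2} {u : E2 → ℝ} (hT : IsOpen T) (hK : IsCompact K)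
    (hKT : K ⊆ T) (hu : ContDiffOn ℝ ∞ u T) (h0 : ∀ p ∈ T, p ∉ K → u p = 0) (i : Fin 2) :
    ∫ p in T, pd u i p = 0 := by
  classical
  set g : E2 → ℝ := T.indicator u with hg
  have gT : ∀ p ∈ T, g =ᶠ[nhds p] u := fun p hp => by
    filter_upwards [hT.mem_nhds hp] with q hq using indicator_of_mem hq u
  have gK : ∀ p, p ∉ K → g p = 0 := fun p hp => by
    by_cases h : p ∈ T
    · rw [hg, indicator_of_mem h, h0 p h hp]
    · rw [hg, indicator_of_notMem h]
  have gK' : ∀ p, p ∉ K → g =ᶠ[nhds p] fun _ => 0 := fun p hp => by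
    filter_upwards [hK.isClosed.isOpen_compl.mem_nhds hp] with q hq using gK q hq
  have gs : ContDiff ℝ ∞ g := by
    rw [contDiff_iff_contDiffAt]
    intro p
    by_cases h : p ∈ K
    · exact (hu.contDiffAt (hT.mem_nhds (hKT h))).congr_of_eventuallyEq (gT p (hKT h))
    · exact contDiffAt_const.congr_of_eventuallyEq (gK' p h)
  have gpd : ContDiff ℝ ∞ (pd g i) := by
    have := contDiffOn_pd isOpen_univ gs.contDiffOn i
    rwa [contDiffOn_univ] at this
  have hint : ∀ w : E2 → ℝ, Continuous w → (∀ p, p ∉ K → w p = 0) → Integrable w := fun w hw h => by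
    rw [← integrableOn_univ]
    exact integrableOn_of_zero_off_compact isOpen_univ hK (subset_univ _) hw.continuousOn
      fun p _ hp => h p hp
  have i1 := hint g gs.continuous gK
  have i2 := hint (pd g i) gpd.continuous fun p hp => by rw [pd, (gK' p hp).fderiv_eq]; simp
  have key := integral_mul_fderiv_eq_neg_fderiv_mul_of_integrable (μ := (volume : Measure E2))
    (f := fun _ => (1 : ℝ)) (g := g) (v := EuclideanSpace.single i (1 : ℝ)) (by simp)
    (by simp only [one_mul]; exact i2)
    (by simp only [one_mul]; exact i1) (fun _ _ => differentiableAt_const _)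
    (fun p _ => (gs.contDiffAt).differentiableAt (by simp))
  simp at key
  have e : ∫ p in T, pd g i p = ∫ p, pd g i p :=
    setIntegral_eq_integral_of_forall_compl_eq_zero fun p hp => by
      rw [pd, (gK' p (fun h => hp (hKT h))).fderiv_eq]; simp
  refine Eq.trans (setIntegral_congr_fun hT.measurableSet fun p hp => ?_) (e.trans key)
  change fderiv ℝ u p _ = fderiv ℝ g p _
  rw [(gT p hp).fderiv_eq]

end plane

section manifold

variable {M : Type*} [TopologicalSpace M] [ChartedSpace E2 M]

theorem contDiffOn_symm [IsManifold (𝓡 2) ∞ M] {u : M → ℝ} (hu : ContMDiff (𝓡 2) 𝓘(ℝ, ℝ) ∞ u) (x : M) :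
    ContDiffOn ℝ ∞ (fun p => u ((extChartAt (𝓡 2) x).symm p)) (extChartAt (𝓡 2) x).target := by
  rw [← contMDiffOn_iff_contDiffOn]
  exact hu.comp_contMDiffOn (contMDiffOn_extChartAt_symm x)

/-- The coordinate change between two charts. -/
def transition (x y : M) (p : E2) : E2 := extChartAt (𝓡 2) y ((extChartAt (𝓡 2) x).symm p)

/-- The domain of the coordinate change. -/
def overlap (x y : M) : Set E2 :=
  (extChartAt (𝓡 2) x).target ∩ (extChartAt (𝓡 2) x).symm ⁻¹' (extChartAt (𝓡 2) y).source

theorem isOpen_overlap (x y : M) : IsOpen (overlap x y) :=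
  (continuousOn_extChartAt_symm x).isOpen_inter_preimage (isOpen_extChartAt_target x)
    (isOpen_extChartAt_source y)

theorem contDiffOn_transition [IsManifold (𝓡 2) ∞ M] (x y : M) : ContDiffOn ℝ ∞ (transition x y) (overlap x y) := by
  rw [← contMDiffOn_iff_contDiffOn]
  exact (contMDiffOn_extChartAt (x := y)).comp
    ((contMDiffOn_extChartAt_symm x).mono inter_subset_left)
    fun p hp => by simpa only [extChartAt_source] using hp.2

end manifold
end Berger

/-! ### The divergence theorem for vector densities on a compact surface. -/

namespace Berger

open MeasureTheory Set

variable {M : Type*} [TopologicalSpace M] [ChartedSpace E2 M]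

theorem symm_transition {x y : M} {p : E2} (hp : p ∈ overlap x y) :
    (extChartAt (𝓡 2) y).symm (transition x y p) = (extChartAt (𝓡 2) x).symm p :=
  (extChartAt (𝓡 2) y).left_inv hp.2

theorem transition_mem {x y : M} {p : E2} (hp : p ∈ overlap x y) : transition x y p ∈ overlap y x :=
  ⟨(extChartAt (𝓡 2) y).map_source hp.2, by
    rw [mem_preimage, symm_transition hp]; exact (extChartAt (𝓡 2) x).map_target hp.1⟩

theorem transition_transition {x y : M} {p : E2} (hp : p ∈ overlap x y) :
    transition y x (transition x y p) = p := by
  rw [transition, symm_transition hp]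
  exact (extChartAt (𝓡 2) x).right_inv hp.1

theorem transition_image (x y : M) : transition x y '' overlap x y = overlap y x := by
  refine Subset.antisymm (image_subset_iff.2 fun p hp => transition_mem hp) fun p hp => ?_
  exact ⟨_, transition_mem hp, transition_transition hp⟩

theorem comp_symm_eventuallyEq {W : Type*} (u : M → W) {x y : M} {p : E2} (hp : p ∈ overlap x y) :
    (fun q => u ((extChartAt (𝓡 2) x).symm q)) =ᶠ[nhds p]
      (fun q => u ((extChartAt (𝓡 2) y).symm q)) ∘ transition x y := by
  filter_upwards [(isOpen_overlap x y).mem_nhds hp] with q hq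
  rw [Function.comp_apply, symm_transition hq]

theorem differentiableAt_transition [IsManifold (𝓡 2) ∞ M] {x y : M} {p : E2}
    (hp : p ∈ overlap x y) : DifferentiableAt ℝ (transition x y) p :=
  ((contDiffOn_transition x y).contDiffAt ((isOpen_overlap x y).mem_nhds hp)).differentiableAt
    (by simp)

theorem fderiv_comp_symm [IsManifold (𝓡 2) ∞ M] {W : Type*} [NormedAddCommGroup W]
    [NormedSpace ℝ W] (u : M → W) {x y : M} {p : E2} (hp : p ∈ overlap x y)
    (hu : DifferentiableAt ℝ (fun q => u ((extChartAt (𝓡 2) y).symm q)) (transition x y p)) (v : E2) :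
    fderiv ℝ (fun q => u ((extChartAt (𝓡 2) x).symm q)) p v =
      fderiv ℝ (fun q => u ((extChartAt (𝓡 2) y).symm q)) (transition x y p)
        (fderiv ℝ (transition x y) p v) := by
  rw [(comp_symm_eventuallyEq u hp).fderiv_eq, fderiv_comp p hu (differentiableAt_transition hp)]
  rfl

/-- The integral of a scalar density does not depend on the chart. -/
theorem setIntegral_density_eq [IsManifold (𝓡 2) ∞ M] {Y : M → E2 → E2}
    (hY : ∀ x y p, p ∈ overlap x y → fderiv ℝ (transition x y) p (Y x p) =
      |(fderiv ℝ (transition x y) p).det| • Y y (transition x y p)) {ρ σ : M → ℝ}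
    (hσ : ContMDiff (𝓡 2) 𝓘(ℝ, ℝ) ∞ σ) {i k : M}
    (hρi : tsupport ρ ⊆ (extChartAt (𝓡 2) i).source)
    (hσk : tsupport σ ⊆ (extChartAt (𝓡 2) k).source) :
    ∫ p in (extChartAt (𝓡 2) k).target, ρ ((extChartAt (𝓡 2) k).symm p) *
        fderiv ℝ (fun q => σ ((extChartAt (𝓡 2) k).symm q)) p (Y k p) =
    ∫ p in (extChartAt (𝓡 2) i).target, ρ ((extChartAt (𝓡 2) i).symm p) *
        fderiv ℝ (fun q => σ ((extChartAt (𝓡 2) i).symm q)) p (Y i p) := by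
  have e1 : ∫ p in (extChartAt (𝓡 2) k).target, ρ ((extChartAt (𝓡 2) k).symm p) *
        fderiv ℝ (fun q => σ ((extChartAt (𝓡 2) k).symm q)) p (Y k p) =
      ∫ p in overlap k i, ρ ((extChartAt (𝓡 2) k).symm p) *
        fderiv ℝ (fun q => σ ((extChartAt (𝓡 2) k).symm q)) p (Y k p) := by
    refine setIntegral_eq_of_subset_of_forall_sdiff_eq_zero
      (isOpen_extChartAt_target k).measurableSet inter_subset_left fun p hp => ?_
    have h0 : ρ ((extChartAt (𝓡 2) k).symm p) = 0 :=
      image_eq_zero_of_notMem_tsupport fun h => hp.2 ⟨hp.1, hρi h⟩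
    rw [h0, zero_mul]
  have e2 : ∫ p in (extChartAt (𝓡 2) i).target, ρ ((extChartAt (𝓡 2) i).symm p) *
        fderiv ℝ (fun q => σ ((extChartAt (𝓡 2) i).symm q)) p (Y i p) =
      ∫ p in overlap i k, ρ ((extChartAt (𝓡 2) i).symm p) *
        fderiv ℝ (fun q => σ ((extChartAt (𝓡 2) i).symm q)) p (Y i p) := by
    refine setIntegral_eq_of_subset_of_forall_sdiff_eq_zero
      (isOpen_extChartAt_target i).measurableSet inter_subset_left fun p hp => ?_
    have h1 : (extChartAt (𝓡 2) i).symm p ∉ tsupport σ := fun h => hp.2 ⟨hp.1, hσk h⟩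
    have h2 : (fun q => σ ((extChartAt (𝓡 2) i).symm q)) =ᶠ[nhds p] fun _ => 0 := by
      have hc := (continuousOn_extChartAt_symm (I := 𝓡 2) i).continuousAt
        ((isOpen_extChartAt_target i).mem_nhds hp.1)
      filter_upwards [hc.preimage_mem_nhds ((isClosed_tsupport σ).isOpen_compl.mem_nhds h1)]
        with q hq using image_eq_zero_of_notMem_tsupport hq
    rw [h2.fderiv_eq]; simp
  rw [e1, e2, ← transition_image k i, integral_image_eq_integral_abs_det_fderiv_smul volume
    (isOpen_overlap k i).measurableSet
    (fun p hp => (differentiableAt_transition hp).hasFDerivAt.hasFDerivWithinAt)]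
  · refine setIntegral_congr_fun (isOpen_overlap k i).measurableSet fun p hp => ?_
    have hd : DifferentiableAt ℝ (fun q => σ ((extChartAt (𝓡 2) i).symm q)) (transition k i p) :=
      ((contDiffOn_symm hσ i).contDiffAt ((isOpen_extChartAt_target i).mem_nhds
        (transition_mem hp).1)).differentiableAt (by simp)
    rw [fderiv_comp_symm σ hp hd, hY k i p hp, symm_transition hp, map_smul, smul_eq_mul, smul_eq_mul]
    ring
  · intro p hp q hq h
    rw [← transition_transition hp, h, transition_transition hq]

/-- On a compact manifold, a smooth vector density with nonnegative divergence is divergence-free. -/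
theorem divergence_eq_zero [IsManifold (𝓡 2) ∞ M] [CompactSpace M] [T2Space M] {Y : M → E2 → E2}
    (hYs : ∀ x, ContDiffOn ℝ ∞ (Y x) (extChartAt (𝓡 2) x).target)
    (hY : ∀ x y p, p ∈ overlap x y → fderiv ℝ (transition x y) p (Y x p) =
      |(fderiv ℝ (transition x y) p).det| • Y y (transition x y p))
    (hdiv : ∀ x, ∀ p ∈ (extChartAt (𝓡 2) x).target,
      0 ≤ pd (fun q => Y x q 0) 0 p + pd (fun q => Y x q 1) 1 p) (y : M) :
    ∃ x, y ∈ (extChartAt (𝓡 2) x).source ∧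
      pd (fun q => Y x q 0) 0 (extChartAt (𝓡 2) x y) + pd (fun q => Y x q 1) 1 (extChartAt (𝓡 2) x y)
        = 0 := by
  obtain ⟨f, hf⟩ := SmoothPartitionOfUnity.exists_isSubordinate (𝓡 2) (isClosed_univ (X := M))
    (fun x : M => (extChartAt (𝓡 2) x).source) (fun x => isOpen_extChartAt_source x)
    (fun x _ => mem_iUnion.2 ⟨x, mem_extChartAt_source x⟩)
  obtain ⟨S, hS⟩ : ∃ S : Finset M, ∀ x, x ∈ S ↔ (Function.support (f x)).Nonempty :=
    ⟨f.locallyFinite.finite_nonempty_of_compact.toFinset, fun x => by simp⟩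
  have hsum : ∀ z, ∑ x ∈ S, f x z = 1 := fun z => by
    rw [← f.sum_eq_one (mem_univ z), finsum_eq_sum_of_support_subset]
    exact fun x hx => (hS x).2 ⟨z, hx⟩
  let φ : M → PartialEquiv M E2 := fun x => extChartAt (𝓡 2) x
  let T : M → Set E2 := fun x => (φ x).target
  have hTo : ∀ x, IsOpen (T x) := fun x => isOpen_extChartAt_target x
  let K : M → Set E2 := fun x => φ x '' tsupport (f x)
  have hKT : ∀ x, K x ⊆ T x := fun x => by
    rintro _ ⟨z, hz, rfl⟩; exact (φ x).map_source (hf x hz)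
  have hK : ∀ x, IsCompact (K x) := fun x =>
    (isClosed_tsupport (f x)).isCompact.image_of_continuousOn
      ((continuousOn_extChartAt x).mono (hf x))
  have hKc : ∀ x p, p ∈ T x → p ∉ K x → (φ x).symm p ∉ tsupport (f x) := fun x p hp h h' =>
    h ⟨_, h', (φ x).right_inv hp⟩
  let g : M → M → E2 → ℝ := fun c x p => f x ((φ c).symm p)
  have gs : ∀ c x, ContDiffOn ℝ ∞ (g c x) (T c) := fun c x => contDiffOn_symm (f x).contMDiff c
  have g0 : ∀ x p, p ∈ T x → p ∉ K x → g x x p = 0 := fun x p hp h =>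
    (image_eq_zero_of_notMem_tsupport (hKc x p hp h) : f x ((φ x).symm p) = 0)
  have Ys : ∀ x i, ContDiffOn ℝ ∞ (fun p => Y x p i) (T x) := fun x i =>
    contDiffOn_euclidean.1 (hYs x) i
  have dgY : ∀ c x, ContDiffOn ℝ ∞ (fun p => fderiv ℝ (g c x) p (Y c p)) (T c) := fun c x =>
    ((gs c x).fderiv_of_isOpen (hTo c) (m := ∞) le_rfl).clm_apply (hYs c)
  let D : M → E2 → ℝ := fun x p => pd (fun q => Y x q 0) 0 p + pd (fun q => Y x q 1) 1 p
  have Ds : ∀ x, ContDiffOn ℝ ∞ (D x) (T x) := fun x =>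
    (contDiffOn_pd (hTo x) (Ys x 0) 0).add (contDiffOn_pd (hTo x) (Ys x 1) 1)
  have int1 : ∀ x, IntegrableOn (fun p => g x x p * D x p) (T x) := fun x =>
    integrableOn_of_zero_off_compact (hTo x) (hK x) (hKT x) ((gs x x).mul (Ds x)).continuousOn
      fun p hp h => by rw [g0 x p hp h, zero_mul]
  have dg0 : ∀ x p, p ∈ T x → p ∉ K x → fderiv ℝ (g x x) p (Y x p) = 0 := fun x p hp h => by
    rw [fderiv_eq_sum_pd, pd_eq_zero_of_off_closed (hTo x) (hK x).isClosed (g0 x) hp h,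
      pd_eq_zero_of_off_closed (hTo x) (hK x).isClosed (g0 x) hp h]; simp
  have int2 : ∀ x, IntegrableOn (fun p => fderiv ℝ (g x x) p (Y x p)) (T x) := fun x =>
    integrableOn_of_zero_off_compact (hTo x) (hK x) (hKT x) (dgY x x).continuousOn (dg0 x)
  have stokes : ∀ x, ∫ p in T x, g x x p * D x p = -∫ p in T x, fderiv ℝ (g x x) p (Y x p) := by
    intro x
    have hi : ∀ i, ∫ p in T x, pd (fun q => g x x q * Y x q i) i p = 0 := fun i =>
      setIntegral_pd_eq_zero (hTo x) (hK x) (hKT x) ((gs x x).mul (Ys x i))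
        (fun p hp h => by rw [g0 x p hp h, zero_mul]) i
    have hii : ∀ i, IntegrableOn (pd (fun q => g x x q * Y x q i) i) (T x) := fun i =>
      integrableOn_of_zero_off_compact (hTo x) (hK x) (hKT x)
        (contDiffOn_pd (hTo x) ((gs x x).mul (Ys x i)) i).continuousOn fun p hp h =>
        pd_eq_zero_of_off_closed (hTo x) (hK x).isClosed
          (fun p hp h => by rw [g0 x p hp h, zero_mul]) hp h i
    rw [eq_neg_iff_add_eq_zero, ← integral_add (int1 x) (int2 x)]
    have hs : ∫ p in T x, (pd (fun q => g x x q * Y x q 0) 0 p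
        + pd (fun q => g x x q * Y x q 1) 1 p) = 0 := by
      rw [integral_add (hii 0) (hii 1), hi, hi, add_zero]
    rw [← hs]
    refine setIntegral_congr_fun (hTo x).measurableSet fun p hp => ?_
    have dg := smoothFun.differentiableAt (hTo x) (gs x x) hp
    have pm : ∀ i, pd (fun q => g x x q * Y x q i) i p =
        g x x p * pd (fun q => Y x q i) i p + Y x p i * pd (g x x) i p := fun i => by
      have dY := smoothFun.differentiableAt (hTo x) (Ys x i) hp
      rw [pd, fderiv_fun_mul dg dY]
      simp [pd]
    simp only [pm, D]
    rw [fderiv_eq_sum_pd]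
    simp only [smul_eq_mul]
    ring
  -- By parts, each term is minus the integral of Y(fₓ). Insert 1 = ∑ fᵢ, move the i-th piece to the
  -- chart at i, and sum over x first: what remains is ∑ᵢ ∫ fᵢ Y(∑ₓ fₓ), the derivative of a
  -- constant.
  have total : ∑ x ∈ S, ∫ p in T x, g x x p * D x p = 0 := by
    have h1 : ∀ x, ∫ p in T x, fderiv ℝ (g x x) p (Y x p) =
        ∑ i ∈ S, ∫ p in T i, g i i p * fderiv ℝ (g i x) p (Y i p) := by
      intro x
      have : ∀ i ∈ S, ∫ p in T i, g i i p * fderiv ℝ (g i x) p (Y i p) =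
          ∫ p in T x, g x i p * fderiv ℝ (g x x) p (Y x p) := fun i _ =>
        (setIntegral_density_eq hY (f x).contMDiff (hf i) (hf x)).symm
      rw [Finset.sum_congr rfl this, ← integral_finsetSum]
      · refine setIntegral_congr_fun (hTo x).measurableSet fun p hp => ?_
        rw [← Finset.sum_mul]
        simp only [g]
        rw [hsum, one_mul]
      · intro i _
        exact integrableOn_of_zero_off_compact (hTo x) (hK x) (hKT x)
          ((gs x i).mul (dgY x x)).continuousOn fun p hp h => by rw [dg0 x p hp h, mul_zero]
    simp only [stokes, h1]
    rw [Finset.sum_neg_distrib, Finset.sum_comm, neg_eq_zero]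
    refine Finset.sum_eq_zero fun i _ => ?_
    rw [← integral_finsetSum]
    · refine setIntegral_eq_zero_of_forall_eq_zero fun p hp => ?_
      rw [← Finset.mul_sum]
      have hc : (fun q => ∑ x ∈ S, g i x q) = fun _ => (1 : ℝ) := funext fun q => hsum _
      have hd := congrArg (fun u : E2 → ℝ => fderiv ℝ u p (Y i p)) hc
      simp only [fderiv_fun_const] at hd
      rw [fderiv_fun_sum fun x _ => smoothFun.differentiableAt (hTo i) (gs i x) hp] at hd
      simp only [_root_.sum_apply] at hd
      rw [hd]; simp
    · intro x _
      exact integrableOn_of_zero_off_compact (hTo i) (hK i) (hKT i)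
        ((gs i i).mul (dgY i x)).continuousOn fun p hp h => by rw [g0 i p hp h, zero_mul]
  have nonneg : ∀ x, ∀ p ∈ T x, 0 ≤ g x x p * D x p := fun x p hp =>
    mul_nonneg (f.nonneg x _) (hdiv x p hp)
  have each : ∀ x ∈ S, ∫ p in T x, g x x p * D x p = 0 := by
    rwa [Finset.sum_eq_zero_iff_of_nonneg fun x _ =>
      setIntegral_nonneg (hTo x).measurableSet (nonneg x)] at total
  obtain ⟨x, hx⟩ := f.exists_pos_of_mem (mem_univ y)
  have hxS : x ∈ S := (hS x).2 ⟨y, hx.ne'⟩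
  have hy : y ∈ (φ x).source := hf x (subset_tsupport _ hx.ne')
  refine ⟨x, hy, ?_⟩
  have h0 := (setIntegral_eq_zero_iff_of_nonneg_ae
    ((ae_restrict_iff' (hTo x).measurableSet).2 (Filter.Eventually.of_forall (nonneg x)))
    (int1 x)).1 (each x hxS)
  -- A continuous function that vanishes almost everywhere on an open set vanishes on it; at y the
  -- weight f x is positive, so the divergence is zero there.
  have h1 := Measure.eqOn_open_of_ae_eq h0 (hTo x) ((gs x x).mul (Ds x)).continuousOn
    continuousOn_const ((φ x).map_source hy)
  have h2 : g x x (φ x y) = f x y := by simp only [g]; rw [(φ x).left_inv hy]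
  simp only [h2, Pi.zero_apply] at h1
  exact (mul_eq_zero.1 h1).resolve_left hx.ne'

end Berger

/-! ### The divergence of the Simons field. -/

namespace Berger
namespace LocalSurface

variable {κ τ H : ℝ} {V : Set E2} {F ν : E2 → R4}

/-- The triple product is continuous without zeros, so its sign s is locally constant. This replaces
the signed density of `smooth_system` by the square root of the Gram determinant, which does not
depend on ν. -/
theorem eventually_sign (h : LocalSurface κ τ H V F ν) (hκ : 0 < κ) (hτ : τ ≠ 0) {p : E2} (hp : p ∈ V) :
    ∃ s : ℝ, ∀ᶠ q in nhds p, q ∈ V ∧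
      √(gramDet κ τ F q) / gramDet κ τ F q = s * (triple κ τ F ν q)⁻¹ ∧
      √(gramDet κ τ F q) = s * triple κ τ F ν q := by
  have hc : ContinuousAt (triple κ τ F ν) p :=
    h.contDiffOn_triple.continuousOn.continuousAt (h.isOpen.mem_nhds hp)
  have key : ∀ s : ℝ, ∀ q ∈ V, s * s = 1 → 0 < s * triple κ τ F ν q → q ∈ V ∧
      √(gramDet κ τ F q) / gramDet κ τ F q = s * (triple κ τ F ν q)⁻¹ ∧
      √(gramDet κ τ F q) = s * triple κ τ F ν q := by
    intro s q hq hs h0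
    have e : √(gramDet κ τ F q) = s * triple κ τ F ν q := by
      rw [← h.triple_sq hκ hτ hq, ← Real.sqrt_sq h0.le]
      congr 1
      linear_combination (-(triple κ τ F ν q) ^ 2) * hs
    refine ⟨hq, ?_, e⟩
    rw [e, ← h.triple_sq hκ hτ hq]
    field_simp [h.triple_ne hκ hτ hq]
  rcases lt_or_gt_of_ne (h.triple_ne hκ hτ hp) with h0 | h0
  · refine ⟨-1, ?_⟩
    filter_upwards [h.isOpen.mem_nhds hp, hc.eventually (gt_mem_nhds h0)] with q hq hq0
    exact key _ q hq (by norm_num) (by linarith)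
  · refine ⟨1, ?_⟩
    filter_upwards [h.isOpen.mem_nhds hp, hc.eventually (lt_mem_nhds h0)] with q hq hq0
    exact key _ q hq (by norm_num) (by linarith)

theorem exists_divergence_eq (h : LocalSurface κ τ H V F ν) (hκ : 0 < κ) (hτ : τ ≠ 0)
    {A HC : E2 → ℝ} {CN : Fin 3 → E2 → ℝ}
    (hA : ∀ p ∈ V, gramDet κ τ F p ^ 2 * A p = normSqNum κ τ F ν p)
    (hHC : ∀ p ∈ V, HC p = H * normalComp κ τ F ν 2 p)
    (hCN : ∀ p ∈ V, ∀ k, CN k p = normalComp κ τ F ν 2 p * normalComp κ τ F ν k p) {p : E2}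
    (hp : p ∈ V) : ∃ P Q : ℝ,
      pd (fun q => √(gramDet κ τ F q) * simonsField κ τ F A HC CN 0 q) 0 p
      + pd (fun q => √(gramDet κ τ F q) * simonsField κ τ F A HC CN 1 q) 1 p
      = 2 * √(gramDet κ τ F p) * ((κ - 4 * τ ^ 2) ^ 2 * (normalComp κ τ F ν 2 p ^ 2
          * (1 - normalComp κ τ F ν 2 p ^ 2))
        - ((A p - 2 * H ^ 2) ^ 2 - quadB κ τ H (normalComp κ τ F ν 2 p) * (A p - 2 * H ^ 2)
          + quadC κ τ H (normalComp κ τ F ν 2 p)) + P ^ 2 + Q ^ 2) := by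
  obtain ⟨P, Q, hPQ⟩ := (h.smooth_system hκ hτ hA hHC hCN).2.2
  obtain ⟨s, hs⟩ := h.eventually_sign hκ hτ hp
  refine ⟨P p, Q p, ?_⟩
  have e0 : (fun q => √(gramDet κ τ F q) * simonsField κ τ F A HC CN 0 q) =ᶠ[nhds p]
      fun q => s • ((triple κ τ F ν q)⁻¹ * (gramE κ τ F 1 1 q * simonsCovector κ τ F A HC CN 0 q
        - gramE κ τ F 0 1 q * simonsCovector κ τ F A HC CN 1 q)) := by
    filter_upwards [hs] with q hq
    rw [simonsField, smul_eq_mul, ← mul_assoc, ← hq.2.1]; ring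
  have e1 : (fun q => √(gramDet κ τ F q) * simonsField κ τ F A HC CN 1 q) =ᶠ[nhds p]
      fun q => s • ((triple κ τ F ν q)⁻¹ * (gramE κ τ F 0 0 q * simonsCovector κ τ F A HC CN 1 q
        - gramE κ τ F 0 1 q * simonsCovector κ τ F A HC CN 0 q)) := by
    filter_upwards [hs] with q hq
    rw [simonsField, smul_eq_mul, ← mul_assoc, ← hq.2.1]; ring
  have g : ∀ (u : E2 → ℝ) (i : Fin 2), pd (fun q => s • u q) i p = s * pd u i p := by
    intro u i
    rw [pd, show (fun q => s • u q) = s • u from rfl, fderiv_const_smul_field]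
    rfl
  rw [pd, e0.fderiv_eq, pd, e1.fderiv_eq, ← pd, ← pd, g, g, ← mul_add, hPQ p hp,
    hs.self_of_nhds.2.2]
  ring

theorem contDiffOn_simonsField (h : LocalSurface κ τ H V F ν)
    {A HC : E2 → ℝ} {CN : Fin 3 → E2 → ℝ}
    (hA : ∀ p ∈ V, gramDet κ τ F p ^ 2 * A p = normSqNum κ τ F ν p)
    (hHC : ∀ p ∈ V, HC p = H * normalComp κ τ F ν 2 p)
    (hCN : ∀ p ∈ V, ∀ k, CN k p = normalComp κ τ F ν 2 p * normalComp κ τ F ν k p) (i : Fin 2) :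
    ContDiffOn ℝ ∞ (fun q => √(gramDet κ τ F q) * simonsField κ τ F A HC CN i q) V := by
  have g00 := h.contDiffOn_gramE 0 0
  have g01 := h.contDiffOn_gramE 0 1
  have g11 := h.contDiffOn_gramE 1 1
  have l := h.contDiffOn_simonsCovector (h.contDiffOn_normSq hA) hHC hCN
  have hw : ContDiffOn ℝ ∞ (fun q => √(gramDet κ τ F q)) V :=
    h.contDiffOn_gramDet.sqrt fun p hp => (h.gramDet_pos p hp).ne'
  have hd : ∀ p ∈ V, gramDet κ τ F p ≠ 0 := fun p hp => (h.gramDet_pos p hp).ne'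
  fin_cases i
  · exact hw.mul (((g11.mul (l 0)).sub (g01.mul (l 1))).div h.contDiffOn_gramDet hd)
  · exact hw.mul (((g00.mul (l 1)).sub (g01.mul (l 0))).div h.contDiffOn_gramDet hd)

end LocalSurface
end Berger

/-! ### Differentials on the manifold and in charts. -/

namespace Berger

open Set Filter

variable {M : Type*} [TopologicalSpace M] [ChartedSpace E2 M]

/-- The tangent space at y is the model plane read in the preferred chart at y, so in that chart
`mfderiv` is an ordinary derivative. Any other chart enters through `transition`. -/
theorem mfderiv_eq_fderiv_symm {W : Type*} [NormedAddCommGroup W] [NormedSpace ℝ W] {u : M → W}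
    {y : M} (hu : MDifferentiableAt (𝓡 2) 𝓘(ℝ, W) u y) (v : E2) :
    DifferentiableAt ℝ (fun q => u ((extChartAt (𝓡 2) y).symm q)) (extChartAt (𝓡 2) y y) ∧
    mfderiv (𝓡 2) 𝓘(ℝ, W) u y v =
      fderiv ℝ (fun q => u ((extChartAt (𝓡 2) y).symm q)) (extChartAt (𝓡 2) y y) v := by
  have h2 : DifferentiableWithinAt ℝ (fun q => u ((extChartAt (𝓡 2) y).symm q)) (range (𝓡 2))
      (extChartAt (𝓡 2) y y) := hu.differentiableWithinAt_writtenInExtChartAt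
  have h3 : mfderiv (𝓡 2) 𝓘(ℝ, W) u y = fderivWithin ℝ
      (fun q => u ((extChartAt (𝓡 2) y).symm q)) (range (𝓡 2)) (extChartAt (𝓡 2) y y) := by
    simp only [mfderiv, hu]
    rfl
  rw [(𝓡 2).range_eq_univ, differentiableWithinAt_univ] at h2
  rw [(𝓡 2).range_eq_univ, fderivWithin_univ] at h3
  exact ⟨h2, congrArg (fun L : E2 →L[ℝ] W => L v) h3⟩

section transition

variable [IsManifold (𝓡 2) ∞ M]

theorem fderiv_symm_eq_mfderiv {W : Type*} [NormedAddCommGroup W] [NormedSpace ℝ W] {u : M → W}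
    {x y : M} {p : E2} (hp : p ∈ (extChartAt (𝓡 2) x).target)
    (hy : (extChartAt (𝓡 2) x).symm p = y)
    (hu : MDifferentiableAt (𝓡 2) 𝓘(ℝ, W) u y) (v : E2) :
    fderiv ℝ (fun q => u ((extChartAt (𝓡 2) x).symm q)) p v =
      mfderiv (𝓡 2) 𝓘(ℝ, W) u y (fderiv ℝ (transition x y) p v) := by
  have ho : p ∈ overlap x y := ⟨hp, by rw [mem_preimage, hy]; exact mem_extChartAt_source y⟩
  have ht : transition x y p = extChartAt (𝓡 2) y y := by rw [transition, hy]
  rw [fderiv_comp_symm u ho (by rw [ht]; exact (mfderiv_eq_fderiv_symm hu v).1), ht]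
  exact (mfderiv_eq_fderiv_symm hu _).2.symm

theorem fderiv_transition_fderiv {x y : M} {p : E2} (hp : p ∈ overlap x y) (v : E2) :
    fderiv ℝ (transition y x) (transition x y p) (fderiv ℝ (transition x y) p v) = v := by
  have e : transition y x ∘ transition x y =ᶠ[nhds p] id := by
    filter_upwards [(isOpen_overlap x y).mem_nhds hp] with q hq using transition_transition hq
  have := fderiv_comp p (differentiableAt_transition (transition_mem hp))
    (differentiableAt_transition hp)
  rw [e.fderiv_eq, fderiv_id] at this
  exact (congrArg (fun L : E2 →L[ℝ] E2 => L v) this).symm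

end transition

theorem inner_fderiv_eq_zero {F : E2 → R4} {p : E2} (hd : DifferentiableAt ℝ F p)
    (h : ∀ᶠ q in nhds p, ‖F q‖ = 1) (v : E2) : inner ℝ (fderiv ℝ F p v) (F p) = 0 := by
  have h1 : (fun q => inner ℝ (F q) (F q)) =ᶠ[nhds p] fun _ => (1 : ℝ) := by
    filter_upwards [h] with q hq
    rw [real_inner_self_eq_norm_sq, hq]; norm_num
  have h3 := congrArg (fun L : E2 →L[ℝ] ℝ => L v) h1.fderiv_eq
  rw [fderiv_inner_apply ℝ hd hd, fderiv_fun_const] at h3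
  change inner ℝ (F p) (fderiv ℝ F p v) + inner ℝ (fderiv ℝ F p v) (F p) = 0 at h3
  rw [real_inner_comm] at h3
  linarith

section immersion

theorem fact_finrank : Fact (Module.finrank ℝ R4 = 3 + 1) := ⟨by simp⟩

attribute [local instance] fact_finrank

variable {f : M → S3}

theorem IsSmoothImmersion.contMDiff (hf : IsSmoothImmersion f) :
    ContMDiff (𝓡 2) 𝓘(ℝ, R4) ∞ (fun y => (f y : R4)) :=
  contMDiff_coe_sphere.comp hf.1

theorem IsSmoothImmersion.mdifferentiableAt (hf : IsSmoothImmersion f) (y : M) :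
    MDifferentiableAt (𝓡 2) 𝓘(ℝ, R4) (fun y => (f y : R4)) y :=
  hf.contMDiff.mdifferentiable (by simp) y

theorem IsSmoothImmersion.diff_injective (hf : IsSmoothImmersion f) (y : M) :
    Function.Injective (diff f y) := by
  have h : ∀ v, diff f y v = mfderiv (𝓡 3) 𝓘(ℝ, R4) ((↑) : S3 → R4) (f y)
      (mfderiv (𝓡 2) (𝓡 3) f y v) := fun v =>
    mfderiv_comp_apply y (contMDiff_coe_sphere.mdifferentiable (n := ∞) (by simp) (f y))
      (hf.1.mdifferentiable (by simp) y) v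
  intro v w hvw
  rw [h, h] at hvw
  exact hf.2 y (mfderiv_coe_sphere_injective (f y) hvw)

theorem IsSmoothImmersion.inner_diff (hf : IsSmoothImmersion f) (y : M) (v : TangentSpace (𝓡 2) y) :
    inner ℝ (diff f y v) (f y : R4) = 0 := by
  obtain ⟨h1, h2⟩ := mfderiv_eq_fderiv_symm (hf.mdifferentiableAt y) v
  have := inner_fderiv_eq_zero h1 (Eventually.of_forall fun q => by simp) v
  simp only [extChartAt_to_inv] at this
  rw [← this, diff, h2]

theorem diff_add (y : M) (v w : TangentSpace (𝓡 2) y) :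
    diff f y (v + w) = diff f y v + diff f y w := map_add _ _ _

theorem diff_smul (y : M) (r : ℝ) (v : TangentSpace (𝓡 2) y) :
    diff f y (r • v) = r • diff f y v := map_smul _ _ _

theorem eq_basisVec (y : M) (v : E2) :
    (v : TangentSpace (𝓡 2) y) = v 0 • basisVec y 0 + v 1 • basisVec y 1 := by
  have : v = v 0 • EuclideanSpace.single 0 (1 : ℝ) + v 1 • EuclideanSpace.single 1 (1 : ℝ) := by
    ext i; fin_cases i <;> simp
  exact this

theorem IsSmoothImmersion.metric_diff_pos {κ τ : ℝ} (hκ : 0 < κ) (hτ : τ ≠ 0)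
    (hf : IsSmoothImmersion f) {y : M} {v : TangentSpace (𝓡 2) y} (hv : v ≠ 0) :
    0 < metric κ τ (f y) (diff f y v) (diff f y v) := by
  have hi := hf.inner_diff y v
  have hs := sphere_sum_sq (f y)
  rw [metric_eq_sum hκ hτ _ hs hi]
  by_contra hn
  have h0 : metric κ τ (f y) (diff f y v) (frame κ τ 0 (f y)) = 0 := by nlinarith
  have h1 : metric κ τ (f y) (diff f y v) (frame κ τ 1 (f y)) = 0 := by nlinarith
  have h2 : metric κ τ (f y) (diff f y v) (frame κ τ 2 (f y)) = 0 := by nlinarith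
  have := tangent_expand hκ hτ hs hi
  rw [h0, h1, h2] at this
  simp only [zero_smul, add_zero] at this
  exact hv (hf.diff_injective y (this.trans (map_zero (mfderiv (𝓡 2) 𝓘(ℝ, R4) (fun y => (f y : R4)) y)).symm))

end immersion

end Berger

/-! ### The immersion and its second fundamental form in a chart. -/

namespace Berger

open Set Filter

variable {M : Type*} [TopologicalSpace M] [ChartedSpace E2 M] {f : M → S3} {N : M → R4} {κ τ : ℝ}

/-- The immersion, read in the chart at `x`. -/
def chartImm (f : M → S3) (x : M) (p : E2) : R4 := (f ((extChartAt (𝓡 2) x).symm p) : R4)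

/-- A vector field along the immersion, read in the chart at `x`. -/
def chartField (N : M → R4) (x : M) (p : E2) : R4 := N ((extChartAt (𝓡 2) x).symm p)

/-- The open set `U`, read in the chart at `x`. -/
def chartDom (x : M) (U : Set M) : Set E2 :=
  (extChartAt (𝓡 2) x).target ∩ (extChartAt (𝓡 2) x).symm ⁻¹' U

/-- The differential of the inverse of the chart at `x`. -/
def chartBasis (x : M) (p : E2) (i : Fin 2) : E2 :=
  fderiv ℝ (transition x ((extChartAt (𝓡 2) x).symm p)) p (EuclideanSpace.single i 1)

theorem isOpen_chartDom (x : M) {U : Set M} (hU : IsOpen U) : IsOpen (chartDom x U) :=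
  (continuousOn_extChartAt_symm x).isOpen_inter_preimage (isOpen_extChartAt_target x) hU

theorem secondForm_eq (hκ : 0 < κ) (hτ : τ ≠ 0) (f : M → S3) (N : M → R4) (y : M)
    (v w : TangentSpace (𝓡 2) y) {a b n : Fin 3 → ℝ}
    (ha : ∀ k, metric κ τ (f y) (diff f y v) (frame κ τ k (f y)) = a k)
    (hb : ∀ k, metric κ τ (f y) (diff f y w) (frame κ τ k (f y)) = b k)
    (hn : ∀ k, comp κ τ f N k y = n k) :
    secondForm κ τ f N y v w =
      -((dirDeriv (comp κ τ f N 0) y v + (-τ) * (a 1 * n 2)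
        - (-τ + (2 * τ - κ / (2 * τ))) * (a 2 * n 1)) * b 0
      + (dirDeriv (comp κ τ f N 1) y v + (-τ + (2 * τ - κ / (2 * τ))) * (a 2 * n 0)
        - (-τ) * (a 0 * n 2)) * b 1
      + (dirDeriv (comp κ τ f N 2) y v + (-τ) * (a 0 * n 1)
        - (-τ) * (a 1 * n 0)) * b 2) := by
  obtain ⟨s0, s1, s2⟩ := sum_connCoeff hκ hτ (f y) a n rfl rfl
  simp only [secondForm, covDeriv, ha, hn]
  rw [Fin.sum_univ_three, s0, s1, s2]
  simp only [metric_add_left, metric_smul_left, metric_comm κ τ (f y) (frame κ τ _ (f y)), hb]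
  ring

theorem secondForm_expand (hκ : 0 < κ) (hτ : τ ≠ 0) (f : M → S3) (N : M → R4) (y : M) (v w : E2) :
    secondForm κ τ f N y v w =
      v 0 * w 0 * secondFormMatrix κ τ f N y 0 0 + v 0 * w 1 * secondFormMatrix κ τ f N y 0 1
      + v 1 * w 0 * secondFormMatrix κ τ f N y 1 0 + v 1 * w 1 * secondFormMatrix κ τ f N y 1 1 := by
  have hd : ∀ u : E2, diff f y u = u 0 • diff f y (basisVec y 0) + u 1 • diff f y (basisVec y 1) := by
    intro u
    conv_lhs => rw [eq_basisVec y u, diff_add, diff_smul, diff_smul]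
  have hm : ∀ (u : E2) k, metric κ τ (f y) (diff f y u) (frame κ τ k (f y)) =
      u 0 * metric κ τ (f y) (diff f y (basisVec y 0)) (frame κ τ k (f y))
      + u 1 * metric κ τ (f y) (diff f y (basisVec y 1)) (frame κ τ k (f y)) := by
    intro u k
    rw [hd u, metric_add_left, metric_smul_left, metric_smul_left]
  have hc : ∀ (u : E2) (g : M → ℝ), dirDeriv g y u =
      u 0 * dirDeriv g y (basisVec y 0) + u 1 * dirDeriv g y (basisVec y 1) := by
    intro u g
    unfold dirDeriv
    conv_lhs => rw [eq_basisVec y u, map_add, map_smul, map_smul]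
    rfl
  simp only [secondFormMatrix, Matrix.of_apply]
  rw [secondForm_eq hκ hτ f N y v w (hm v) (hm w) fun k => rfl,
    secondForm_eq hκ hτ f N y _ _ (fun k => rfl) (fun k => rfl) fun k => rfl,
    secondForm_eq hκ hτ f N y _ _ (fun k => rfl) (fun k => rfl) fun k => rfl,
    secondForm_eq hκ hτ f N y _ _ (fun k => rfl) (fun k => rfl) fun k => rfl,
    secondForm_eq hκ hτ f N y _ _ (fun k => rfl) (fun k => rfl) fun k => rfl,
    hc v, hc v, hc v]
  ring

theorem metric_diff_expand (f : M → S3) (y : M) (v w : E2) :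
    metric κ τ (f y) (diff f y v) (diff f y w) =
      v 0 * w 0 * gramMatrix κ τ f y 0 0 + v 0 * w 1 * gramMatrix κ τ f y 0 1
      + v 1 * w 0 * gramMatrix κ τ f y 0 1 + v 1 * w 1 * gramMatrix κ τ f y 1 1 := by
  have hd : ∀ u : E2, diff f y u = u 0 • diff f y (basisVec y 0) + u 1 • diff f y (basisVec y 1) := by
    intro u
    conv_lhs => rw [eq_basisVec y u, diff_add, diff_smul, diff_smul]
  simp only [gramMatrix, Matrix.of_apply]
  rw [hd v, hd w]
  simp only [metric_add_left, metric_smul_left, metric_add_right, metric_smul_right,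
    metric_comm κ τ (f y) (diff f y (basisVec y 1)) (diff f y (basisVec y 0))]
  ring

/-- With A = ⟨v, v⟩ and B = ⟨v, w⟩, the vector A w - B v is nonzero and its squared length is A
times the Gram determinant. -/
theorem IsSmoothImmersion.gramMatrix_det_pos (hf : IsSmoothImmersion f) (hκ : 0 < κ) (hτ : τ ≠ 0)
    (y : M) {v w : E2} (h : v 0 * w 1 - v 1 * w 0 ≠ 0) :
    0 < metric κ τ (f y) (diff f y v) (diff f y v) * metric κ τ (f y) (diff f y w) (diff f y w)
      - metric κ τ (f y) (diff f y v) (diff f y w) * metric κ τ (f y) (diff f y v) (diff f y w) := by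
  have hv : v ≠ 0 := by rintro rfl; simp at h
  have h0 := hf.metric_diff_pos hκ hτ (y := y) hv
  set A := metric κ τ (f y) (diff f y v) (diff f y v) with hA
  set B := metric κ τ (f y) (diff f y v) (diff f y w) with hB
  have hu : A • w - B • v ≠ 0 := by
    intro h1
    have e0 := congrArg (fun u : E2 => u 0) h1
    have e1 := congrArg (fun u : E2 => u 1) h1
    simp only [PiLp.sub_apply, PiLp.smul_apply, smul_eq_mul, PiLp.zero_apply] at e0 e1
    have : A * (v 0 * w 1 - v 1 * w 0) = 0 := by linear_combination v 0 * e1 - v 1 * e0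
    rcases mul_eq_zero.1 this with h2 | h2
    · exact h0.ne' h2
    · exact h h2
  have h2 := hf.metric_diff_pos hκ hτ (y := y) hu
  have e : diff f y (A • w - B • v : E2) = A • diff f y w + (-B) • diff f y v := by
    have : (A • w - B • v : E2) = A • w + (-B) • v := by rw [neg_smul, sub_eq_add_neg]
    rw [this]
    exact (diff_add y _ _).trans (congrArg₂ _ (diff_smul y _ _) (diff_smul y _ _))
  rw [e] at h2
  simp only [metric_add_left, metric_smul_left, metric_add_right, metric_smul_right,
    metric_comm κ τ (f y) (diff f y w) (diff f y v), ← hA, ← hB] at h2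
  refine pos_of_mul_pos_right (a := A) ?_ h0.le
  linarith

section charts

variable [IsManifold (𝓡 2) ∞ M]

/-- The differential of a coordinate change has a left inverse, so it maps the standard basis to
independent vectors. -/
theorem chartBasis_det_ne {x : M} {p : E2} (hp : p ∈ (extChartAt (𝓡 2) x).target) :
    chartBasis x p 0 0 * chartBasis x p 1 1 - chartBasis x p 0 1 * chartBasis x p 1 0 ≠ 0 := by
  set y := (extChartAt (𝓡 2) x).symm p with hy
  have ho : p ∈ overlap x y := ⟨hp, by rw [mem_preimage, ← hy]; exact mem_extChartAt_source y⟩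
  intro h
  have inj : ∀ v : E2, fderiv ℝ (transition x y) p v = 0 → v = 0 := by
    intro v hv
    rw [← fderiv_transition_fderiv ho v, hv, map_zero]
  have key : ∀ r s : ℝ, r • chartBasis x p 0 + s • chartBasis x p 1 = 0 → r = 0 ∧ s = 0 := by
    intro r s hrs
    have h1 := inj (r • EuclideanSpace.single 0 1 + s • EuclideanSpace.single 1 1) (by
      rw [map_add, map_smul, map_smul]; exact hrs)
    have e0 := congrArg (fun u : E2 => u 0) h1
    have e1 := congrArg (fun u : E2 => u 1) h1
    simp at e0 e1
    exact ⟨e0, e1⟩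
  have k0 := key (chartBasis x p 1 0) (-chartBasis x p 0 0) (by
    ext i; fin_cases i
    · simp; ring
    · simp; linear_combination -h)
  have k1 := key (chartBasis x p 1 1) (-chartBasis x p 0 1) (by
    ext i; fin_cases i
    · simp; linear_combination h
    · simp; ring)
  have k2 := key 0 1 (by
    ext i; fin_cases i
    · simp [k0.1]
    · simp [k1.1])
  exact one_ne_zero k2.2

theorem pd_eq_mfderiv {W : Type*} [NormedAddCommGroup W] [NormedSpace ℝ W] {u : M → W}
    {x : M} {p : E2} (hp : p ∈ (extChartAt (𝓡 2) x).target)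
    (hu : MDifferentiableAt (𝓡 2) 𝓘(ℝ, W) u ((extChartAt (𝓡 2) x).symm p)) (i : Fin 2) :
    pd (fun q => u ((extChartAt (𝓡 2) x).symm q)) i p =
      mfderiv (𝓡 2) 𝓘(ℝ, W) u ((extChartAt (𝓡 2) x).symm p) (chartBasis x p i) :=
  fderiv_symm_eq_mfderiv hp rfl hu _

theorem IsSmoothImmersion.pd_chartImm (hf : IsSmoothImmersion f) {x : M} {p : E2}
    (hp : p ∈ (extChartAt (𝓡 2) x).target) (i : Fin 2) :
    pd (chartImm f x) i p = diff f ((extChartAt (𝓡 2) x).symm p) (chartBasis x p i) :=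
  pd_eq_mfderiv hp (hf.mdifferentiableAt _) i

theorem IsUnitNormalOn.contMDiffOn_comp {U : Set M} (hf : IsSmoothImmersion f)
    (hN : IsUnitNormalOn κ τ f U N) (k : Fin 3) :
    ContMDiffOn (𝓡 2) 𝓘(ℝ, ℝ) ∞ (comp κ τ f N k) U := by
  have h1 : ContDiff ℝ ∞ (fun z : R4 × R4 => metric κ τ z.1 z.2 (frame κ τ k z.1)) := by
    rw [← contDiffOn_univ]
    exact metric_contDiffOn κ τ contDiffOn_fst contDiffOn_snd
      ((frame_contDiff κ τ k).comp_contDiffOn contDiffOn_fst)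
  have h2 : ContMDiffOn (𝓡 2) 𝓘(ℝ, R4 × R4) ∞ (fun y => ((f y : R4), N y)) U :=
    hf.contMDiff.contMDiffOn.prodMk_space hN.smooth
  exact (h1.contMDiff.comp_contMDiffOn h2).congr fun y _ => rfl

theorem IsUnitNormalOn.secE_eq {U : Set M} (hκ : 0 < κ) (hτ : τ ≠ 0) (hf : IsSmoothImmersion f)
    (hN : IsUnitNormalOn κ τ f U N) {x : M} {p : E2} (hp : p ∈ chartDom x U) (i j : Fin 2) :
    secE κ τ (chartImm f x) (chartField N x) i j p =
      secondForm κ τ f N ((extChartAt (𝓡 2) x).symm p) (chartBasis x p i) (chartBasis x p j) := by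
  refine Eq.trans ?_ (secondForm_eq hκ hτ f N ((extChartAt (𝓡 2) x).symm p) (chartBasis x p i)
    (chartBasis x p j) (fun k => rfl) (fun k => rfl) fun k => rfl).symm
  have hd : ∀ k, pd (normalComp κ τ (chartImm f x) (chartField N x) k) i p =
      dirDeriv (comp κ τ f N k) ((extChartAt (𝓡 2) x).symm p) (chartBasis x p i) := fun k =>
    pd_eq_mfderiv hp.1 (((hN.contMDiffOn_comp hf k).contMDiffAt
      (hN.isOpen.mem_nhds hp.2)).mdifferentiableAt (by simp)) i
  have hc : ∀ i k, coframe κ τ (chartImm f x) i k p = metric κ τ (f ((extChartAt (𝓡 2) x).symm p))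
      (diff f ((extChartAt (𝓡 2) x).symm p) (chartBasis x p i))
      (frame κ τ k (f ((extChartAt (𝓡 2) x).symm p))) := fun i k => by
    rw [coframe, hf.pd_chartImm hp.1]; rfl
  simp only [secE, hd, hc]
  rfl

end charts
end Berger

/-! ### Mean curvature and |A|² in a chart. -/

namespace Berger

open Set Filter

theorem trace_inv_mul {G B : Matrix (Fin 2) (Fin 2) ℝ} (hG : G 1 0 = G 0 1)
    (hd : G 0 0 * G 1 1 - G 0 1 * G 0 1 ≠ 0) :
    (G 0 0 * G 1 1 - G 0 1 * G 0 1) * (G⁻¹ * B).trace =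
      G 1 1 * B 0 0 - G 0 1 * B 1 0 - G 0 1 * B 0 1 + G 0 0 * B 1 1 ∧
    (G 0 0 * G 1 1 - G 0 1 * G 0 1) ^ 2 * (G⁻¹ * B * (G⁻¹ * B)).trace =
      (G 1 1 * B 0 0 - G 0 1 * B 1 0) ^ 2
        + 2 * ((G 1 1 * B 0 1 - G 0 1 * B 1 1) * (G 0 0 * B 1 0 - G 0 1 * B 0 0))
        + (G 0 0 * B 1 1 - G 0 1 * B 0 1) ^ 2 := by
  have hdet : G.det = G 0 0 * G 1 1 - G 0 1 * G 0 1 := by rw [Matrix.det_fin_two, hG]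
  have hinv : G⁻¹ = (G 0 0 * G 1 1 - G 0 1 * G 0 1)⁻¹ • !![G 1 1, -G 0 1; -G 0 1, G 0 0] := by
    rw [Matrix.inv_def, Matrix.adjugate_fin_two, hdet, hG, Ring.inverse_eq_inv']
  rw [hinv]
  generalize G 0 0 * G 1 1 - G 0 1 * G 0 1 = d at *
  constructor
  · simp [Matrix.trace_fin_two, Matrix.mul_apply, Fin.sum_univ_two, -Matrix.cons_mul, -Matrix.smul_mul, -Matrix.smul_of]
    field_simp
    ring
  · simp [Matrix.trace_fin_two, Matrix.mul_apply, Fin.sum_univ_two, -Matrix.cons_mul, -Matrix.smul_mul, -Matrix.smul_of]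
    field_simp
    ring

variable {M : Type*} [TopologicalSpace M] [ChartedSpace E2 M] {f : M → S3} {N : M → R4} {κ τ : ℝ}

theorem gramMatrix_symm (f : M → S3) (y : M) :
    gramMatrix κ τ f y 1 0 = gramMatrix κ τ f y 0 1 := metric_comm _ _ _ _ _

theorem IsSmoothImmersion.gramMatrix_ne (hf : IsSmoothImmersion f) (hκ : 0 < κ) (hτ : τ ≠ 0) (y : M) :
    gramMatrix κ τ f y 0 0 * gramMatrix κ τ f y 1 1
      - gramMatrix κ τ f y 0 1 * gramMatrix κ τ f y 0 1 ≠ 0 :=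
  (hf.gramMatrix_det_pos hκ hτ y (v := EuclideanSpace.single 0 1) (w := EuclideanSpace.single 1 1)
    (by simp)).ne'

section charts

variable [IsManifold (𝓡 2) ∞ M]

theorem IsSmoothImmersion.gramE_chart (hf : IsSmoothImmersion f) {x : M} {p : E2}
    (hp : p ∈ (extChartAt (𝓡 2) x).target) (i j : Fin 2) :
    gramE κ τ (chartImm f x) i j p = metric κ τ (f ((extChartAt (𝓡 2) x).symm p))
      (diff f ((extChartAt (𝓡 2) x).symm p) (chartBasis x p i))
      (diff f ((extChartAt (𝓡 2) x).symm p) (chartBasis x p j)) := by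
  rw [gramE, hf.pd_chartImm hp, hf.pd_chartImm hp]; rfl

theorem IsSmoothImmersion.gramDet_chart_pos (hf : IsSmoothImmersion f) (hκ : 0 < κ) (hτ : τ ≠ 0)
    {x : M} {p : E2} (hp : p ∈ (extChartAt (𝓡 2) x).target) :
    0 < gramDet κ τ (chartImm f x) p := by
  rw [gramDet, hf.gramE_chart hp, hf.gramE_chart hp, hf.gramE_chart hp]
  exact hf.gramMatrix_det_pos hκ hτ _ (chartBasis_det_ne hp)

theorem contDiffOn_chart {W : Type*} [NormedAddCommGroup W] [NormedSpace ℝ W] {u : M → W}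
    {U : Set M} (hu : ContMDiffOn (𝓡 2) 𝓘(ℝ, W) ∞ u U) (x : M) :
    ContDiffOn ℝ ∞ (fun p => u ((extChartAt (𝓡 2) x).symm p)) (chartDom x U) := by
  rw [← contMDiffOn_iff_contDiffOn]
  exact hu.comp ((contMDiffOn_extChartAt_symm x).mono inter_subset_left) fun p hp => hp.2

/-- Traces of the shape operator do not depend on the basis. Passing from the basis of T_yM to the
chart basis, of determinant J, multiplies the numerator and denominator of 2H by J² and those of
|A|² by J⁴. -/
theorem IsUnitNormalOn.trace_chart {U : Set M} (hκ : 0 < κ) (hτ : τ ≠ 0) (hf : IsSmoothImmersion f)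
    (hN : IsUnitNormalOn κ τ f U N) {x : M} {p : E2} (hp : p ∈ chartDom x U) :
    gramE κ τ (chartImm f x) 1 1 p * secE κ τ (chartImm f x) (chartField N x) 0 0 p
      - gramE κ τ (chartImm f x) 0 1 p * secE κ τ (chartImm f x) (chartField N x) 1 0 p
      - gramE κ τ (chartImm f x) 0 1 p * secE κ τ (chartImm f x) (chartField N x) 0 1 p
      + gramE κ τ (chartImm f x) 0 0 p * secE κ τ (chartImm f x) (chartField N x) 1 1 p
      = 2 * meanCurvature κ τ f N ((extChartAt (𝓡 2) x).symm p) * gramDet κ τ (chartImm f x) p ∧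
    gramDet κ τ (chartImm f x) p ^ 2 * normSqA κ τ f N ((extChartAt (𝓡 2) x).symm p)
      = normSqNum κ τ (chartImm f x) (chartField N x) p := by
  have hS := fun i j => hN.secE_eq hκ hτ hf hp i j
  have hG := fun i j => hf.gramE_chart (κ := κ) (τ := τ) hp.1 i j
  simp only [normSqNum, gramDet, hS, hG]
  generalize hy : (extChartAt (𝓡 2) x).symm p = y
  obtain ⟨t1, t2⟩ := trace_inv_mul (B := secondFormMatrix κ τ f N y)
    (gramMatrix_symm (κ := κ) (τ := τ) f y) (hf.gramMatrix_ne hκ hτ y)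
  have hm : 2 * meanCurvature κ τ f N y =
      ((gramMatrix κ τ f y)⁻¹ * secondFormMatrix κ τ f N y).trace := by
    rw [meanCurvature, shapeMatrix]; ring
  have hn : normSqA κ τ f N y = ((gramMatrix κ τ f y)⁻¹ * secondFormMatrix κ τ f N y *
    ((gramMatrix κ τ f y)⁻¹ * secondFormMatrix κ τ f N y)).trace := rfl
  rw [← hm] at t1
  rw [← hn] at t2
  simp only [metric_diff_expand f y, secondForm_expand hκ hτ f N y]
  generalize chartBasis x p 0 0 = a at *
  generalize chartBasis x p 0 1 = b at *
  generalize chartBasis x p 1 0 = c at *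
  generalize chartBasis x p 1 1 = d at *
  generalize 2 * meanCurvature κ τ f N y = m at *
  generalize normSqA κ τ f N y = s at *
  generalize gramMatrix κ τ f y 0 0 = g00 at *
  generalize gramMatrix κ τ f y 0 1 = g01 at *
  generalize gramMatrix κ τ f y 1 1 = g11 at *
  generalize secondFormMatrix κ τ f N y 0 0 = b00 at *
  generalize secondFormMatrix κ τ f N y 0 1 = b01 at *
  generalize secondFormMatrix κ τ f N y 1 0 = b10 at *
  generalize secondFormMatrix κ τ f N y 1 1 = b11 at *
  constructor
  · linear_combination -(a * d - b * c) ^ 2 * t1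
  · linear_combination (a * d - b * c) ^ 4 * t2

theorem IsUnitNormalOn.localSurface {U : Set M} {H : ℝ} (hκ : 0 < κ) (hτ : τ ≠ 0)
    (hf : IsSmoothImmersion f) (hN : IsUnitNormalOn κ τ f U N)
    (hH : ∀ y ∈ U, meanCurvature κ τ f N y = H) (x : M) :
    LocalSurface κ τ H (chartDom x U) (chartImm f x) (chartField N x) where
  isOpen := isOpen_chartDom x hN.isOpen
  smooth := contDiffOn_chart (hf.contMDiff.contMDiffOn (s := U)) x
  smooth_normal := contDiffOn_chart hN.smooth x
  sphere p _ := by simp [chartImm]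
  tangent p hp := hN.tangent _ hp.2
  unit p hp := hN.unit _ hp.2
  normal p hp i := by
    rw [hf.pd_chartImm hp.1]
    exact hN.normal _ hp.2 _
  gramDet_pos p hp := hf.gramDet_chart_pos hκ hτ hp.1
  gram_pos p hp := by
    rw [hf.gramE_chart hp.1]
    refine hf.metric_diff_pos hκ hτ fun h => chartBasis_det_ne hp.1 ?_
    change chartBasis x p 0 = 0 at h
    rw [h]; simp
  mean p hp := by
    rw [(hN.trace_chart hκ hτ hf hp).1, hH _ hp.2]

theorem angle_eq_comp (κ τ : ℝ) (f : M → S3) (N : M → R4) (y : M) :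
    angle κ τ f N y = comp κ τ f N 2 y := metric_comm _ _ _ _ _

theorem normalComp_chart (κ τ : ℝ) (f : M → S3) (N : M → R4) (x : M) (k : Fin 3) (p : E2) :
    normalComp κ τ (chartImm f x) (chartField N x) k p =
      comp κ τ f N k ((extChartAt (𝓡 2) x).symm p) := rfl

end charts
end Berger

/-! ### Dependence on the choice of unit normal. -/

namespace Berger

open Set Filter

/-- Both n and n' are multiples of a × b, whose squared length is the Gram determinant D; since n is
a unit vector, n' is its projection onto n. -/
theorem normal_unique {a b n n' : Fin 3 → ℝ} (h : 0 < (a 0 * a 0 + a 1 * a 1 + a 2 * a 2) *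
      (b 0 * b 0 + b 1 * b 1 + b 2 * b 2) - (a 0 * b 0 + a 1 * b 1 + a 2 * b 2) *
      (a 0 * b 0 + a 1 * b 1 + a 2 * b 2))
    (han : a 0 * n 0 + a 1 * n 1 + a 2 * n 2 = 0) (hbn : b 0 * n 0 + b 1 * n 1 + b 2 * n 2 = 0)
    (han' : a 0 * n' 0 + a 1 * n' 1 + a 2 * n' 2 = 0)
    (hbn' : b 0 * n' 0 + b 1 * n' 1 + b 2 * n' 2 = 0)
    (hn : n 0 * n 0 + n 1 * n 1 + n 2 * n 2 = 1) (k : Fin 3) :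
    n' k = (n 0 * n' 0 + n 1 * n' 1 + n 2 * n' 2) * n k := by
  set D := (a 0 * a 0 + a 1 * a 1 + a 2 * a 2) * (b 0 * b 0 + b 1 * b 1 + b 2 * b 2)
    - (a 0 * b 0 + a 1 * b 1 + a 2 * b 2) * (a 0 * b 0 + a 1 * b 1 + a 2 * b 2) with hD
  set m0 := a 1 * b 2 - a 2 * b 1 with h0
  set m1 := a 2 * b 0 - a 0 * b 2 with h1
  set m2 := a 0 * b 1 - a 1 * b 0 with h2
  have hDm : D = m0 * m0 + m1 * m1 + m2 * m2 := by rw [hD, h0, h1, h2]; ring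
  have c0 : D * n 0 = (m0 * n 0 + m1 * n 1 + m2 * n 2) * m0 := by
    rw [hDm, h0, h1, h2]
    linear_combination -(((a 2 * b 0 - a 0 * b 2) * b 2 - (a 0 * b 1 - a 1 * b 0) * b 1) * han)
      + (((a 2 * b 0 - a 0 * b 2) * a 2 - (a 0 * b 1 - a 1 * b 0) * a 1) * hbn)
  have c1 : D * n 1 = (m0 * n 0 + m1 * n 1 + m2 * n 2) * m1 := by
    rw [hDm, h0, h1, h2]
    linear_combination -(((a 0 * b 1 - a 1 * b 0) * b 0 - (a 1 * b 2 - a 2 * b 1) * b 2) * han)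
      + (((a 0 * b 1 - a 1 * b 0) * a 0 - (a 1 * b 2 - a 2 * b 1) * a 2) * hbn)
  have c2 : D * n 2 = (m0 * n 0 + m1 * n 1 + m2 * n 2) * m2 := by
    rw [hDm, h0, h1, h2]
    linear_combination -(((a 1 * b 2 - a 2 * b 1) * b 1 - (a 2 * b 0 - a 0 * b 2) * b 0) * han)
      + (((a 1 * b 2 - a 2 * b 1) * a 1 - (a 2 * b 0 - a 0 * b 2) * a 0) * hbn)
  have d0 : D * n' 0 = (m0 * n' 0 + m1 * n' 1 + m2 * n' 2) * m0 := by
    rw [hDm, h0, h1, h2]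
    linear_combination -(((a 2 * b 0 - a 0 * b 2) * b 2 - (a 0 * b 1 - a 1 * b 0) * b 1) * han')
      + (((a 2 * b 0 - a 0 * b 2) * a 2 - (a 0 * b 1 - a 1 * b 0) * a 1) * hbn')
  have d1 : D * n' 1 = (m0 * n' 0 + m1 * n' 1 + m2 * n' 2) * m1 := by
    rw [hDm, h0, h1, h2]
    linear_combination -(((a 0 * b 1 - a 1 * b 0) * b 0 - (a 1 * b 2 - a 2 * b 1) * b 2) * han')
      + (((a 0 * b 1 - a 1 * b 0) * a 0 - (a 1 * b 2 - a 2 * b 1) * a 2) * hbn')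
  have d2 : D * n' 2 = (m0 * n' 0 + m1 * n' 1 + m2 * n' 2) * m2 := by
    rw [hDm, h0, h1, h2]
    linear_combination -(((a 1 * b 2 - a 2 * b 1) * b 1 - (a 2 * b 0 - a 0 * b 2) * b 0) * han')
      + (((a 1 * b 2 - a 2 * b 1) * a 1 - (a 2 * b 0 - a 0 * b 2) * a 0) * hbn')
  clear_value D m0 m1 m2
  set t := m0 * n 0 + m1 * n 1 + m2 * n 2 with ht
  set t' := m0 * n' 0 + m1 * n' 1 + m2 * n' 2 with ht'
  have ht2 : t * t = D := by
    have : D * D = t * t * D := by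
      calc D * D = (D * n 0) * (D * n 0) + (D * n 1) * (D * n 1) + (D * n 2) * (D * n 2) := by
            linear_combination -(D * D) * hn
        _ = t * t * D := by rw [c0, c1, c2, hDm]; ring
    exact (mul_right_cancel₀ h.ne' this).symm
  have hs : D * (n 0 * n' 0 + n 1 * n' 1 + n 2 * n' 2) = t * t' := by
    rw [ht']
    linear_combination n' 0 * c0 + n' 1 * c1 + n' 2 * c2
  have key : ∀ m x x' : ℝ, D * x = t * m → D * x' = t' * m →
      x' = (n 0 * n' 0 + n 1 * n' 1 + n 2 * n' 2) * x := by
    intro m x x' e e'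
    refine mul_left_cancel₀ (mul_ne_zero h.ne' h.ne') ?_
    linear_combination D * e' - D * x * hs - t * t' * e - t' * m * ht2
  fin_cases k
  · exact key m0 _ _ c0 d0
  · exact key m1 _ _ c1 d1
  · exact key m2 _ _ c2 d2

variable {M : Type*} [TopologicalSpace M] [ChartedSpace E2 M] {f : M → S3} {N N' : M → R4}
  {κ τ : ℝ} {U U' : Set M}

theorem IsUnitNormalOn.sum_sq_comp (hκ : 0 < κ) (hτ : τ ≠ 0) (hN : IsUnitNormalOn κ τ f U N)
    {y : M} (hy : y ∈ U) : comp κ τ f N 0 y * comp κ τ f N 0 y + comp κ τ f N 1 y * comp κ τ f N 1 y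
      + comp κ τ f N 2 y * comp κ τ f N 2 y = 1 := by
  rw [← hN.unit y hy]
  exact (metric_eq_sum hκ hτ _ (sphere_sum_sq _) (hN.tangent y hy)).symm

theorem IsUnitNormalOn.eq_smul (hκ : 0 < κ) (hτ : τ ≠ 0) (hf : IsSmoothImmersion f)
    (hN : IsUnitNormalOn κ τ f U N) (hN' : IsUnitNormalOn κ τ f U' N') {y : M} (hy : y ∈ U)
    (hy' : y ∈ U') : N' y = metric κ τ (f y) (N y) (N' y) • N y := by
  have hs := sphere_sum_sq (f y)
  have e := metric_eq_sum hκ hτ (N' y) hs (hN.tangent y hy)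
  have hp : 0 < metric κ τ (f y) (diff f y (basisVec y 0)) (diff f y (basisVec y 0)) *
      metric κ τ (f y) (diff f y (basisVec y 1)) (diff f y (basisVec y 1)) -
      metric κ τ (f y) (diff f y (basisVec y 0)) (diff f y (basisVec y 1)) *
      metric κ τ (f y) (diff f y (basisVec y 0)) (diff f y (basisVec y 1)) :=
    hf.gramMatrix_det_pos hκ hτ y (v := EuclideanSpace.single 0 1)
      (w := EuclideanSpace.single 1 1) (by simp)
  have ho : ∀ {W : Set M} {N : M → R4} (_ : IsUnitNormalOn κ τ f W N) (_ : y ∈ W)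
      (v : TangentSpace (𝓡 2) y),
      metric κ τ (f y) (diff f y v) (frame κ τ 0 (f y)) * comp κ τ f N 0 y
      + metric κ τ (f y) (diff f y v) (frame κ τ 1 (f y)) * comp κ τ f N 1 y
      + metric κ τ (f y) (diff f y v) (frame κ τ 2 (f y)) * comp κ τ f N 2 y = 0 := by
    intro W N hN hy v
    rw [← hN.normal y hy v, metric_comm κ τ _ (N y)]
    exact (metric_eq_sum hκ hτ _ hs (hf.inner_diff y v)).symm
  rw [metric_eq_sum hκ hτ (diff f y (basisVec y 0)) hs (hf.inner_diff y (basisVec y 0)),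
    metric_eq_sum hκ hτ (diff f y (basisVec y 1)) hs (hf.inner_diff y (basisVec y 1)),
    metric_eq_sum hκ hτ (diff f y (basisVec y 1)) hs (hf.inner_diff y (basisVec y 0))] at hp
  have hk := normal_unique (a := fun k => metric κ τ (f y) (diff f y (basisVec y 0))
      (frame κ τ k (f y))) (b := fun k => metric κ τ (f y) (diff f y (basisVec y 1))
      (frame κ τ k (f y))) (n := fun k => comp κ τ f N k y) (n' := fun k => comp κ τ f N' k y)
    hp (ho hN hy _) (ho hN hy _) (ho hN' hy' _) (ho hN' hy' _) (hN.sum_sq_comp hκ hτ hy)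
  have x1 := tangent_expand hκ hτ hs (hN.tangent y hy)
  have x2 := tangent_expand hκ hτ hs (hN'.tangent y hy')
  have k0 := hk 0
  have k1 := hk 1
  have k2 := hk 2
  simp only [comp] at k0 k1 k2
  rw [← e] at k0 k1 k2
  generalize metric κ τ (f y) (N y) (N' y) = s at *
  rw [k0, k1, k2] at x2
  have x3 := congrArg (fun v => s • v) x1
  simp only [smul_add, smul_smul] at x3
  rw [x2, x3]

/-- The factor between two unit normals is ±1 and continuous, hence locally constant. It therefore
passes through derivatives, and so to the second fundamental form. -/
theorem IsUnitNormalOn.eventually_smul (hκ : 0 < κ) (hτ : τ ≠ 0) (hf : IsSmoothImmersion f)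
    (hN : IsUnitNormalOn κ τ f U N) (hN' : IsUnitNormalOn κ τ f U' N') {y : M} (hy : y ∈ U)
    (hy' : y ∈ U') : ∃ s : ℝ, s * s = 1 ∧ ∀ᶠ z in nhds y, N' z = s • N z := by
  have h1 : ∀ z ∈ U, z ∈ U' → metric κ τ (f z) (N z) (N' z) * metric κ τ (f z) (N z) (N' z) = 1 := by
    intro z hz hz'
    have := hN'.unit z hz'
    rw [hN.eq_smul hκ hτ hf hN' hz hz'] at this
    rw [metric_smul_left, metric_smul_right, hN.unit z hz, mul_one] at this
    exact this
  have hc : ContinuousOn (fun z => metric κ τ (f z) (N z) (N' z)) (U ∩ U') := by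
    have a1 : ContinuousOn (fun z => (f z : R4)) (U ∩ U') := hf.contMDiff.continuous.continuousOn
    have a2 : ContinuousOn N (U ∩ U') := hN.smooth.continuousOn.mono inter_subset_left
    have a3 : ContinuousOn N' (U ∩ U') := hN'.smooth.continuousOn.mono inter_subset_right
    have a4 := hopfField_contDiff.continuous.comp_continuousOn a1
    exact continuousOn_const.mul ((a2.inner a3).add
      (continuousOn_const.mul ((a2.inner a4).mul (a3.inner a4))))
  have hm : U ∩ U' ∈ nhds y := (hN.isOpen.inter hN'.isOpen).mem_nhds ⟨hy, hy'⟩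
  have hca := hc.continuousAt hm
  refine ⟨metric κ τ (f y) (N y) (N' y), h1 y hy hy', ?_⟩
  have hpos : 0 < metric κ τ (f y) (N y) (N' y) * metric κ τ (f y) (N y) (N' y) := by
    rw [h1 y hy hy']; norm_num
  have hev := (continuousAt_const.mul hca : ContinuousAt (fun z => metric κ τ (f y) (N y) (N' y) *
    metric κ τ (f z) (N z) (N' z)) y).eventually (lt_mem_nhds hpos)
  filter_upwards [hm, hev] with z hz hz0
  rw [hN.eq_smul hκ hτ hf hN' hz.1 hz.2]
  have e1 := h1 y hy hy'
  have e2 := h1 z hz.1 hz.2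
  have hz1 : 0 < metric κ τ (f y) (N y) (N' y) * metric κ τ (f z) (N z) (N' z) := hz0
  clear hz0 hev
  congr 1
  generalize metric κ τ (f y) (N y) (N' y) = a at *
  generalize metric κ τ (f z) (N z) (N' z) = b at *
  have : (a * b - 1) * (a * b + 1) = 0 := by linear_combination b * b * e1 + e2
  rcases mul_eq_zero.1 this with h | h
  · linear_combination a * h - b * e1
  · linarith

theorem IsUnitNormalOn.comp_smul {s : ℝ} {y : M} (h : N' y = s • N y) (k : Fin 3) :
    comp κ τ f N' k y = s * comp κ τ f N k y := by
  rw [comp, h, metric_smul_left]; rfl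

section charts
variable [IsManifold (𝓡 2) ∞ M]

theorem IsUnitNormalOn.secondForm_smul (hκ : 0 < κ) (hτ : τ ≠ 0) (hf : IsSmoothImmersion f)
    (hN : IsUnitNormalOn κ τ f U N) {y : M} (hy : y ∈ U) {s : ℝ}
    (h : ∀ᶠ z in nhds y, N' z = s • N z) (v w : TangentSpace (𝓡 2) y) :
    secondForm κ τ f N' y v w = s * secondForm κ τ f N y v w := by
  have hd : ∀ k, dirDeriv (comp κ τ f N' k) y v = s * dirDeriv (comp κ τ f N k) y v := by
    intro k
    have e : comp κ τ f N' k =ᶠ[nhds y] s • comp κ τ f N k := by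
      filter_upwards [h] with z hz using IsUnitNormalOn.comp_smul hz k
    have hm : MDifferentiableAt (𝓡 2) 𝓘(ℝ, ℝ) (comp κ τ f N k) y :=
      ((hN.contMDiffOn_comp hf k).contMDiffAt (hN.isOpen.mem_nhds hy)).mdifferentiableAt (by simp)
    unfold dirDeriv
    rw [e.mfderiv_eq, const_smul_mfderiv hm]
    rfl
  have hc := fun k => IsUnitNormalOn.comp_smul (κ := κ) (τ := τ) (f := f) h.self_of_nhds k
  rw [secondForm_eq hκ hτ f N' y v w (fun k => rfl) (fun k => rfl) hc,
    secondForm_eq hκ hτ f N y v w (fun k => rfl) (fun k => rfl) fun k => rfl]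
  simp only [hd]
  ring

theorem IsUnitNormalOn.shapeMatrix_smul (hκ : 0 < κ) (hτ : τ ≠ 0) (hf : IsSmoothImmersion f)
    (hN : IsUnitNormalOn κ τ f U N) {y : M} (hy : y ∈ U) {s : ℝ}
    (h : ∀ᶠ z in nhds y, N' z = s • N z) :
    meanCurvature κ τ f N' y = s * meanCurvature κ τ f N y ∧
      normSqA κ τ f N' y = s * s * normSqA κ τ f N y := by
  have e : secondFormMatrix κ τ f N' y = s • secondFormMatrix κ τ f N y := by
    ext i j
    exact hN.secondForm_smul hκ hτ hf hy h _ _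
  have e2 : shapeMatrix κ τ f N' y = s • shapeMatrix κ τ f N y := by
    rw [shapeMatrix, e, Matrix.mul_smul]; rfl
  constructor
  · rw [meanCurvature, e2, Matrix.trace_smul, meanCurvature, smul_eq_mul]; ring
  · rw [normSqA, e2, Matrix.smul_mul, Matrix.mul_smul, Matrix.trace_smul, Matrix.trace_smul, normSqA,
      smul_eq_mul, smul_eq_mul]; ring

end charts
end Berger

/-! ### The Simons field as a global density. -/

namespace Berger

open Set Filter

theorem det_E2 (T : E2 →L[ℝ] E2) : T.det =
    T (EuclideanSpace.single 0 1) 0 * T (EuclideanSpace.single 1 1) 1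
      - T (EuclideanSpace.single 0 1) 1 * T (EuclideanSpace.single 1 1) 0 := by
  rw [ContinuousLinearMap.det, ← LinearMap.det_toMatrix (EuclideanSpace.basisFun (Fin 2) ℝ).toBasis,
    Matrix.det_fin_two]
  simp [LinearMap.toMatrix_apply]
  ring

variable {M : Type*} [TopologicalSpace M] [ChartedSpace E2 M] {f : M → S3} {κ τ H : ℝ}

/-- The Simons field times the area density, read in the chart at `x`. -/
def simonsDensity (κ τ : ℝ) (f : M → S3) (A HC : M → ℝ) (CN : Fin 3 → M → ℝ) (x : M) (p : E2) : E2 :=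
  !₂[√(gramDet κ τ (chartImm f x) p) * simonsField κ τ (chartImm f x)
      (fun q => A ((extChartAt (𝓡 2) x).symm q)) (fun q => HC ((extChartAt (𝓡 2) x).symm q))
      (fun k q => CN k ((extChartAt (𝓡 2) x).symm q)) 0 p,
    √(gramDet κ τ (chartImm f x) p) * simonsField κ τ (chartImm f x)
      (fun q => A ((extChartAt (𝓡 2) x).symm q)) (fun q => HC ((extChartAt (𝓡 2) x).symm q))
      (fun k q => CN k ((extChartAt (𝓡 2) x).symm q)) 1 p]

/-- `A`, `HC`, `CN` are the functions `|A|²`, `HC` and `CN`, for all unit normals of mean curvature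
`H`. -/
def IsNormalData (κ τ H : ℝ) (f : M → S3) (A HC : M → ℝ) (CN : Fin 3 → M → ℝ) : Prop :=
  ∀ (U : Set M) (N : M → R4), IsUnitNormalOn κ τ f U N → (∀ y ∈ U, meanCurvature κ τ f N y = H) →
    ∀ y ∈ U, A y = normSqA κ τ f N y ∧ HC y = H * comp κ τ f N 2 y ∧
      ∀ k, CN k y = comp κ τ f N 2 y * comp κ τ f N k y

section
variable [IsManifold (𝓡 2) ∞ M]

/-- If N' = sN and both normals have mean curvature H, then sH = H, so HC is unchanged; |A|² and CN
are unchanged because s² = 1. -/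
theorem IsCMC.exists_normalData (hκ : 0 < κ) (hτ : τ ≠ 0) (hf : IsSmoothImmersion f)
    (hH : IsCMC κ τ H f) : ∃ A HC CN, IsNormalData κ τ H f A HC CN := by
  choose U N hU hN hm using hH
  refine ⟨fun y => normSqA κ τ f (N y) y, fun y => H * comp κ τ f (N y) 2 y,
    fun k y => comp κ τ f (N y) 2 y * comp κ τ f (N y) k y, ?_⟩
  intro U' N' hN' hm' y hy
  obtain ⟨s, hs, hev⟩ := (hN y).eventually_smul hκ hτ hf hN' (hU y) hy
  obtain ⟨e1, e2⟩ := (hN y).shapeMatrix_smul hκ hτ hf (hU y) hev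
  have hc := fun k => IsUnitNormalOn.comp_smul (κ := κ) (τ := τ) (f := f) hev.self_of_nhds k
  rw [hm' y hy, hm y y (hU y)] at e1
  refine ⟨by rw [e2, hs, one_mul], ?_, fun k => ?_⟩
  · rw [hc, ← mul_assoc, mul_comm H s, ← e1]
  · rw [hc, hc]
    linear_combination (-(comp κ τ f (N y) 2 y * comp κ τ f (N y) k y)) * hs

/-- The covector and the Gram matrix transform tensorially under the Jacobian, so the dual vector is
pushed forward, while the square root of the Gram determinant contributes the absolute value of the
Jacobian determinant. -/
theorem IsSmoothImmersion.simonsDensity_transition (hκ : 0 < κ) (hτ : τ ≠ 0)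
    (hf : IsSmoothImmersion f) (A HC : M → ℝ) (CN : Fin 3 → M → ℝ) {x y : M} {p : E2}
    (hp : p ∈ overlap x y) (hA : DifferentiableAt ℝ (fun q => A ((extChartAt (𝓡 2) y).symm q))
      (transition x y p)) :
    fderiv ℝ (transition x y) p (simonsDensity κ τ f A HC CN x p) =
      |(fderiv ℝ (transition x y) p).det| • simonsDensity κ τ f A HC CN y (transition x y p) := by
  have hq := transition_mem hp
  have hFd : DifferentiableAt ℝ (chartImm f y) (transition x y p) :=
    ((contDiffOn_chart (hf.contMDiff.contMDiffOn (s := univ)) y).contDiffAt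
      ((isOpen_chartDom y isOpen_univ).mem_nhds ⟨hq.1, mem_univ _⟩)).differentiableAt (by simp)
  have hF : chartImm f x p = chartImm f y (transition x y p) := by
    rw [chartImm, chartImm, symm_transition hp]
  have eF : ∀ i, pd (chartImm f x) i p =
      (fderiv ℝ (transition x y) p (EuclideanSpace.single i 1) 0) • pd (chartImm f y) 0 (transition x y p)
      + (fderiv ℝ (transition x y) p (EuclideanSpace.single i 1) 1) •
        pd (chartImm f y) 1 (transition x y p) := fun i =>
    (fderiv_comp_symm (fun z => (f z : R4)) hp hFd _).trans (fderiv_eq_sum_pd _ _ _)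
  have eA : ∀ i, pd (fun q => A ((extChartAt (𝓡 2) x).symm q)) i p =
      (fderiv ℝ (transition x y) p (EuclideanSpace.single i 1) 0) •
        pd (fun q => A ((extChartAt (𝓡 2) y).symm q)) 0 (transition x y p)
      + (fderiv ℝ (transition x y) p (EuclideanSpace.single i 1) 1) •
        pd (fun q => A ((extChartAt (𝓡 2) y).symm q)) 1 (transition x y p) := fun i =>
    (fderiv_comp_symm A hp hA _).trans (fderiv_eq_sum_pd _ _ _)
  have hpos : 0 < gramDet κ τ (chartImm f x) p := hf.gramDet_chart_pos hκ hτ hp.1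
  have hpos' : 0 < gramDet κ τ (chartImm f y) (transition x y p) := hf.gramDet_chart_pos hκ hτ hq.1
  rw [fderiv_eq_sum_pd, det_E2]
  simp only [pd] at eF eA ⊢
  set T := fderiv ℝ (transition x y) p with hT
  set a := T (EuclideanSpace.single 0 1) 0 with ha
  set b := T (EuclideanSpace.single 0 1) 1 with hb
  set c := T (EuclideanSpace.single 1 1) 0 with hc
  set d := T (EuclideanSpace.single 1 1) 1 with hd
  have hG : ∀ i j, gramE κ τ (chartImm f x) i j p =
      T (EuclideanSpace.single i 1) 0 * T (EuclideanSpace.single j 1) 0 *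
        gramE κ τ (chartImm f y) 0 0 (transition x y p)
      + T (EuclideanSpace.single i 1) 0 * T (EuclideanSpace.single j 1) 1 *
        gramE κ τ (chartImm f y) 0 1 (transition x y p)
      + T (EuclideanSpace.single i 1) 1 * T (EuclideanSpace.single j 1) 0 *
        gramE κ τ (chartImm f y) 0 1 (transition x y p)
      + T (EuclideanSpace.single i 1) 1 * T (EuclideanSpace.single j 1) 1 *
        gramE κ τ (chartImm f y) 1 1 (transition x y p) := by
    intro i j
    simp only [gramE, pd]
    rw [eF, eF, hF]
    simp only [metric_add_left, metric_smul_left, metric_add_right, metric_smul_right]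
    rw [metric_comm κ τ _ (fderiv ℝ (chartImm f y) (transition x y p) (EuclideanSpace.single 1 1))
      (fderiv ℝ (chartImm f y) (transition x y p) (EuclideanSpace.single 0 1))]
    ring
  have hL : ∀ i, simonsCovector κ τ (chartImm f x) (fun q => A ((extChartAt (𝓡 2) x).symm q))
      (fun q => HC ((extChartAt (𝓡 2) x).symm q)) (fun k q => CN k ((extChartAt (𝓡 2) x).symm q)) i p =
      T (EuclideanSpace.single i 1) 0 * simonsCovector κ τ (chartImm f y)
        (fun q => A ((extChartAt (𝓡 2) y).symm q)) (fun q => HC ((extChartAt (𝓡 2) y).symm q))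
        (fun k q => CN k ((extChartAt (𝓡 2) y).symm q)) 0 (transition x y p)
      + T (EuclideanSpace.single i 1) 1 * simonsCovector κ τ (chartImm f y)
        (fun q => A ((extChartAt (𝓡 2) y).symm q)) (fun q => HC ((extChartAt (𝓡 2) y).symm q))
        (fun k q => CN k ((extChartAt (𝓡 2) y).symm q)) 1 (transition x y p) := by
    intro i
    simp only [simonsCovector, coframe, pd, symm_transition hp]
    rw [eA, eF, hF]
    simp only [metric_add_left, metric_smul_left, smul_eq_mul]
    ring
  have hDet : gramDet κ τ (chartImm f x) p =
      (a * d - b * c) ^ 2 * gramDet κ τ (chartImm f y) (transition x y p) := by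
    simp only [gramDet, hG, ← ha, ← hb, ← hc, ← hd]
    ring
  have hJ : a * d - b * c ≠ 0 := by
    intro h0
    rw [h0] at hDet
    simp [hDet] at hpos
  have hw : √(gramDet κ τ (chartImm f x) p) =
      |a * d - b * c| * √(gramDet κ τ (chartImm f y) (transition x y p)) := by
    rw [hDet, Real.sqrt_mul (sq_nonneg _), Real.sqrt_sq_eq_abs]
  ext i
  simp only [simonsDensity, simonsField, hw]
  simp only [hDet, hL, hG, ← ha, ← hb, ← hc, ← hd]
  fin_cases i
  · simp [← ha, ← hb, ← hc, ← hd]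
    field_simp
    ring
  · simp [← ha, ← hb, ← hc, ← hd]
    field_simp
    ring

end
end Berger

/-! ### The angle function vanishes. -/

namespace Berger

open Set Filter

namespace LocalSurface
variable {κ τ H : ℝ} {V : Set E2} {F ν : E2 → R4} {A HC : E2 → ℝ} {CN : Fin 3 → E2 → ℝ}

/-- If C² = 1 then N = ±ξ, so the ξ-components of ∂₁F and ∂₂F vanish identically. Their torsion
equation reduces to -2τ times the area of the horizontal components, which is then zero, although
its square is the Gram determinant. -/
theorem not_horizontal (h : LocalSurface κ τ H V F ν) (hκ : 0 < κ) (hτ : τ ≠ 0)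
    (hA : ∀ p ∈ V, gramDet κ τ F p ^ 2 * A p = normSqNum κ τ F ν p)
    (hHC : ∀ p ∈ V, HC p = H * normalComp κ τ F ν 2 p)
    (hCN : ∀ p ∈ V, ∀ k, CN k p = normalComp κ τ F ν 2 p * normalComp κ τ F ν k p)
    (h1 : ∀ p ∈ V, normalComp κ τ F ν 2 p * normalComp κ τ F ν 2 p = 1) {p : E2} (hp : p ∈ V) :
    False := by
  have hz : ∀ q ∈ V, ∀ i, coframe κ τ F i 2 q = 0 := by
    intro q hq i
    have hu := h.unit_eq hκ hτ hq
    have hn := h.normal_eq hκ hτ hq i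
    have h2 := h1 q hq
    rw [h2] at hu
    have n0 : normalComp κ τ F ν 0 q = 0 := by nlinarith
    have n1 : normalComp κ τ F ν 1 q = 0 := by nlinarith
    rw [n0, n1] at hn
    linear_combination normalComp κ τ F ν 2 q * hn - coframe κ τ F i 2 q * h2
  have hd : ∀ i j, pd (coframe κ τ F i 2) j p = 0 := by
    intro i j
    have : coframe κ τ F i 2 =ᶠ[nhds p] fun _ => 0 := by
      filter_upwards [h.isOpen.mem_nhds hp] with q hq using hz q hq i
    rw [pd, this.fderiv_eq]; simp
  have ht := (h.smooth_system hκ hτ hA hHC hCN).2.1 p hp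
  rw [hd, hd] at ht
  have hJ : coframe κ τ F 0 0 p * coframe κ τ F 1 1 p - coframe κ τ F 0 1 p * coframe κ τ F 1 0 p
      = 0 := by
    have : 2 * (-τ) ≠ 0 := by simpa using hτ
    refine (mul_eq_zero.1 (?_ : 2 * (-τ) * _ = 0)).resolve_left this
    linarith
  have hpos := h.gramDet_pos p hp
  rw [gramDet, h.gramE_eq hκ hτ hp, h.gramE_eq hκ hτ hp, h.gramE_eq hκ hτ hp, hz p hp, hz p hp] at hpos
  have := congrArg (fun t => t * t) hJ
  simp only [mul_zero] at this
  linarith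

/-- Every tangent vector is u times the horizontal unit vector (n₁, -n₀, 0) plus a multiple of ξ. In
this basis the second fundamental form has entries 2H, τ, 0. -/
theorem normSq_of_vertical (h : LocalSurface κ τ H V F ν) (hκ : 0 < κ) (hτ : τ ≠ 0)
    (hA : ∀ p ∈ V, gramDet κ τ F p ^ 2 * A p = normSqNum κ τ F ν p)
    (hHC : ∀ p ∈ V, HC p = H * normalComp κ τ F ν 2 p)
    (hCN : ∀ p ∈ V, ∀ k, CN k p = normalComp κ τ F ν 2 p * normalComp κ τ F ν k p)
    (h0 : ∀ p ∈ V, normalComp κ τ F ν 2 p = 0) {p : E2} (hp : p ∈ V) :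
    A p = 2 * (2 * H ^ 2 + τ ^ 2) := by
  have hn := (h.smooth_system hκ hτ hA hHC hCN).1 h0 p hp
  have hz := h0 p hp
  have hdz : ∀ i, pd (normalComp κ τ F ν 2) i p = 0 := by
    intro i
    have : normalComp κ τ F ν 2 =ᶠ[nhds p] fun _ => 0 := by
      filter_upwards [h.isOpen.mem_nhds hp] with q hq using h0 q hq
    rw [pd, this.fderiv_eq]; simp
  have hu := h.unit_eq hκ hτ hp
  have ha : ∀ i, ∃ u, coframe κ τ F i 0 p = u * normalComp κ τ F ν 1 p ∧
      coframe κ τ F i 1 p = -u * normalComp κ τ F ν 0 p := by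
    intro i
    have hi := h.normal_eq hκ hτ hp i
    rw [hz] at hi hu
    refine ⟨coframe κ τ F i 0 p * normalComp κ τ F ν 1 p - coframe κ τ F i 1 p * normalComp κ τ F ν 0 p,
      ?_, ?_⟩
    · linear_combination (-coframe κ τ F i 0 p) * hu + normalComp κ τ F ν 0 p * hi
    · linear_combination (-coframe κ τ F i 1 p) * hu + normalComp κ τ F ν 1 p * hi
  have hS : ∀ i j u v, coframe κ τ F i 0 p = u * normalComp κ τ F ν 1 p →
      coframe κ τ F i 1 p = -u * normalComp κ τ F ν 0 p →
      coframe κ τ F j 0 p = v * normalComp κ τ F ν 1 p →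
      coframe κ τ F j 1 p = -v * normalComp κ τ F ν 0 p →
      secE κ τ F ν i j p = 2 * H * u * v + τ * (coframe κ τ F i 2 p * v + u * coframe κ τ F j 2 p) := by
    intro i j u v e1 e2 e3 e4
    rw [secE, hdz, (hn i).1, (hn i).2, e1, e2, e3, e4, hz]
    rw [hz] at hu
    linear_combination (2 * H * u * v + τ * (coframe κ τ F i 2 p * v + u * coframe κ τ F j 2 p)) * hu
  have hG : ∀ i j u v, coframe κ τ F i 0 p = u * normalComp κ τ F ν 1 p →
      coframe κ τ F i 1 p = -u * normalComp κ τ F ν 0 p →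
      coframe κ τ F j 0 p = v * normalComp κ τ F ν 1 p →
      coframe κ τ F j 1 p = -v * normalComp κ τ F ν 0 p →
      gramE κ τ F i j p = u * v + coframe κ τ F i 2 p * coframe κ τ F j 2 p := by
    intro i j u v e1 e2 e3 e4
    rw [h.gramE_eq hκ hτ hp, e1, e2, e3, e4]
    rw [hz] at hu
    linear_combination u * v * hu
  obtain ⟨u, u0, u1⟩ := ha 0
  obtain ⟨v, v0, v1⟩ := ha 1
  have e := hA p hp
  have hpos := h.gramDet_pos p hp
  rw [normSqNum, gramDet, hG 0 0 u u u0 u1 u0 u1, hG 0 1 u v u0 u1 v0 v1, hG 1 1 v v v0 v1 v0 v1,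
    hS 0 0 u u u0 u1 u0 u1, hS 0 1 u v u0 u1 v0 v1, hS 1 0 v u v0 v1 u0 u1, hS 1 1 v v v0 v1 v0 v1] at e
  rw [gramDet, hG 0 0 u u u0 u1 u0 u1, hG 0 1 u v u0 u1 v0 v1, hG 1 1 v v v0 v1 v0 v1] at hpos
  refine mul_left_cancel₀ (pow_ne_zero 2 hpos.ne') (e.trans ?_)
  ring

end LocalSurface

variable {M : Type*} [TopologicalSpace M] [ChartedSpace E2 M] {f : M → S3} {κ τ H : ℝ}

section
variable [IsManifold (𝓡 2) ∞ M] {A HC : M → ℝ} {CN : Fin 3 → M → ℝ}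

theorem IsNormalData.chart (hκ : 0 < κ) (hτ : τ ≠ 0) (hf : IsSmoothImmersion f)
    (hD : IsNormalData κ τ H f A HC CN) {U : Set M} {N : M → R4} (hN : IsUnitNormalOn κ τ f U N)
    (hm : ∀ y ∈ U, meanCurvature κ τ f N y = H) (x : M) :
    (∀ p ∈ chartDom x U, gramDet κ τ (chartImm f x) p ^ 2 * A ((extChartAt (𝓡 2) x).symm p)
      = normSqNum κ τ (chartImm f x) (chartField N x) p) ∧
    (∀ p ∈ chartDom x U, HC ((extChartAt (𝓡 2) x).symm p) =
      H * normalComp κ τ (chartImm f x) (chartField N x) 2 p) ∧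
    (∀ p ∈ chartDom x U, ∀ k, CN k ((extChartAt (𝓡 2) x).symm p) =
      normalComp κ τ (chartImm f x) (chartField N x) 2 p
        * normalComp κ τ (chartImm f x) (chartField N x) k p) := by
  refine ⟨fun p hp => ?_, fun p hp => (hD U N hN hm _ hp.2).2.1, fun p hp => (hD U N hN hm _ hp.2).2.2⟩
  rw [(hD U N hN hm _ hp.2).1]
  exact (hN.trace_chart hκ hτ hf hp).2

theorem IsNormalData.contDiffOn_simonsDensity (hκ : 0 < κ) (hτ : τ ≠ 0) (hf : IsSmoothImmersion f)
    (hH : IsCMC κ τ H f) (hD : IsNormalData κ τ H f A HC CN) (x : M) :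
    ContDiffOn ℝ ∞ (simonsDensity κ τ f A HC CN x) (extChartAt (𝓡 2) x).target := by
  intro p hp
  obtain ⟨U, N, hU, hN, hm⟩ := hH ((extChartAt (𝓡 2) x).symm p)
  have hL := hN.localSurface hκ hτ hf hm x
  obtain ⟨h1, h2, h3⟩ := hD.chart hκ hτ hf hN hm x
  have hV : chartDom x U ∈ nhds p := hL.isOpen.mem_nhds ⟨hp, hU⟩
  refine ContDiffAt.contDiffWithinAt ?_
  rw [contDiffAt_euclidean]
  intro i
  fin_cases i
  · exact (hL.contDiffOn_simonsField h1 h2 h3 0).contDiffAt hV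
  · exact (hL.contDiffOn_simonsField h1 h2 h3 1).contDiffAt hV

theorem IsNormalData.differentiableAt (hκ : 0 < κ) (hτ : τ ≠ 0) (hf : IsSmoothImmersion f)
    (hH : IsCMC κ τ H f) (hD : IsNormalData κ τ H f A HC CN) (x : M) {p : E2}
    (hp : p ∈ (extChartAt (𝓡 2) x).target) :
    DifferentiableAt ℝ (fun q => A ((extChartAt (𝓡 2) x).symm q)) p := by
  obtain ⟨U, N, hU, hN, hm⟩ := hH ((extChartAt (𝓡 2) x).symm p)
  have hL := hN.localSurface hκ hτ hf hm x
  exact ((hL.contDiffOn_normSq (hD.chart hκ hτ hf hN hm x).1).contDiffAt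
    (hL.isOpen.mem_nhds ⟨hp, hU⟩)).differentiableAt (by simp)

theorem IsNormalData.continuous (hf : IsSmoothImmersion f)
    (hH : IsCMC κ τ H f) (hD : IsNormalData κ τ H f A HC CN) : Continuous (CN 2) := by
  rw [continuous_iff_continuousAt]
  intro y
  obtain ⟨U, N, hU, hN, hm⟩ := hH y
  have hc := ((hN.contMDiffOn_comp hf 2).continuousOn).continuousAt (hN.isOpen.mem_nhds hU)
  refine (hc.mul hc).congr ?_
  filter_upwards [hN.isOpen.mem_nhds hU] with z hz using ((hD U N hN hm z hz).2.2 2).symm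

/-- The hypothesis makes every term in the divergence of the Simons field nonnegative, so
compactness forces C²(1 - C²) = 0. The function CN 2 is C², defined on all of M. -/
theorem angle_eq_zero [CompactSpace M] [ConnectedSpace M] [T2Space M] (hτ : τ ≠ 0)
    (hκ : 4 * τ ^ 2 < κ) (hf : IsSmoothImmersion f) (hH : IsCMC κ τ H f)
    (hq : ∀ (U : Set M) (N : M → R4), IsUnitNormalOn κ τ f U N → ∀ y ∈ U,
      (normSqA κ τ f N y - 2 * H ^ 2) ^ 2 - quadB κ τ H (angle κ τ f N y)
        * (normSqA κ τ f N y - 2 * H ^ 2) + quadC κ τ H (angle κ τ f N y) ≤ 0) :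
    ∀ (U : Set M) (N : M → R4), IsUnitNormalOn κ τ f U N → ∀ y ∈ U, comp κ τ f N 2 y = 0 ∧
      normSqA κ τ f N y = 2 * (2 * H ^ 2 + τ ^ 2) := by
  have hκ0 : 0 < κ := by nlinarith [sq_nonneg τ]
  obtain ⟨A, HC, CN, hD⟩ := hH.exists_normalData hκ0 hτ hf
  have hsq : ∀ (U : Set M) (N : M → R4), IsUnitNormalOn κ τ f U N → ∀ y ∈ U,
      comp κ τ f N 2 y ^ 2 ≤ 1 := by
    intro U N hN y hy
    nlinarith [hN.sum_sq_comp hκ0 hτ hy, sq_nonneg (comp κ τ f N 0 y), sq_nonneg (comp κ τ f N 1 y)]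
  have key : ∀ x, ∀ p ∈ (extChartAt (𝓡 2) x).target, ∃ P Q R w, 0 < w ∧ R ≤ 0 ∧
      CN 2 ((extChartAt (𝓡 2) x).symm p) ≤ 1 ∧ 0 ≤ CN 2 ((extChartAt (𝓡 2) x).symm p) ∧
      pd (fun q => simonsDensity κ τ f A HC CN x q 0) 0 p
        + pd (fun q => simonsDensity κ τ f A HC CN x q 1) 1 p
      = 2 * w * ((κ - 4 * τ ^ 2) ^ 2 * (CN 2 ((extChartAt (𝓡 2) x).symm p)
        * (1 - CN 2 ((extChartAt (𝓡 2) x).symm p))) - R + P ^ 2 + Q ^ 2) := by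
    intro x p hp
    obtain ⟨U, N, hU, hN, hm⟩ := hH ((extChartAt (𝓡 2) x).symm p)
    have hL := hN.localSurface hκ0 hτ hf hm x
    obtain ⟨h1, h2, h3⟩ := hD.chart hκ0 hτ hf hN hm x
    obtain ⟨P, Q, hPQ⟩ := hL.exists_divergence_eq hκ0 hτ h1 h2 h3 (p := p) ⟨hp, hU⟩
    have hc := (hD U N hN hm _ hU).2.2 2
    have hR := hq U N hN _ hU
    rw [angle_eq_comp, ← (hD U N hN hm _ hU).1] at hR
    have h5 := hsq U N hN _ hU
    refine ⟨P, Q, _, _, Real.sqrt_pos.2 (hL.gramDet_pos p ⟨hp, hU⟩), hR, ?_, ?_, ?_⟩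
    · rw [hc]; linarith
    · rw [hc]; exact mul_self_nonneg _
    · rw [hc, ← pow_two]
      exact hPQ
  have hdiv : ∀ x, ∀ p ∈ (extChartAt (𝓡 2) x).target,
      0 ≤ pd (fun q => simonsDensity κ τ f A HC CN x q 0) 0 p
        + pd (fun q => simonsDensity κ τ f A HC CN x q 1) 1 p := by
    intro x p hp
    obtain ⟨P, Q, R, w, hw, hR, hc1, hc0, e⟩ := key x p hp
    rw [e]
    have := mul_nonneg hc0 (sub_nonneg.2 hc1)
    have : 0 ≤ -R := by linarith
    have e2 : (κ - 4 * τ ^ 2) ^ 2 * (CN 2 ((extChartAt (𝓡 2) x).symm p)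
        * (1 - CN 2 ((extChartAt (𝓡 2) x).symm p))) - R + P ^ 2 + Q ^ 2 =
      (κ - 4 * τ ^ 2) ^ 2 * (CN 2 ((extChartAt (𝓡 2) x).symm p)
        * (1 - CN 2 ((extChartAt (𝓡 2) x).symm p))) + -R + P ^ 2 + Q ^ 2 := by ring
    rw [e2]
    positivity
  have h01 : ∀ y, CN 2 y * (1 - CN 2 y) = 0 := by
    intro y
    obtain ⟨x, hx, h0⟩ := divergence_eq_zero
      (fun x => hD.contDiffOn_simonsDensity hκ0 hτ hf hH x)
      (fun x y p hp => hf.simonsDensity_transition hκ0 hτ A HC CN hp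
        (hD.differentiableAt hκ0 hτ hf hH y (transition_mem hp).1)) hdiv y
    obtain ⟨P, Q, R, w, hw, hR, hc1, hc0, e⟩ := key x _ ((extChartAt (𝓡 2) x).map_source hx)
    rw [(extChartAt (𝓡 2) x).left_inv hx] at hc1 hc0 e
    rw [e] at h0
    have h6 := (mul_eq_zero.1 h0).resolve_left (by positivity)
    have h7 := mul_nonneg hc0 (sub_nonneg.2 hc1)
    have h8 : 0 < (κ - 4 * τ ^ 2) ^ 2 := pow_pos (by linarith) 2
    by_contra hne
    have h9 := mul_pos h8 (lt_of_le_of_ne h7 (Ne.symm hne))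
    nlinarith [sq_nonneg P, sq_nonneg Q]
  have hcont := hD.continuous hf hH
  have hclopen : IsClopen {y | CN 2 y = 0} := by
    refine ⟨isClosed_eq hcont continuous_const, ?_⟩
    -- C² takes only the values 0 and 1, so its zero set is open as well as closed.
    have : {y | CN 2 y = 0} = {y | CN 2 y < 1} := by
      ext y
      simp only [mem_ofPred_eq]
      constructor
      · intro h; rw [h]; norm_num
      · intro h
        rcases mul_eq_zero.1 (h01 y) with h2 | h2
        · exact h2
        · linarith
    rw [this]
    exact isOpen_lt hcont continuous_const
  have hC : ∀ y, CN 2 y = 0 := by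
    rcases isClopen_iff.1 hclopen with h | h
    · exfalso
      obtain ⟨y⟩ := (inferInstance : Nonempty M)
      obtain ⟨U, N, hU, hN, hm⟩ := hH y
      have hL := hN.localSurface hκ0 hτ hf hm y
      obtain ⟨h1, h2, h3⟩ := hD.chart hκ0 hτ hf hN hm y
      refine hL.not_horizontal hκ0 hτ h1 h2 h3 (fun p hp => ?_) (p := extChartAt (𝓡 2) y y)
        ⟨mem_extChartAt_target y, by rwa [mem_preimage, extChartAt_to_inv]⟩
      rw [← h3 p hp 2]
      rcases mul_eq_zero.1 (h01 ((extChartAt (𝓡 2) y).symm p)) with h5 | h5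
      · have h6 : (extChartAt (𝓡 2) y).symm p ∈ {y | CN 2 y = 0} := h5
        rw [h] at h6
        exact absurd h6 (notMem_empty _)
      · linarith
    · intro y
      have h6 : y ∈ {y | CN 2 y = 0} := by rw [h]; exact mem_univ y
      exact h6
  intro U' N' hN' y hy'
  obtain ⟨U, N, hU, hN, hm⟩ := hH y
  obtain ⟨s, hs, hev⟩ := hN.eventually_smul hκ0 hτ hf hN' hU hy'
  have hz : ∀ z ∈ U, comp κ τ f N 2 z = 0 := fun z hz =>
    mul_self_eq_zero.1 (((hD U N hN hm z hz).2.2 2).symm.trans (hC z))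
  refine ⟨by rw [IsUnitNormalOn.comp_smul hev.self_of_nhds, hz y hU, mul_zero], ?_⟩
  rw [(hN.shapeMatrix_smul hκ0 hτ hf hU hev).2, hs, one_mul, ← (hD U N hN hm y hU).1]
  have hL := hN.localSurface hκ0 hτ hf hm y
  obtain ⟨h1, h2, h3⟩ := hD.chart hκ0 hτ hf hN hm y
  have := hL.normSq_of_vertical hκ0 hτ h1 h2 h3 (fun p hp => hz _ hp.2) (p := extChartAt (𝓡 2) y y)
    ⟨mem_extChartAt_target y, by rwa [mem_preimage, extChartAt_to_inv]⟩
  rwa [extChartAt_to_inv] at this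

end
end Berger

/-! ### Tori over circles, and surfaces immersed in them. -/

namespace Berger

open Set Filter

/-- An orthonormal basis of `ℂ²` over `ℝ`, adapted to the Hopf fibration, with first vector `u`. -/
def hopfBasis (u : R4) (k : Fin 4) : R4 :=
  match k with
  | 0 => u
  | 1 => hopfField u
  | 2 => !₂[-u 2, u 3, u 0, -u 1]
  | 3 => !₂[-u 3, -u 2, u 1, u 0]

theorem inner_hopfBasis (u q : R4) :
    inner ℝ (hopfBasis u 0) q = u 0 * q 0 + u 1 * q 1 + u 2 * q 2 + u 3 * q 3 ∧
    inner ℝ (hopfBasis u 1) q = -u 1 * q 0 + u 0 * q 1 - u 3 * q 2 + u 2 * q 3 ∧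
    inner ℝ (hopfBasis u 2) q = -u 2 * q 0 + u 3 * q 1 + u 0 * q 2 - u 1 * q 3 ∧
    inner ℝ (hopfBasis u 3) q = -u 3 * q 0 - u 2 * q 1 + u 1 * q 2 + u 0 * q 3 := by
  refine ⟨?_, ?_, ?_, ?_⟩ <;> rw [inner_R4] <;> simp [hopfBasis, hopfField] <;> ring

theorem hopfBasis_expand {u : R4} (hu : u 0 ^ 2 + u 1 ^ 2 + u 2 ^ 2 + u 3 ^ 2 = 1) (q : R4) :
    q = inner ℝ (hopfBasis u 0) q • hopfBasis u 0 + inner ℝ (hopfBasis u 1) q • hopfBasis u 1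
      + inner ℝ (hopfBasis u 2) q • hopfBasis u 2 + inner ℝ (hopfBasis u 3) q • hopfBasis u 3 := by
  obtain ⟨h0, h1, h2, h3⟩ := inner_hopfBasis u q
  rw [h0, h1, h2, h3]
  ext k
  fin_cases k <;> simp [hopfBasis, hopfField]
  · linear_combination -q 0 * hu
  · linear_combination -q 1 * hu
  · linear_combination -q 2 * hu
  · linear_combination -q 3 * hu

/-- The tori that project onto the circles around the projection of `u`. -/
def torus (u : R4) (a c : ℝ) (x : ℝ × ℝ) : R4 :=
  (a * Real.cos x.1) • hopfBasis u 0 + (a * Real.sin x.1) • hopfBasis u 1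
    + (c * Real.cos x.2) • hopfBasis u 2 + (c * Real.sin x.2) • hopfBasis u 3

theorem torus_coord (u : R4) (a c : ℝ) (x : ℝ × ℝ) :
    torus u a c x 0 = a * Real.cos x.1 * u 0 - a * Real.sin x.1 * u 1 - c * Real.cos x.2 * u 2
      - c * Real.sin x.2 * u 3 ∧
    torus u a c x 1 = a * Real.cos x.1 * u 1 + a * Real.sin x.1 * u 0 + c * Real.cos x.2 * u 3
      - c * Real.sin x.2 * u 2 ∧
    torus u a c x 2 = a * Real.cos x.1 * u 2 - a * Real.sin x.1 * u 3 + c * Real.cos x.2 * u 0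
      + c * Real.sin x.2 * u 1 ∧
    torus u a c x 3 = a * Real.cos x.1 * u 3 + a * Real.sin x.1 * u 2 - c * Real.cos x.2 * u 1
      + c * Real.sin x.2 * u 0 := by
  refine ⟨?_, ?_, ?_, ?_⟩ <;> simp [torus, hopfBasis, hopfField] <;> ring

theorem continuous_torus (u : R4) (a c : ℝ) : Continuous (torus u a c) := by
  unfold torus
  fun_prop

theorem exists_angle {a x y : ℝ} (ha : 0 < a) (h : x ^ 2 + y ^ 2 = a ^ 2) :
    ∃ t : ℝ, x = a * Real.cos t ∧ y = a * Real.sin t := by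
  have hn : ‖(⟨x, y⟩ : ℂ)‖ = a := by
    rw [Complex.norm_def, Complex.normSq_mk, ← pow_two, ← pow_two, h, Real.sqrt_sq ha.le]
  refine ⟨Complex.arg ⟨x, y⟩, ?_, ?_⟩
  · have := Complex.norm_mul_cos_arg (⟨x, y⟩ : ℂ)
    rw [hn] at this; exact this.symm
  · have := Complex.norm_mul_sin_arg (⟨x, y⟩ : ℂ)
    rw [hn] at this; exact this.symm

theorem exists_torus {u : R4} (hu : u 0 ^ 2 + u 1 ^ 2 + u 2 ^ 2 + u 3 ^ 2 = 1) {a c : ℝ} (ha : 0 < a)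
    (hc : 0 < c) {q : R4} (h1 : inner ℝ (hopfBasis u 0) q ^ 2 + inner ℝ (hopfBasis u 1) q ^ 2 = a ^ 2)
    (h2 : inner ℝ (hopfBasis u 2) q ^ 2 + inner ℝ (hopfBasis u 3) q ^ 2 = c ^ 2) :
    ∃ x, torus u a c x = q := by
  obtain ⟨s, s0, s1⟩ := exists_angle ha h1
  obtain ⟨t, t0, t1⟩ := exists_angle hc h2
  refine ⟨(s, t), ?_⟩
  rw [torus, ← s0, ← s1, ← t0, ← t1]
  exact (hopfBasis_expand hu q).symm

/-- The circle equation leaves x = ±a cos(t - s), and positivity selects the sign. -/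
theorem eq_of_sq_add_sq {a x y t s : ℝ} (hx : 0 < x) (ha : 0 < a) (h : x ^ 2 + y ^ 2 = a ^ 2)
    (hy : y = a * Real.sin (t - s)) (hc : 0 < Real.cos (t - s)) : x = a * Real.cos (t - s) := by
  have h1 := Real.sin_sq_add_cos_sq (t - s)
  have h2 : (x - a * Real.cos (t - s)) * (x + a * Real.cos (t - s)) = 0 := by
    rw [hy] at h; linear_combination h - a ^ 2 * h1
  rcases mul_eq_zero.1 h2 with h3 | h3
  · linarith
  · nlinarith [mul_pos ha hc]

variable {M : Type*} [TopologicalSpace M] [ChartedSpace E2 M] [IsManifold (𝓡 2) ∞ M] {f : M → S3}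

/-- An immersion of a surface into a torus is an open map, here by the inverse function theorem in
two sine coordinates of the torus. -/
theorem IsSmoothImmersion.torus_mem_nhds (hf : IsSmoothImmersion f) {u : R4}
    (hu : u 0 ^ 2 + u 1 ^ 2 + u 2 ^ 2 + u 3 ^ 2 = 1) {a c : ℝ} (ha : 0 < a) (hc : 0 < c)
    (h1 : ∀ y, inner ℝ (hopfBasis u 0) (f y : R4) ^ 2 + inner ℝ (hopfBasis u 1) (f y : R4) ^ 2 = a ^ 2)
    (h2 : ∀ y, inner ℝ (hopfBasis u 2) (f y : R4) ^ 2 + inner ℝ (hopfBasis u 3) (f y : R4) ^ 2 = c ^ 2)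
    {x₀ : ℝ × ℝ} {y : M} (hy : (f y : R4) = torus u a c x₀) :
    ∀ᶠ x in nhds x₀, ∃ z, (f z : R4) = torus u a c x := by
  -- C + iS and C' + iS' are the complex coordinates along u and along the second basis vector,
  -- rotated back by the angles x₀; at f y they equal a and c. Near that point S and S' are
  -- coordinates on the torus.
  set C : R4 →L[ℝ] ℝ := Real.cos x₀.1 • innerSL ℝ (hopfBasis u 0) + Real.sin x₀.1 • innerSL ℝ (hopfBasis u 1)
    with hC
  set S : R4 →L[ℝ] ℝ := Real.cos x₀.1 • innerSL ℝ (hopfBasis u 1) - Real.sin x₀.1 • innerSL ℝ (hopfBasis u 0)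
    with hS
  set C' : R4 →L[ℝ] ℝ := Real.cos x₀.2 • innerSL ℝ (hopfBasis u 2) + Real.sin x₀.2 • innerSL ℝ (hopfBasis u 3)
    with hC'
  set S' : R4 →L[ℝ] ℝ := Real.cos x₀.2 • innerSL ℝ (hopfBasis u 3) - Real.sin x₀.2 • innerSL ℝ (hopfBasis u 2)
    with hS'
  have cC : ∀ q, C q = Real.cos x₀.1 * inner ℝ (hopfBasis u 0) q + Real.sin x₀.1 * inner ℝ (hopfBasis u 1) q :=
    fun q => rfl
  have cS : ∀ q, S q = Real.cos x₀.1 * inner ℝ (hopfBasis u 1) q - Real.sin x₀.1 * inner ℝ (hopfBasis u 0) q :=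
    fun q => rfl
  have cC' : ∀ q, C' q = Real.cos x₀.2 * inner ℝ (hopfBasis u 2) q + Real.sin x₀.2 * inner ℝ (hopfBasis u 3) q :=
    fun q => rfl
  have cS' : ∀ q, S' q = Real.cos x₀.2 * inner ℝ (hopfBasis u 3) q - Real.sin x₀.2 * inner ℝ (hopfBasis u 2) q :=
    fun q => rfl
  have p1 := Real.sin_sq_add_cos_sq x₀.1
  have p2 := Real.sin_sq_add_cos_sq x₀.2
  have sq1 : ∀ z, C (f z) ^ 2 + S (f z) ^ 2 = a ^ 2 := by
    intro z; rw [cC, cS]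
    linear_combination h1 z + (inner ℝ (hopfBasis u 0) (f z : R4) ^ 2
      + inner ℝ (hopfBasis u 1) (f z : R4) ^ 2) * p1
  have sq2 : ∀ z, C' (f z) ^ 2 + S' (f z) ^ 2 = c ^ 2 := by
    intro z; rw [cC', cS']
    linear_combination h2 z + (inner ℝ (hopfBasis u 2) (f z : R4) ^ 2
      + inner ℝ (hopfBasis u 3) (f z : R4) ^ 2) * p2
  have inv1 : ∀ q, inner ℝ (hopfBasis u 0) q = Real.cos x₀.1 * C q - Real.sin x₀.1 * S q ∧
      inner ℝ (hopfBasis u 1) q = Real.sin x₀.1 * C q + Real.cos x₀.1 * S q := by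
    intro q; rw [cC, cS]
    constructor
    · linear_combination -inner ℝ (hopfBasis u 0) q * p1
    · linear_combination -inner ℝ (hopfBasis u 1) q * p1
  have inv2 : ∀ q, inner ℝ (hopfBasis u 2) q = Real.cos x₀.2 * C' q - Real.sin x₀.2 * S' q ∧
      inner ℝ (hopfBasis u 3) q = Real.sin x₀.2 * C' q + Real.cos x₀.2 * S' q := by
    intro q; rw [cC', cS']
    constructor
    · linear_combination -inner ℝ (hopfBasis u 2) q * p2
    · linear_combination -inner ℝ (hopfBasis u 3) q * p2
  have hT : ∀ x, inner ℝ (hopfBasis u 0) (torus u a c x) = a * Real.cos x.1 ∧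
      inner ℝ (hopfBasis u 1) (torus u a c x) = a * Real.sin x.1 ∧
      inner ℝ (hopfBasis u 2) (torus u a c x) = c * Real.cos x.2 ∧
      inner ℝ (hopfBasis u 3) (torus u a c x) = c * Real.sin x.2 := by
    intro x
    obtain ⟨i0, i1, i2, i3⟩ := inner_hopfBasis u (torus u a c x)
    obtain ⟨t0, t1, t2, t3⟩ := torus_coord u a c x
    rw [i0, i1, i2, i3, t0, t1, t2, t3]
    refine ⟨?_, ?_, ?_, ?_⟩
    · linear_combination a * Real.cos x.1 * hu
    · linear_combination a * Real.sin x.1 * hu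
    · linear_combination c * Real.cos x.2 * hu
    · linear_combination c * Real.sin x.2 * hu
  obtain ⟨b0, b1, b2, b3⟩ := hT x₀
  rw [← hy] at b0 b1 b2 b3
  have v1 : C (f y) = a := by rw [cC, b0, b1]; linear_combination a * p1
  have v2 : S (f y) = 0 := by rw [cS, b0, b1]; ring
  have v3 : C' (f y) = c := by rw [cC', b2, b3]; linear_combination c * p2
  have v4 : S' (f y) = 0 := by rw [cS', b2, b3]; ring
  set F := chartImm f y with hFdef
  set p := extChartAt (𝓡 2) y y with hp
  have hFp : F p = f y := by simp only [hFdef, chartImm, hp, extChartAt_to_inv]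
  have hV : (extChartAt (𝓡 2) y).target ∈ nhds p := extChartAt_target_mem_nhds y
  have hFs : ContDiffAt ℝ ∞ F p :=
    (contDiffOn_chart (hf.contMDiff.contMDiffOn (s := univ)) y).contDiffAt
      ((isOpen_chartDom y isOpen_univ).mem_nhds ⟨mem_extChartAt_target y, mem_univ _⟩)
  have hFd : DifferentiableAt ℝ F p := hFs.differentiableAt (by simp)
  let G : E2 → E2 := fun q => !₂[S (F q), S' (F q)]
  have hGs : ContDiffAt ℝ 1 G p := by
    rw [contDiffAt_euclidean]
    intro i
    have h3 := hFs.of_le (m := 1) (by simp)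
    fin_cases i
    · exact S.contDiff.contDiffAt.comp p h3
    · exact S'.contDiff.contDiffAt.comp p h3
  have hG0 : G p = 0 := by
    ext i; fin_cases i
    · simp [G, hFp, v2]
    · simp [G, hFp, v4]
  have hGd := hGs.hasStrictFDerivAt (by simp)
  have dlin : ∀ (T : R4 →L[ℝ] ℝ) v, fderiv ℝ (fun q => T (F q)) p v = T (fderiv ℝ F p v) := fun T v => by
    have := (T.hasFDerivAt.comp p hFd.hasFDerivAt).fderiv
    exact congrArg (fun L : E2 →L[ℝ] ℝ => L v) this
  -- At p, where S = 0 and C = a ≠ 0, differentiating C² + S² = a² gives dC = 0, and likewise dC' =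
  -- 0. If dS and dS' also kill v, then dF(v) = 0, and the immersion forces v = 0.
  have hinj : Function.Injective (fderiv ℝ G p) := by
    rw [injective_iff_map_eq_zero]
    intro v hv
    have hGf := hGd.hasFDerivAt
    have hcomp : ∀ i, fderiv ℝ (fun q => G q i) p v = fderiv ℝ G p v i := by
      intro i
      have := ((EuclideanSpace.proj i : E2 →L[ℝ] ℝ).hasFDerivAt.comp p hGf).fderiv
      exact congrArg (fun L : E2 →L[ℝ] ℝ => L v) this
    have s1 : S (fderiv ℝ F p v) = 0 := by
      rw [← dlin S v]; exact (hcomp 0).trans (by rw [hv]; rfl)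
    have s2 : S' (fderiv ℝ F p v) = 0 := by
      rw [← dlin S' v]; exact (hcomp 1).trans (by rw [hv]; rfl)
    have dsq : ∀ (T T' : R4 →L[ℝ] ℝ) (r : ℝ), (∀ z, T (f z) ^ 2 + T' (f z) ^ 2 = r ^ 2) → T (f y) = r →
        T' (f y) = 0 → 0 < r → T (fderiv ℝ F p v) = 0 := by
      intro T T' r hr e1 e2 hr0
      have e3 : (fun q => T (F q) * T (F q) + T' (F q) * T' (F q)) = fun _ => r ^ 2 := by
        funext q
        rw [← hr ((extChartAt (𝓡 2) y).symm q)]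
        simp only [hFdef, chartImm]; ring
      have d1 : DifferentiableAt ℝ (fun q => T (F q)) p := T.differentiableAt.comp p hFd
      have d2 : DifferentiableAt ℝ (fun q => T' (F q)) p := T'.differentiableAt.comp p hFd
      have e4 := congrArg (fun L : E2 →L[ℝ] ℝ => L v)
        ((d1.hasFDerivAt.mul d1.hasFDerivAt).add (d2.hasFDerivAt.mul d2.hasFDerivAt)).fderiv
      have e5 : fderiv ℝ (fun q => T (F q) * T (F q) + T' (F q) * T' (F q)) p v = 0 := by
        rw [e3]; simp
      have e6 : T (F p) * fderiv ℝ (fun q => T (F q)) p v + T (F p) * fderiv ℝ (fun q => T (F q)) p v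
        + (T' (F p) * fderiv ℝ (fun q => T' (F q)) p v + T' (F p) * fderiv ℝ (fun q => T' (F q)) p v)
        = 0 := e4.symm.trans e5
      rw [hFp, e1, e2, dlin] at e6
      have : r * T (fderiv ℝ F p v) = 0 := by linarith
      exact (mul_eq_zero.1 this).resolve_left hr0.ne'
    have s3 := dsq C S a sq1 v1 v2 ha
    have s4 := dsq C' S' c sq2 v3 v4 hc
    have hz : fderiv ℝ F p v = 0 := by
      rw [hopfBasis_expand hu (fderiv ℝ F p v), (inv1 _).1, (inv1 _).2, (inv2 _).1, (inv2 _).2,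
        s1, s2, s3, s4]
      simp
    have hm := (mfderiv_eq_fderiv_symm (hf.mdifferentiableAt y) v).2
    refine hf.diff_injective y (?_ : diff f y v = diff f y (0 : E2))
    exact (hm.trans hz).trans (map_zero (mfderiv (𝓡 2) 𝓘(ℝ, R4) (fun y => (f y : R4)) y)).symm
  have hsurj : LinearMap.range (fderiv ℝ G p : E2 →ₗ[ℝ] E2) = ⊤ :=
    LinearMap.range_eq_top.2 (LinearMap.injective_iff_surjective.1 hinj)
  have hmap := hGd.map_nhds_eq_of_surj hsurj
  have hW : {q | 0 < C (F q) ∧ 0 < C' (F q)} ∈ nhds p := by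
    have c1 : ContinuousAt (fun q => C (F q)) p := C.continuous.continuousAt.comp hFs.continuousAt
    have c2 : ContinuousAt (fun q => C' (F q)) p := C'.continuous.continuousAt.comp hFs.continuousAt
    exact (c1.eventually (lt_mem_nhds (by change 0 < C (F p); rw [hFp, v1]; exact ha))).and
      (c2.eventually (lt_mem_nhds (by change 0 < C' (F p); rw [hFp, v3]; exact hc)))
  have himg := image_mem_map (m := G) hW
  rw [hmap, hG0] at himg
  -- These are the values of S and S' at the torus point x. They tend to 0 = G p, so for x near x₀
  -- they are attained by G at a point where C and C' are positive, and such a point has the same C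
  -- and C' as x.
  have hK : Tendsto (fun x : ℝ × ℝ => (!₂[a * Real.sin (x.1 - x₀.1), c * Real.sin (x.2 - x₀.2)] : E2))
      (nhds x₀) (nhds 0) := by
    have : Continuous (fun x : ℝ × ℝ =>
        (!₂[a * Real.sin (x.1 - x₀.1), c * Real.sin (x.2 - x₀.2)] : E2)) := by
      rw [← continuousOn_univ]
      refine (PiLp.continuous_toLp 2 _).comp_continuousOn ?_
      rw [continuousOn_univ]
      refine continuous_pi fun i => ?_
      fin_cases i <;> simp <;> fun_prop
    convert this.tendsto x₀ using 2
    ext i; fin_cases i <;> simp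
  have hcos1 : ∀ᶠ x : ℝ × ℝ in nhds x₀, 0 < Real.cos (x.1 - x₀.1) := by
    have : Continuous (fun x : ℝ × ℝ => Real.cos (x.1 - x₀.1)) := by fun_prop
    exact this.continuousAt.eventually (lt_mem_nhds (by simp))
  have hcos2 : ∀ᶠ x : ℝ × ℝ in nhds x₀, 0 < Real.cos (x.2 - x₀.2) := by
    have : Continuous (fun x : ℝ × ℝ => Real.cos (x.2 - x₀.2)) := by fun_prop
    exact this.continuousAt.eventually (lt_mem_nhds (by simp))
  filter_upwards [hK himg, hcos1, hcos2] with x hx hx1 hx2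
  obtain ⟨q, ⟨q1, q2⟩, hq⟩ := hx
  refine ⟨(extChartAt (𝓡 2) y).symm q, ?_⟩
  have g1 : S (F q) = a * Real.sin (x.1 - x₀.1) := congrArg (fun v : E2 => v 0) hq
  have g2 : S' (F q) = c * Real.sin (x.2 - x₀.2) := congrArg (fun v : E2 => v 1) hq
  have g3 := eq_of_sq_add_sq q1 ha (sq1 ((extChartAt (𝓡 2) y).symm q)) g1 hx1
  have g4 := eq_of_sq_add_sq q2 hc (sq2 ((extChartAt (𝓡 2) y).symm q)) g2 hx2
  change F q = _
  have e1 : x.1 = x₀.1 + (x.1 - x₀.1) := by ring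
  have e2 : x.2 = x₀.2 + (x.2 - x₀.2) := by ring
  rw [hopfBasis_expand hu (F q), (inv1 _).1, (inv1 _).2, (inv2 _).1, (inv2 _).2, g1, g2, g3, g4, torus,
    e1, e2, Real.cos_add, Real.cos_add, Real.sin_add, Real.sin_add]
  simp only [add_sub_cancel_left]
  congr 1
  · congr 1
    · congr 1
      · congr 1; ring
      · congr 1; ring
    · congr 1; ring
  · congr 1; ring

/-- The set of angle parameters whose torus point lies in f(M) is closed by compactness, open by the
previous lemma, and nonempty, in the connected plane. -/
theorem IsSmoothImmersion.torus_subset_range [CompactSpace M] [Nonempty M] (hf : IsSmoothImmersion f) {u : R4}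
    (hu : u 0 ^ 2 + u 1 ^ 2 + u 2 ^ 2 + u 3 ^ 2 = 1) {a c : ℝ} (ha : 0 < a) (hc : 0 < c)
    (h1 : ∀ y, inner ℝ (hopfBasis u 0) (f y : R4) ^ 2 + inner ℝ (hopfBasis u 1) (f y : R4) ^ 2 = a ^ 2)
    (h2 : ∀ y, inner ℝ (hopfBasis u 2) (f y : R4) ^ 2 + inner ℝ (hopfBasis u 3) (f y : R4) ^ 2 = c ^ 2)
    (x : ℝ × ℝ) : ∃ z, (f z : R4) = torus u a c x := by
  have hcl : IsClosed {x | ∃ z, (f z : R4) = torus u a c x} :=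
    (isCompact_range hf.contMDiff.continuous).isClosed.preimage (continuous_torus u a c)
  have hop : IsOpen {x | ∃ z, (f z : R4) = torus u a c x} := by
    rw [isOpen_iff_mem_nhds]
    rintro x ⟨y, hy⟩
    exact hf.torus_mem_nhds hu ha hc h1 h2 hy
  rcases isClopen_iff.1 ⟨hcl, hop⟩ with h | h
  · obtain ⟨y⟩ := (inferInstance : Nonempty M)
    obtain ⟨x, hx⟩ := exists_torus hu ha hc (h1 y) (h2 y)
    have : x ∈ {x | ∃ z, (f z : R4) = torus u a c x} := ⟨y, hx.symm⟩
    rw [h] at this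
    exact absurd this (notMem_empty _)
  · have : x ∈ {x | ∃ z, (f z : R4) = torus u a c x} := by rw [h]; exact mem_univ x
    exact this

end Berger

/-! ### The quadratic, the axis, and circles in the base. -/

namespace Berger

open Set Filter

/-- The value is -(P² + (κ - 4τ²) P (1 - C²)) with P = H² + τ². A nonpositive value also makes the
discriminant nonnegative, so that the two roots are real. -/
theorem quad_nonpos_at {κ τ H C : ℝ} (hκ : 4 * τ ^ 2 < κ) (hC : C ^ 2 ≤ 1) :
    (H ^ 2 + τ ^ 2) ^ 2 - quadB κ τ H C * (H ^ 2 + τ ^ 2) + quadC κ τ H C ≤ 0 := by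
  have e : (H ^ 2 + τ ^ 2) ^ 2 - quadB κ τ H C * (H ^ 2 + τ ^ 2) + quadC κ τ H C =
      -((H ^ 2 + τ ^ 2) ^ 2 + (κ - 4 * τ ^ 2) * (H ^ 2 + τ ^ 2) * (1 - C ^ 2)) := by
    rw [quadB, quadC]; ring
  have h1 : 0 ≤ κ - 4 * τ ^ 2 := by linarith
  have h2 : 0 ≤ 1 - C ^ 2 := by linarith
  rw [e, neg_nonpos]
  positivity

theorem quad_nonpos_of_roots {κ τ H C x : ℝ} (hκ : 4 * τ ^ 2 < κ) (hC : C ^ 2 ≤ 1)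
    (h1 : rootA κ τ H C ≤ x) (h2 : x ≤ rootB κ τ H C) :
    x ^ 2 - quadB κ τ H C * x + quadC κ τ H C ≤ 0 := by
  have h3 := quad_nonpos_at (H := H) hκ hC
  have hd : 0 ≤ quadB κ τ H C ^ 2 - 4 * quadC κ τ H C := by
    nlinarith [sq_nonneg (2 * (H ^ 2 + τ ^ 2) - quadB κ τ H C)]
  have hs := Real.sq_sqrt hd
  rw [rootA] at h1
  rw [rootB] at h2
  nlinarith [mul_nonneg (sub_nonneg.2 h1) (sub_nonneg.2 h2)]

/-- Convexity: the quadratic is nonpositive at P = H² + τ² and at 2P, where it equals -4(κ - 4τ²) P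
C². The identity `e` in the proof is linear interpolation between P and 2P plus the quadratic
remainder. -/
theorem quad_nonpos_of_mem_Icc {κ τ H C x : ℝ} (hτ : τ ≠ 0) (hκ : 4 * τ ^ 2 < κ) (hC : C ^ 2 ≤ 1)
    (h1 : H ^ 2 + τ ^ 2 ≤ x) (h2 : x ≤ 2 * (H ^ 2 + τ ^ 2)) :
    x ^ 2 - quadB κ τ H C * x + quadC κ τ H C ≤ 0 := by
  have h3 := quad_nonpos_at (H := H) hκ hC
  have hP : 0 < H ^ 2 + τ ^ 2 := by positivity
  have hD : 0 ≤ κ - 4 * τ ^ 2 := by linarith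
  have h4 : (2 * (H ^ 2 + τ ^ 2)) ^ 2 - quadB κ τ H C * (2 * (H ^ 2 + τ ^ 2)) + quadC κ τ H C ≤ 0 := by
    have e : (2 * (H ^ 2 + τ ^ 2)) ^ 2 - quadB κ τ H C * (2 * (H ^ 2 + τ ^ 2)) + quadC κ τ H C =
        -(4 * ((κ - 4 * τ ^ 2) * (H ^ 2 + τ ^ 2) * C ^ 2)) := by
      rw [quadB, quadC]; ring
    rw [e, neg_nonpos]
    positivity
  generalize H ^ 2 + τ ^ 2 = P at *
  generalize quadB κ τ H C = B at *
  generalize quadC κ τ H C = D at *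
  have e : P * (x ^ 2 - B * x + D) = P * ((x - P) * (x - 2 * P))
      + (2 * P - x) * (P ^ 2 - B * P + D) + (x - P) * ((2 * P) ^ 2 - B * (2 * P) + D) := by ring
  have h5 : P * (x ^ 2 - B * x + D) ≤ 0 := by
    rw [e]
    have a1 : (x - P) * (x - 2 * P) ≤ 0 := mul_nonpos_of_nonneg_of_nonpos (by linarith) (by linarith)
    have a2 := mul_nonpos_of_nonneg_of_nonpos hP.le a1
    have a3 := mul_nonpos_of_nonneg_of_nonpos (sub_nonneg.2 h2) h3
    have a4 := mul_nonpos_of_nonneg_of_nonpos (sub_nonneg.2 h1) h4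
    linarith
  by_contra hne
  exact absurd (mul_pos hP (not_le.1 hne)) (not_lt.2 h5)

theorem axis_smul {κ H s : ℝ} (hs : s * H = H) (x : R4) (n : Fin 3 → ℝ) (k : Fin 3) :
    axis κ H x (fun j => s * n j) k = s * axis κ H x n k := by
  fin_cases k <;> simp only [axis] <;> conv_lhs => rw [← hs]
  all_goals ring

/-- The axis is H times the unit vector p = √κ Π(x) plus √κ/2 times a unit vector orthogonal to p.
Points with a constant axis therefore project to a fixed circle. -/
theorem axis_dot {κ H : ℝ} (hκ : 0 < κ) {x : R4} (hx : x 0 ^ 2 + x 1 ^ 2 + x 2 ^ 2 + x 3 ^ 2 = 1)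
    {n : Fin 3 → ℝ} (hn : n 0 * n 0 + n 1 * n 1 = 1) :
    axis κ H x n 0 * (2 * (x 0 * x 2 + x 1 * x 3)) + axis κ H x n 1 * (2 * (x 1 * x 2 - x 0 * x 3))
      + axis κ H x n 2 * (x 0 ^ 2 + x 1 ^ 2 - x 2 ^ 2 - x 3 ^ 2) = H ∧
    axis κ H x n 0 ^ 2 + axis κ H x n 1 ^ 2 + axis κ H x n 2 ^ 2 = H ^ 2 + κ / 4 := by
  have hk := Real.sq_sqrt hκ.le
  simp only [axis]
  generalize √κ = s at *
  subst hk
  generalize x 0 = a at *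
  generalize x 1 = b at *
  generalize x 2 = c at *
  generalize x 3 = d at *
  generalize n 0 = m at *
  generalize n 1 = k at *
  constructor
  · linear_combination H * (a ^ 2 + b ^ 2 + c ^ 2 + d ^ 2 + 1) * hx
  · linear_combination (H ^ 2 + s ^ 2 / 4 * (m * m + k * k)) * (a ^ 2 + b ^ 2 + c ^ 2 + d ^ 2 + 1) * hx
      + s ^ 2 / 4 * hn

theorem exists_hopf_preimage {b0 b1 b2 : ℝ} (h : b0 ^ 2 + b1 ^ 2 + b2 ^ 2 = 1) :
    ∃ u : R4, u 0 ^ 2 + u 1 ^ 2 + u 2 ^ 2 + u 3 ^ 2 = 1 ∧ 2 * (u 0 * u 2 + u 1 * u 3) = b0 ∧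
      2 * (u 1 * u 2 - u 0 * u 3) = b1 ∧ u 0 ^ 2 + u 1 ^ 2 - u 2 ^ 2 - u 3 ^ 2 = b2 := by
  -- The pole b₂ = -1 is the image of (0, 1); elsewhere there is the section whose first coordinate
  -- is real, equal to √((1 + b₂)/2).
  by_cases hb : b2 = -1
  · subst hb
    have h0 : b0 = 0 := by nlinarith
    have h1 : b1 = 0 := by nlinarith
    exact ⟨!₂[0, 0, 1, 0], by simp, by simp [h0], by simp [h1], by simp⟩
  · have h1 : 0 < (1 + b2) / 2 := by
      have : -1 ≤ b2 := by nlinarith [sq_nonneg b0, sq_nonneg b1]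
      have := lt_of_le_of_ne this (Ne.symm hb)
      linarith
    have hs := Real.sq_sqrt h1.le
    have hp := Real.sqrt_pos.2 h1
    generalize √((1 + b2) / 2) = s at *
    have e : b2 = 2 * s ^ 2 - 1 := by linarith
    subst e
    refine ⟨!₂[s, 0, b0 / (2 * s), -b1 / (2 * s)], ?_, ?_, ?_, ?_⟩ <;> simp <;> field_simp
    · linear_combination h
    · linear_combination -h

/-- The coordinates of q in `hopfBasis u` are those of the unitary basis (u, v) of ℂ². The inner
product of the Hopf images is |q_u|² - |q_v|², so a circle around the image of u corresponds to a
torus of constant |q_u| and |q_v|. -/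
theorem hopf_dot (u q : R4) :
    (2 * (u 0 * u 2 + u 1 * u 3)) * (2 * (q 0 * q 2 + q 1 * q 3))
      + (2 * (u 1 * u 2 - u 0 * u 3)) * (2 * (q 1 * q 2 - q 0 * q 3))
      + (u 0 ^ 2 + u 1 ^ 2 - u 2 ^ 2 - u 3 ^ 2) * (q 0 ^ 2 + q 1 ^ 2 - q 2 ^ 2 - q 3 ^ 2) =
    inner ℝ (hopfBasis u 0) q ^ 2 + inner ℝ (hopfBasis u 1) q ^ 2 - inner ℝ (hopfBasis u 2) q ^ 2
      - inner ℝ (hopfBasis u 3) q ^ 2 ∧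
    (u 0 ^ 2 + u 1 ^ 2 + u 2 ^ 2 + u 3 ^ 2) * (q 0 ^ 2 + q 1 ^ 2 + q 2 ^ 2 + q 3 ^ 2) =
    inner ℝ (hopfBasis u 0) q ^ 2 + inner ℝ (hopfBasis u 1) q ^ 2 + inner ℝ (hopfBasis u 2) q ^ 2
      + inner ℝ (hopfBasis u 3) q ^ 2 := by
  obtain ⟨h0, h1, h2, h3⟩ := inner_hopfBasis u q
  rw [h0, h1, h2, h3]
  constructor <;> ring

/-- The circle onto which a torus projects. -/
def hopfCircle (κ : ℝ) (u : R4) (a c t : ℝ) : R3 :=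
  (1 / √κ) • ((a ^ 2 - c ^ 2) • !₂[2 * (u 0 * u 2 + u 1 * u 3), 2 * (u 1 * u 2 - u 0 * u 3),
      u 0 ^ 2 + u 1 ^ 2 - u 2 ^ 2 - u 3 ^ 2]
    + (2 * a * c) • (Real.cos t • !₂[u 0 * u 0 - u 1 * u 1 - u 2 * u 2 + u 3 * u 3,
        2 * (u 0 * u 1 + u 2 * u 3), 2 * (u 1 * u 3 - u 0 * u 2)]
      - Real.sin t • !₂[2 * (u 0 * u 1 - u 2 * u 3), u 1 * u 1 + u 3 * u 3 - u 0 * u 0 - u 2 * u 2,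
        -2 * (u 0 * u 3 + u 1 * u 2)]))

theorem hopfMap_torus (κ : ℝ) (u : R4) (a c : ℝ) (x : ℝ × ℝ) :
    hopfMap κ (torus u a c x) = hopfCircle κ u a c (x.1 - x.2) := by
  obtain ⟨t0, t1, t2, t3⟩ := torus_coord u a c x
  have p1 := Real.sin_sq_add_cos_sq x.1
  have p2 := Real.sin_sq_add_cos_sq x.2
  rw [hopfMap, hopfCircle, t0, t1, t2, t3, Real.cos_sub, Real.sin_sub]
  congr 1
  ext k
  fin_cases k <;> simp
  · linear_combination (2 * (u 0 * u 2 + u 1 * u 3)) * (a ^ 2 * p1 - c ^ 2 * p2)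
  · linear_combination (2 * (u 1 * u 2 - u 0 * u 3)) * (a ^ 2 * p1 - c ^ 2 * p2)
  · linear_combination (u 0 ^ 2 + u 1 ^ 2 - u 2 ^ 2 - u 3 ^ 2) * (a ^ 2 * p1 - c ^ 2 * p2)

theorem hopfCircle_deriv_ne {κ : ℝ} (hκ : 0 < κ) {u : R4}
    (hu : u 0 ^ 2 + u 1 ^ 2 + u 2 ^ 2 + u 3 ^ 2 = 1) {a c : ℝ} (ha : 0 < a) (hc : 0 < c) (t : ℝ) :
    deriv (hopfCircle κ u a c) t ≠ 0 := by
  set A : R3 := !₂[2 * (u 0 * u 2 + u 1 * u 3), 2 * (u 1 * u 2 - u 0 * u 3),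
      u 0 ^ 2 + u 1 ^ 2 - u 2 ^ 2 - u 3 ^ 2] with hA
  set B : R3 := !₂[u 0 * u 0 - u 1 * u 1 - u 2 * u 2 + u 3 * u 3,
        2 * (u 0 * u 1 + u 2 * u 3), 2 * (u 1 * u 3 - u 0 * u 2)] with hB
  set D : R3 := !₂[2 * (u 0 * u 1 - u 2 * u 3), u 1 * u 1 + u 3 * u 3 - u 0 * u 0 - u 2 * u 2,
        -2 * (u 0 * u 3 + u 1 * u 2)] with hD
  have hd : HasDerivAt (hopfCircle κ u a c) ((1 / √κ) • (2 * a * c) •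
      ((-Real.sin t) • B - Real.cos t • D)) t := by
    have := ((((Real.hasDerivAt_cos t).smul_const B).sub ((Real.hasDerivAt_sin t).smul_const D)).const_smul
      (2 * a * c)).const_add ((a ^ 2 - c ^ 2) • A)
    exact this.const_smul (1 / √κ)
  rw [hd.deriv]
  intro h0
  have hk : (1 / √κ) ≠ 0 := by
    have := Real.sqrt_pos.2 hκ
    positivity
  have h1 := ((smul_eq_zero.1 h0).resolve_left hk)
  have h2 := (smul_eq_zero.1 h1).resolve_left (by positivity)
  have e0 : -Real.sin t * (u 0 * u 0 - u 1 * u 1 - u 2 * u 2 + u 3 * u 3)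
      - Real.cos t * (2 * (u 0 * u 1 - u 2 * u 3)) = 0 := congrArg (fun v : R3 => v 0) h2
  have e1 : -Real.sin t * (2 * (u 0 * u 1 + u 2 * u 3))
      - Real.cos t * (u 1 * u 1 + u 3 * u 3 - u 0 * u 0 - u 2 * u 2) = 0 :=
    congrArg (fun v : R3 => v 1) h2
  have e2 : -Real.sin t * (2 * (u 1 * u 3 - u 0 * u 2))
      - Real.cos t * (-2 * (u 0 * u 3 + u 1 * u 2)) = 0 := congrArg (fun v : R3 => v 2) h2
  have p := Real.sin_sq_add_cos_sq t
  -- B and D are orthonormal, so -sin t B - cos t D has length one and cannot vanish.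
  have : (1 : ℝ) = (-Real.sin t * (u 0 * u 0 - u 1 * u 1 - u 2 * u 2 + u 3 * u 3)
      - Real.cos t * (2 * (u 0 * u 1 - u 2 * u 3))) ^ 2 + (-Real.sin t * (2 * (u 0 * u 1 + u 2 * u 3))
      - Real.cos t * (u 1 * u 1 + u 3 * u 3 - u 0 * u 0 - u 2 * u 2)) ^ 2
      + (-Real.sin t * (2 * (u 1 * u 3 - u 0 * u 2))
      - Real.cos t * (-2 * (u 0 * u 3 + u 1 * u 2))) ^ 2 := by
    linear_combination (-(u 0 ^ 2 + u 1 ^ 2 + u 2 ^ 2 + u 3 ^ 2 + 1) *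
      (Real.sin t ^ 2 + Real.cos t ^ 2)) * hu - p
  rw [e0, e1, e2] at this
  norm_num at this

theorem hopfCircle_contDiff (κ : ℝ) (u : R4) (a c : ℝ) : ContDiff ℝ ∞ (hopfCircle κ u a c) := by
  unfold hopfCircle
  have h1 : ContDiff ℝ ∞ Real.cos := Real.contDiff_cos
  have h2 : ContDiff ℝ ∞ Real.sin := Real.contDiff_sin
  fun_prop

theorem hopfCircle_dot {κ : ℝ} (hκ : 0 < κ) {u q : R4} (hu : u 0 ^ 2 + u 1 ^ 2 + u 2 ^ 2 + u 3 ^ 2 = 1)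
    {a c t : ℝ} (h : hopfMap κ q = hopfCircle κ u a c t) :
    inner ℝ (hopfBasis u 0) q ^ 2 + inner ℝ (hopfBasis u 1) q ^ 2 - inner ℝ (hopfBasis u 2) q ^ 2
      - inner ℝ (hopfBasis u 3) q ^ 2 = a ^ 2 - c ^ 2 := by
  have hk : (1 / √κ) ≠ 0 := by
    have := Real.sqrt_pos.2 hκ
    positivity
  have h1 := smul_right_injective R3 hk h
  have e0 := congrArg (fun v : R3 => v 0) h1
  have e1 := congrArg (fun v : R3 => v 1) h1
  have e2 := congrArg (fun v : R3 => v 2) h1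
  simp at e0 e1 e2
  rw [← (hopf_dot u q).1]
  linear_combination 2 * (u 0 * u 2 + u 1 * u 3) * e0 + 2 * (u 1 * u 2 - u 0 * u 3) * e1
    + (u 0 ^ 2 + u 1 ^ 2 - u 2 ^ 2 - u 3 ^ 2) * e2
    + (a ^ 2 - c ^ 2) * (u 0 ^ 2 + u 1 ^ 2 + u 2 ^ 2 + u 3 ^ 2 + 1) * hu

end Berger

/-! ### Surfaces with vanishing angle are Hopf cylinders. -/

namespace Berger

open Set Filter

variable {M : Type*} [TopologicalSpace M] [ChartedSpace E2 M] [IsManifold (𝓡 2) ∞ M] {f : M → S3}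
  {κ τ H : ℝ}

theorem IsUnitNormalOn.smul {N : M → R4} {U : Set M} (hN : IsUnitNormalOn κ τ f U N) {s : ℝ}
    (hs : s * s = 1) : IsUnitNormalOn κ τ f U (fun y => s • N y) where
  isOpen := hN.isOpen
  smooth := (contDiff_const_smul s).contMDiff.comp_contMDiffOn hN.smooth
  tangent x hx := by rw [real_inner_smul_left, hN.tangent x hx, mul_zero]
  unit x hx := by rw [metric_smul_left, metric_smul_right, hN.unit x hx, mul_one, hs]
  normal x hx v := by rw [metric_smul_left, hN.normal x hx v, mul_zero]

theorem IsUnitNormalOn.axis_eventually_eq (hκ : 0 < κ) (hτ : τ ≠ 0) (hf : IsSmoothImmersion f)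
    (hH : IsCMC κ τ H f) {U : Set M} {N : M → R4} (hN : IsUnitNormalOn κ τ f U N)
    (hm : ∀ y ∈ U, meanCurvature κ τ f N y = H) (h0 : ∀ y ∈ U, comp κ τ f N 2 y = 0) {y : M}
    (hy : y ∈ U) : ∀ᶠ z in nhds y, ∀ k, axis κ H (f z) (fun j => comp κ τ f N j z) k =
      axis κ H (f y) (fun j => comp κ τ f N j y) k := by
  obtain ⟨A, HC, CN, hD⟩ := hH.exists_normalData hκ hτ hf
  have hL := hN.localSurface hκ hτ hf hm y
  obtain ⟨h1, h2, h3⟩ := hD.chart hκ hτ hf hN hm y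
  have hp : extChartAt (𝓡 2) y y ∈ chartDom y U :=
    ⟨mem_extChartAt_target y, by rwa [mem_preimage, extChartAt_to_inv]⟩
  obtain ⟨r, hr, hball⟩ := Metric.isOpen_iff.1 hL.isOpen _ hp
  have hz : ∀ᶠ z in nhds y, z ∈ (extChartAt (𝓡 2) y).source ∧
      extChartAt (𝓡 2) y z ∈ Metric.ball (extChartAt (𝓡 2) y y) r :=
    Filter.Eventually.and (extChartAt_source_mem_nhds y)
      ((continuousAt_extChartAt y).eventually (Metric.ball_mem_nhds _ hr))
  filter_upwards [hz] with z hz k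
  have hd : DifferentiableOn ℝ (fun q => axis κ H (chartImm f y q) (fun j =>
      normalComp κ τ (chartImm f y) (chartField N y) j q) k) (Metric.ball (extChartAt (𝓡 2) y y) r) :=
    ((hL.contDiffOn_axis k).mono hball).differentiableOn (by simp)
  have he := Metric.isOpen_ball.is_const_of_fderiv_eq_zero (convex_ball _ _).isPreconnected hd
    (fun q hq => by
      ext v
      rw [fderiv_eq_sum_pd, hL.pd_axis hκ hτ h1 h2 h3 (fun p hp => h0 _ hp.2) (hball hq),
        hL.pd_axis hκ hτ h1 h2 h3 (fun p hp => h0 _ hp.2) (hball hq)]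
      simp) hz.2 (Metric.mem_ball_self hr)
  simp only [chartImm, normalComp_chart, (extChartAt (𝓡 2) y).left_inv hz.1, extChartAt_to_inv] at he
  exact he

/-- The axis is locally constant for each local normal. The points having some normal of mean
curvature H with axis b form an open and closed set, so one b serves all of M without a global
normal. -/
theorem IsCMC.exists_axis [ConnectedSpace M] (hκ : 0 < κ) (hτ : τ ≠ 0) (hf : IsSmoothImmersion f)
    (hH : IsCMC κ τ H f)
    (h0 : ∀ (U : Set M) (N : M → R4), IsUnitNormalOn κ τ f U N → ∀ y ∈ U, comp κ τ f N 2 y = 0) :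
    ∃ b : Fin 3 → ℝ, ∀ y, ∃ n : Fin 3 → ℝ, n 0 * n 0 + n 1 * n 1 = 1 ∧
      ∀ k, axis κ H (f y) n k = b k := by
  obtain ⟨y₀⟩ := (inferInstance : Nonempty M)
  obtain ⟨U₀, N₀, hU₀, hN₀, hm₀⟩ := hH y₀
  set b := fun k => axis κ H (f y₀) (fun j => comp κ τ f N₀ j y₀) k with hb
  let P : Set M := {y | ∃ (U : Set M) (N : M → R4), y ∈ U ∧ IsUnitNormalOn κ τ f U N ∧
    (∀ z ∈ U, meanCurvature κ τ f N z = H) ∧ ∀ k, axis κ H (f y) (fun j => comp κ τ f N j y) k = b k}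
  have hop : IsOpen P := by
    rw [isOpen_iff_mem_nhds]
    rintro y ⟨U, N, hU, hN, hm, hk⟩
    filter_upwards [hN.isOpen.mem_nhds hU, hN.axis_eventually_eq hκ hτ hf hH hm (h0 U N hN) hU] with
      z hz hz2
    exact ⟨U, N, hz, hN, hm, fun k => (hz2 k).trans (hk k)⟩
  have hcl : IsClosed P := by
    rw [← isOpen_compl_iff, isOpen_iff_mem_nhds]
    intro y hy
    obtain ⟨U, N, hU, hN, hm⟩ := hH y
    filter_upwards [hN.isOpen.mem_nhds hU, hN.axis_eventually_eq hκ hτ hf hH hm (h0 U N hN) hU] with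
      z hz hz2
    rintro ⟨U', N', hU', hN', hm', hk'⟩
    obtain ⟨s, hs, hev⟩ := hN.eventually_smul hκ hτ hf hN' hz hU'
    -- Two normals of mean curvature H can differ by a sign only if H = 0, and then sN is again a
    -- normal of mean curvature H.
    have hsH : s * H = H := by
      have := (hN.shapeMatrix_smul hκ hτ hf hz hev).1
      rw [hm' z hU', hm z hz] at this
      exact this.symm
    refine hy ⟨U, fun y => s • N y, hU, hN.smul hs, fun w hw => ?_, fun k => ?_⟩
    · rw [(hN.shapeMatrix_smul hκ hτ hf hw (Eventually.of_forall fun _ => rfl)).1, hm w hw, hsH]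
    · have e1 : (fun j => comp κ τ f (fun y => s • N y) j y) = fun j => s * comp κ τ f N j y := by
        funext j; exact IsUnitNormalOn.comp_smul rfl j
      have e2 : (fun j => comp κ τ f N' j z) = fun j => s * comp κ τ f N j z := by
        funext j; exact IsUnitNormalOn.comp_smul hev.self_of_nhds j
      rw [e1, axis_smul hsH, ← hk' k, e2, axis_smul hsH, hz2 k]
  refine ⟨b, fun y => ?_⟩
  have hy : y ∈ P := by
    rcases isClopen_iff.1 ⟨hcl, hop⟩ with h | h
    · have : y₀ ∈ P := ⟨U₀, N₀, hU₀, hN₀, hm₀, fun k => rfl⟩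
      rw [h] at this
      exact absurd this (notMem_empty _)
    · rw [h]; exact mem_univ y
  obtain ⟨U, N, hU, hN, hm, hk⟩ := hy
  refine ⟨fun j => comp κ τ f N j y, ?_, hk⟩
  have := hN.sum_sq_comp hκ hτ hU
  rwa [h0 U N hN y hU, mul_zero, add_zero] at this

theorem isHopfCylinder [CompactSpace M] [ConnectedSpace M] (hκ : 0 < κ) (hτ : τ ≠ 0)
    (hf : IsSmoothImmersion f) (hH : IsCMC κ τ H f)
    (h0 : ∀ (U : Set M) (N : M → R4), IsUnitNormalOn κ τ f U N → ∀ y ∈ U, comp κ τ f N 2 y = 0) :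
    IsHopfCylinder κ f := by
  obtain ⟨b, hb⟩ := hH.exists_axis hκ hτ hf h0
  have hdot := fun y => (hb y).elim fun n hn => by
    have := axis_dot (H := H) hκ (sphere_sum_sq (f y)) hn.1
    rw [hn.2, hn.2, hn.2] at this
    exact this
  obtain ⟨y₀⟩ := (inferInstance : Nonempty M)
  have hbn := (hdot y₀).2
  have hr : 0 < H ^ 2 + κ / 4 := by positivity
  set r := √(H ^ 2 + κ / 4) with hrdef
  have hrp : 0 < r := Real.sqrt_pos.2 hr
  have hr2 : r ^ 2 = H ^ 2 + κ / 4 := Real.sq_sqrt hr.le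
  obtain ⟨u, hu, u0, u1, u2⟩ := exists_hopf_preimage (b0 := b 0 / r) (b1 := b 1 / r) (b2 := b 2 / r) (by
    field_simp
    rw [hbn, hr2])
  -- Strict because κ > 0. Hence the circle is not a point: the radii a and c, fixed by a² + c² = 1
  -- and a² - c² = H/r, are both positive.
  have hlt : |H / r| < 1 := by
    rw [abs_div, abs_of_pos hrp, div_lt_one hrp]
    exact abs_lt_of_sq_lt_sq (by rw [hr2]; linarith) hrp.le
  obtain ⟨hl1, hl2⟩ := abs_lt.1 hlt
  have hap : 0 < (1 + H / r) / 2 := by linarith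
  have hcp : 0 < (1 - H / r) / 2 := by linarith
  set a := √((1 + H / r) / 2) with hadef
  set c := √((1 - H / r) / 2) with hcdef
  have ha : 0 < a := Real.sqrt_pos.2 hap
  have hc : 0 < c := Real.sqrt_pos.2 hcp
  have ha2 : a ^ 2 = (1 + H / r) / 2 := Real.sq_sqrt hap.le
  have hc2 : c ^ 2 = (1 - H / r) / 2 := Real.sq_sqrt hcp.le
  have hsum : ∀ q : S3, inner ℝ (hopfBasis u 0) (q : R4) ^ 2 + inner ℝ (hopfBasis u 1) (q : R4) ^ 2
      + inner ℝ (hopfBasis u 2) (q : R4) ^ 2 + inner ℝ (hopfBasis u 3) (q : R4) ^ 2 = 1 := by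
    intro q
    rw [← (hopf_dot u q).2, hu, sphere_sum_sq, one_mul]
  have hdiff : ∀ y, inner ℝ (hopfBasis u 0) (f y : R4) ^ 2 + inner ℝ (hopfBasis u 1) (f y : R4) ^ 2
      - inner ℝ (hopfBasis u 2) (f y : R4) ^ 2 - inner ℝ (hopfBasis u 3) (f y : R4) ^ 2 = H / r := by
    intro y
    rw [← (hopf_dot u (f y)).1, u0, u1, u2]
    field_simp
    have := (hdot y).1
    linarith
  have h1 : ∀ y, inner ℝ (hopfBasis u 0) (f y : R4) ^ 2 + inner ℝ (hopfBasis u 1) (f y : R4) ^ 2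
      = a ^ 2 := by
    intro y; have := hdiff y; have := hsum (f y); linarith
  have h2 : ∀ y, inner ℝ (hopfBasis u 2) (f y : R4) ^ 2 + inner ℝ (hopfBasis u 3) (f y : R4) ^ 2
      = c ^ 2 := by
    intro y; have := hdiff y; have := hsum (f y); linarith
  have hsub := hf.torus_subset_range hu ha hc h1 h2
  refine ⟨hopfCircle κ u a c, 2 * Real.pi, hopfCircle_contDiff κ u a c, by positivity, fun t => ?_,
    hopfCircle_deriv_ne hκ hu ha hc, fun t => ?_, ?_⟩
  · simp only [hopfCircle, Real.cos_add_two_pi, Real.sin_add_two_pi]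
  -- The circle point at t is the projection of the torus point (t, 0), which is a value of f and so
  -- lies on 𝕊³.
  · obtain ⟨z, hz⟩ := hsub (t, 0)
    have := hopfMap_mem κ (f z)
    rwa [hz, hopfMap_torus, sub_zero] at this
  · ext q
    constructor
    · rintro ⟨y, rfl⟩
      obtain ⟨x, hx⟩ := exists_torus hu ha hc (h1 y) (h2 y)
      exact ⟨x.1 - x.2, by rw [← hx, hopfMap_torus]⟩
    · rintro ⟨t, ht⟩
      have hd := hopfCircle_dot hκ hu ht.symm
      have hs := hsum q
      obtain ⟨x, hx⟩ := exists_torus hu ha hc (q := q) (by linarith) (by linarith)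
      obtain ⟨z, hz⟩ := hsub x
      exact ⟨z, Subtype.ext (hz.trans hx)⟩

end Berger

end

/-! ### The two pinching conditions. -/

theorem corollary1 (κ τ H : ℝ) (hτ : τ ≠ 0) (hκ : 4 * τ ^ 2 < κ)
    {M : Type*} [TopologicalSpace M] [ChartedSpace (EuclideanSpace ℝ (Fin 2)) M]
    [IsManifold (𝓡 2) ∞ M] [CompactSpace M] [ConnectedSpace M] [T2Space M]
    (f : M → Berger.S3) (hf : Berger.IsSmoothImmersion f) (hH : Berger.IsCMC κ τ H f) :
    ((∀ (U : Set M) (N : M → Berger.R4), Berger.IsUnitNormalOn κ τ f U N → ∀ x ∈ U,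
        Berger.rootA κ τ H (Berger.angle κ τ f N x) + 2 * H ^ 2 ≤ Berger.normSqA κ τ f N x ∧
        Berger.normSqA κ τ f N x ≤ Berger.rootB κ τ H (Berger.angle κ τ f N x) + 2 * H ^ 2) →
      Berger.IsHopfCylinder κ f ∧
        ∀ (U : Set M) (N : M → Berger.R4), Berger.IsUnitNormalOn κ τ f U N → ∀ x ∈ U,
          Berger.normSqA κ τ f N x = 2 * (2 * H ^ 2 + τ ^ 2)) ∧
    ((∀ (U : Set M) (N : M → Berger.R4), Berger.IsUnitNormalOn κ τ f U N → ∀ x ∈ U,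
        3 * H ^ 2 + τ ^ 2 ≤ Berger.normSqA κ τ f N x ∧
        Berger.normSqA κ τ f N x ≤ 2 * (2 * H ^ 2 + τ ^ 2)) →
      Berger.IsHopfCylinder κ f ∧
        ∀ (U : Set M) (N : M → Berger.R4), Berger.IsUnitNormalOn κ τ f U N → ∀ x ∈ U,
          Berger.normSqA κ τ f N x = 2 * (2 * H ^ 2 + τ ^ 2)) := by
  have hκ0 : 0 < κ := lt_of_le_of_lt (by positivity) hκ
  have hC : ∀ (U : Set M) (N : M → Berger.R4), Berger.IsUnitNormalOn κ τ f U N → ∀ x ∈ U,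
      Berger.angle κ τ f N x ^ 2 ≤ 1 := by
    intro U N hN x hx
    rw [Berger.angle_eq_comp]
    nlinarith [hN.sum_sq_comp hκ0 hτ hx, sq_nonneg (Berger.comp κ τ f N 0 x),
      sq_nonneg (Berger.comp κ τ f N 1 x)]
  have key := Berger.angle_eq_zero hτ hκ hf hH
  refine ⟨fun h => ?_, fun h => ?_⟩
  · have h0 := key fun U N hN x hx => by
      obtain ⟨h1, h2⟩ := h U N hN x hx
      exact Berger.quad_nonpos_of_roots hκ (hC U N hN x hx) (by linarith) (by linarith)
    exact ⟨Berger.isHopfCylinder hκ0 hτ hf hH fun U N hN y hy => (h0 U N hN y hy).1,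
      fun U N hN x hx => (h0 U N hN x hx).2⟩
  · have h0 := key fun U N hN x hx => by
      obtain ⟨h1, h2⟩ := h U N hN x hx
      exact Berger.quad_nonpos_of_mem_Icc hτ hκ (hC U N hN x hx) (by linarith) (by linarith)
    exact ⟨Berger.isHopfCylinder hκ0 hτ hf hH fun U N hN y hy => (h0 U N hN y hy).1,
      fun U N hN x hx => (h0 U N hN x hx).2⟩
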